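/- All graphs are finite and loopless but may have parallel edges; two parallel edges form a cycle of length $2$. A cycle $C$ of a connected graph $G$ is \emph{separating} if the graph $G\setminus E(C)$, obtained by deleting the edges of $C$ and keeping all vertices, is disconnected. Let $\mathcal S_{1,3}$ be the class of connected graphs with minimum degree at least $1$ and maximum degree at most $3$ in which every cycle is separating. Call $G\in\mathcal S_{1,3}$ a \emph{counterexample} if $G$ cannot be decomposed into a spanning tree and a matching, that is, if there is no partition $E(G)=E(T)\cup M$ in which $T$ is a spanning tree of $G$ and $M$ is a (possibly empty) matching. Call a counterexample $G$ \emph{minimum} if $|V(G)|+|E(G)|$ is minimum among all counterexamples. Let $V_k(G)$ denote the set of vertices of degree $k$ in $G$. **Theorem 3.3.** Every minimum counterexample $G$ satisfies the following properties: 1. $G$ is simple and $2$-edge-connected; 2. the girth of $G$ is at least $5$; 3. any two distinct vertices in $V_2(G)$ are at distance at least $3$ in $G$; 4. $G-V_2(G)$ is connected; 5. there is a cycle $C\subseteq G$ with $V(C)\subseteq V_3(G)$. -/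

import Mathlib

/-! Finite loopless multigraphs are modelled by Mathlib's `Graph α β`, whose vertex set `V(G)` is a
set in `α` and whose edge set `E(G)` is a set in `β`; parallel edges are distinct elements of `β`.
Subgraphs (`≤`), spanning subgraphs (`≤s`), deletion of edges and of vertices, and the
classes `Graph.Loopless` and `Graph.Simple` are Mathlib's. -/

namespace TwoDecomposition

open Graph

universe u v

variable {α : Type u} {β : Type v}

/-- `G` has at least one vertex, and any two of its vertices are joined by a walk. -/
def IsConnected (G : Graph α β) : Prop :=
  V(G).Nonempty ∧ ∀ x ∈ V(G), ∀ y ∈ V(G), Relation.ReflTransGen G.Adj x y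

/-- The degree of a vertex of a finite loopless multigraph: the number of edges at it, parallel
edges being counted separately. -/
noncomputable def degree (G : Graph α β) (x : α) : ℕ := (G.incidenceSet x).ncard

/-- The set `V_k(G)` of vertices of degree `k`. -/
def verticesOfDegree (G : Graph α β) (k : ℕ) : Set α := {x | x ∈ V(G) ∧ degree G x = k}

/-- `C` is a cycle: a connected 2-regular (finite, loopless) graph. Two vertices joined by two
parallel edges form a cycle with two edges. -/
structure IsCycle (C : Graph α β) : Prop where
  loopless : C.Loopless
  finite_vertexSet : V(C).Finite
  finite_edgeSet : E(C).Finite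
  connected : IsConnected C
  degree_eq_two : ∀ x ∈ V(C), degree C x = 2

/-- `T` is a tree: connected and acyclic (no loops, and no subgraph of `T` is a cycle). -/
structure IsTree (T : Graph α β) : Prop where
  loopless : T.Loopless
  connected : IsConnected T
  acyclic : ∀ C : Graph α β, C ≤ T → ¬ IsCycle C

/-- `M` is a matching of `G`: a set of edges, no two of which share an end. -/
def IsMatching (G : Graph α β) (M : Set β) : Prop :=
  M ⊆ E(G) ∧ ∀ e ∈ M, ∀ f ∈ M, ∀ x, G.Inc e x → G.Inc f x → e = f

/-- `G` decomposes into a spanning tree and a (possibly empty) matching: the edge set of `G` is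
the disjoint union of the edge set of the tree and the matching. -/
def HasTwoDecomposition (G : Graph α β) : Prop :=
  ∃ (T : Graph α β) (M : Set β), T ≤s G ∧ IsTree T ∧ IsMatching G M ∧
    Disjoint E(T) M ∧ E(T) ∪ M = E(G)

/-- The class `S_{p,q}`: finite connected loopless multigraphs with all degrees between
`p` and `q` in which every cycle `C` is separating, that is, `G \ E(C)` is disconnected. -/
structure MemS (p q : ℕ) (G : Graph α β) : Prop where
  loopless : G.Loopless
  finite_vertexSet : V(G).Finite
  finite_edgeSet : E(G).Finite
  connected : IsConnected G
  separating : ∀ C : Graph α β, C ≤ G → IsCycle C → ¬ IsConnected (G.deleteEdges E(C))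
  le_degree : ∀ x ∈ V(G), p ≤ degree G x
  degree_le : ∀ x ∈ V(G), degree G x ≤ q

/-- `G` is a counterexample to the statement that every graph in `S_{1,3}` decomposes into a
spanning tree and a matching. -/
def IsCounterexample (G : Graph α β) : Prop := MemS 1 3 G ∧ ¬ HasTwoDecomposition G

/-- `φ(G) = |V(G)| + |E(G)|`. -/
noncomputable def size (G : Graph α β) : ℕ := V(G).ncard + E(G).ncard

/-- A counterexample of minimum size among all counterexamples. -/
def IsMinimumCounterexample (G : Graph α β) : Prop :=
  IsCounterexample G ∧
    ∀ (α' : Type u) (β' : Type v) (H : Graph α' β'), IsCounterexample H → size G ≤ size H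

/-- `G` is `k`-edge-connected: it has at least two vertices, and deleting fewer than `k` edges
leaves it connected. -/
def IsEdgeConnected (k : ℕ) (G : Graph α β) : Prop :=
  V(G).Nontrivial ∧ ∀ F ⊆ E(G), F.encard < k → IsConnected (G.deleteEdges F)

/-- The girth of a loopless multigraph `G`: the minimum number of edges of a cycle of `G`, and `⊤` if `G` has no cycle. -/
noncomputable def girth (G : Graph α β) : ℕ∞ :=
  ⨅ (C : Graph α β) (_ : C ≤ G ∧ IsCycle C), E(C).encard

/-- The distance of two vertices (`⊤` if no path joins them), computed in the underlying simple
graph, which has the same vertices and the same adjacencies. -/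
noncomputable def dist (G : Graph α β) (x y : V(G)) : ℕ∞ := G.toSimpleGraph.edist x y

end TwoDecomposition

/-! ### Oriented finite multigraphs, cuts and critical graphs -/

namespace TwoDecomposition

open scoped Classical

/-! Connectivity is expressed by cuts (`Conn`: a vertex predicate that no edge of `F` separates is
constant) and cycles by elements of the cycle space over `ZMod 2` (`IsEven`). In a subcubic graph
each component of a nonempty even edge set is 2-regular, so "every cycle is separating" is the same
as "every nonzero even set is separating"; this is `Good`. A minimum counterexample becomes a
`Critical` graph. Most arguments then take one of two shapes: a cut with at most one edge is trivial
(no bridges), or a smaller graph `H` is built, shown to be good, and its decomposition is lifted to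
a forbidden one of the original graph.

Bridges: the decompositions of the two sides are joined by the bridge. Parallel edges: a cut left
after deleting the digon can be moved over either of its ends, which forces the graph to be the
digon itself.

Vertices of degree two: if `y` has degree two and `e = xy`, a decomposition of `G / e` would lift by
adding `e` to the tree. Hence `G / e` is not good, and `exists_even_of_deg_two` yields an even set
through `e` whose deletion leaves a graph that becomes connected once `x` and `y` are identified.
This excludes adjacent vertices of degree two. For two with a common neighbour `z`, their edges to
`z` are deleted and the two vertices are glued.

Short cycles: deleting a triangle or a quadrilateral leaves a nontrivial cut. Moving one vertex over
it would expose a bridge (`iff_of_pair`). This excludes triangles whose vertices all have degree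
three; one with a vertex of degree two is contracted. A quadrilateral is removed, and one path (if
it has a vertex of degree two) or two opposite paths through it are replaced by single edges.

Connectedness of the part of degree three (`iff_of_card_three`): a cut of it extends to a cut of the
whole graph, each of whose edges has an end of degree two whose other edge is uncut. The special
even set through one such edge must cross the cut again, at another vertex of degree two, which it
isolates; this is impossible.

Cycle in the part of degree three (`exists_even_three`): otherwise this part is a tree. Attaching
every vertex of degree two as a leaf gives a spanning tree, and since vertices of degree two are at
distance at least three, the remaining edges form a matching.

Trees are recognised by counting edges; `Conn.card_add_one_iff` identifies this with acyclicity
through the rank of the coboundary map. -/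

/-- A finite loopless multigraph whose edges carry an (arbitrary) orientation. -/
structure FinGraph (α β : Type*) where
  verts : Finset α
  edges : Finset β
  src : β → α
  tgt : β → α
  src_mem : ∀ e ∈ edges, src e ∈ verts
  tgt_mem : ∀ e ∈ edges, tgt e ∈ verts
  src_ne_tgt : ∀ e ∈ edges, src e ≠ tgt e

namespace FinGraph

variable {α β : Type*} {M : FinGraph α β} {e e₁ e₂ e₃ : β} {x y u v : α}
  {F F' : Set β} {f : α → Prop} {d : β → ZMod 2}

/-- The edge `e` has ends `x` and `y`. -/
def Link (M : FinGraph α β) (e : β) (x y : α) : Prop :=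
  e ∈ M.edges ∧ (M.src e = x ∧ M.tgt e = y ∨ M.src e = y ∧ M.tgt e = x)

/-- The set of edges at `x`. -/
noncomputable def inc (M : FinGraph α β) (x : α) : Finset β :=
  {e ∈ M.edges | M.src e = x ∨ M.tgt e = x}

/-- `f` does not separate the ends of any edge of `F`. -/
def Const (M : FinGraph α β) (F : Set β) (f : α → Prop) : Prop :=
  ∀ e ∈ F, f (M.src e) ↔ f (M.tgt e)

/-- The edge set `F` connects all vertices: no vertex bipartition avoids cutting `F`. -/
def Conn (M : FinGraph α β) (F : Set β) : Prop :=
  M.verts.Nonempty ∧ ∀ f, M.Const F f → ∀ x ∈ M.verts, ∀ y ∈ M.verts, f x → f y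

/-- `d` is an element of the cycle space over `ZMod 2`, written as orthogonality to all
coboundaries. -/
def IsEven (M : FinGraph α β) (d : β → ZMod 2) : Prop :=
  ∀ g : α → ZMod 2, ∑ e ∈ M.edges, d e * (g (M.src e) + g (M.tgt e)) = 0

/-- Connected, subcubic, and every nonzero element of the cycle space is separating. -/
structure Good (M : FinGraph α β) : Prop where
  conn : M.Conn M.edges
  sep : ∀ d, M.IsEven d → (∃ e ∈ M.edges, d e ≠ 0) → ¬ M.Conn {e | e ∈ M.edges ∧ d e = 0}
  deg_le : ∀ x ∈ M.verts, (M.inc x).card ≤ 3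

/-- The edges outside `F` form a matching. -/
def CoMatching (M : FinGraph α β) (F : Finset β) : Prop :=
  ∀ x, ∀ e ∈ M.inc x, e ∉ F → ∀ e' ∈ M.inc x, e' ∉ F → e = e'

/-- `M` decomposes into a spanning tree and a matching. -/
def Decomp (M : FinGraph α β) : Prop :=
  ∃ F ⊆ M.edges, M.Conn F ∧ F.card + 1 = M.verts.card ∧ M.CoMatching F

/-- A good graph without a decomposition all of whose smaller good graphs have one. -/
structure Critical (M : FinGraph α β) : Prop extends Good M where
  not_decomp : ¬ M.Decomp
  decomp_of_lt : ∀ H : FinGraph α β, H.Good →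
    H.verts.card + H.edges.card < M.verts.card + M.edges.card → H.Decomp

/-! ### Links and incidence -/

lemma mem_inc : e ∈ M.inc x ↔ e ∈ M.edges ∧ (M.src e = x ∨ M.tgt e = x) := by
  simp [inc]

lemma Link.mem (h : M.Link e x y) : e ∈ M.edges := h.1

lemma Link.symm (h : M.Link e x y) : M.Link e y x := ⟨h.1, h.2.symm⟩

lemma Link.left_mem (h : M.Link e x y) : x ∈ M.verts := by
  rcases h with ⟨he, ⟨rfl, -⟩ | ⟨-, rfl⟩⟩
  · exact M.src_mem e he
  · exact M.tgt_mem e he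

lemma Link.right_mem (h : M.Link e x y) : y ∈ M.verts := h.symm.left_mem

lemma Link.ne (h : M.Link e x y) : x ≠ y := by
  rcases h with ⟨he, ⟨rfl, rfl⟩ | ⟨rfl, rfl⟩⟩
  · exact M.src_ne_tgt e he
  · exact (M.src_ne_tgt e he).symm

lemma Link.mem_inc_left (h : M.Link e x y) : e ∈ M.inc x := by
  rcases h with ⟨he, ⟨rfl, rfl⟩ | ⟨rfl, rfl⟩⟩ <;> simp [mem_inc, he]

lemma Link.mem_inc_right (h : M.Link e x y) : e ∈ M.inc y := h.symm.mem_inc_left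

lemma Link.ends (h : M.Link e x y) (h' : M.Link e u v) : x = u ∧ y = v ∨ x = v ∧ y = u := by
  rcases h with ⟨he, ⟨rfl, rfl⟩ | ⟨rfl, rfl⟩⟩ <;> rcases h' with ⟨he, ⟨rfl, rfl⟩ | ⟨rfl, rfl⟩⟩ <;>
    simp

lemma Link.mem_inc_iff (h : M.Link e x y) : e ∈ M.inc u ↔ u = x ∨ u = y := by
  rcases h with ⟨he, ⟨rfl, rfl⟩ | ⟨rfl, rfl⟩⟩ <;> simp [mem_inc, he, eq_comm, or_comm]

lemma exists_link (h : e ∈ M.inc x) : ∃ y, M.Link e x y := by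
  rw [mem_inc] at h
  rcases h with ⟨he, rfl | rfl⟩
  · exact ⟨_, he, Or.inl ⟨rfl, rfl⟩⟩
  · exact ⟨_, he, Or.inr ⟨rfl, rfl⟩⟩

lemma link_src_tgt (h : e ∈ M.edges) : M.Link e (M.src e) (M.tgt e) := ⟨h, Or.inl ⟨rfl, rfl⟩⟩

lemma src_ne_of_notMem_inc (he : e ∈ M.edges) (h : e ∉ M.inc x) : M.src e ≠ x :=
  fun h' ↦ h (mem_inc.2 ⟨he, Or.inl h'⟩)

lemma tgt_ne_of_notMem_inc (he : e ∈ M.edges) (h : e ∉ M.inc x) : M.tgt e ≠ x :=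
  fun h' ↦ h (mem_inc.2 ⟨he, Or.inr h'⟩)

lemma Link.add_eq {R : Type*} [AddCommMonoid R] (h : M.Link e x y) (g : α → R) :
    g (M.src e) + g (M.tgt e) = g x + g y := by
  rcases h with ⟨he, ⟨rfl, rfl⟩ | ⟨rfl, rfl⟩⟩
  · rfl
  · exact add_comm _ _

/-! ### Functions constant along edges -/

lemma Const.mono (h : M.Const F f) (hF : F' ⊆ F) : M.Const F' f := fun e he ↦ h e (hF he)

lemma Const.link (h : M.Const F f) (he : e ∈ F) (hl : M.Link e x y) : f x ↔ f y := by
  have := h e he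
  rcases hl with ⟨-, ⟨rfl, rfl⟩ | ⟨rfl, rfl⟩⟩
  · exact this
  · exact this.symm

lemma Link.iff_of_src_tgt (hl : M.Link e x y) (h : f x ↔ f y) : f (M.src e) ↔ f (M.tgt e) := by
  rcases hl with ⟨-, ⟨rfl, rfl⟩ | ⟨rfl, rfl⟩⟩
  · exact h
  · exact h.symm

lemma Conn.iff (h : M.Conn F) (hf : M.Const F f) (hx : x ∈ M.verts) (hy : y ∈ M.verts) :
    f x ↔ f y :=
  ⟨h.2 f hf x hx y hy, h.2 f hf y hy x hx⟩

lemma Conn.mono (h : M.Conn F) (hF : F ⊆ F') : M.Conn F' :=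
  ⟨h.1, fun f hf ↦ h.2 f (hf.mono hF)⟩

/-! ### The cycle space -/

lemma IsEven.sum_inc (h : M.IsEven d) (x : α) : ∑ e ∈ M.inc x, d e = 0 := by
  have h1 := h (fun v ↦ if v = x then 1 else 0)
  rw [inc, Finset.sum_filter, ← h1]
  refine Finset.sum_congr rfl fun e he ↦ ?_
  have := M.src_ne_tgt e he
  by_cases h1 : M.src e = x <;> by_cases h2 : M.tgt e = x <;> simp_all

lemma IsEven.eq_of_inc_pair (h : M.IsEven d) (hx : M.inc x = {e₁, e₂}) (hne : e₁ ≠ e₂) :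
    d e₁ = d e₂ := by
  have := h.sum_inc x
  rw [hx, Finset.sum_pair hne] at this
  exact CharTwo.add_eq_zero.1 this

lemma zmod_two_eq_one {a : ZMod 2} (h : a ≠ 0) : a = 1 := by
  revert a; decide

/-! ### Bridges -/

/-- The subgraph induced by the vertices satisfying `f`. -/
noncomputable def side (M : FinGraph α β) (f : α → Prop) : FinGraph α β where
  verts := {x ∈ M.verts | f x}
  edges := {e ∈ M.edges | f (M.src e) ∧ f (M.tgt e)}
  src := M.src
  tgt := M.tgt
  src_mem e he := by
    simp only [Finset.mem_filter] at he ⊢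
    exact ⟨M.src_mem e he.1, he.2.1⟩
  tgt_mem e he := by
    simp only [Finset.mem_filter] at he ⊢
    exact ⟨M.tgt_mem e he.1, he.2.2⟩
  src_ne_tgt e he := M.src_ne_tgt e (Finset.mem_filter.1 he).1

lemma mem_side_verts : x ∈ (M.side f).verts ↔ x ∈ M.verts ∧ f x := by simp [side]

lemma mem_side_edges : e ∈ (M.side f).edges ↔ e ∈ M.edges ∧ f (M.src e) ∧ f (M.tgt e) := by
  simp [side]

lemma card_side_verts_add : (M.side f).verts.card + (M.side fun x ↦ ¬ f x).verts.card =
    M.verts.card := by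
  rw [← Finset.card_filter_add_card_filter_not (s := M.verts) f]
  congr! 2
  ext x
  simp [mem_side_verts]

lemma side_conn (hM : M.Conn M.edges) (hf : M.Const (M.edges \ {e} : Finset β) f)
    (he : M.Link e u v) (hu : f u) (hv : ¬ f v) : (M.side f).Conn (M.side f).edges := by
  refine ⟨⟨u, mem_side_verts.2 ⟨he.left_mem, hu⟩⟩, fun h hh x hx y hy ↦ ?_⟩
  -- Extending `h` over the other side by its value at `u` leaves the bridge uncut.
  have key : M.Const M.edges (fun w ↦ if f w then h w else h u) := by
    intro e' he'
    by_cases hee : e' = e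
    · subst hee
      exact he.iff_of_src_tgt (f := fun w ↦ if f w then h w else h u) (by simp [hu, hv])
    · have h1 := hf e' (by simp [hee, he'])
      have h2 : f (M.src e') → (h (M.src e') ↔ h (M.tgt e')) := fun h3 ↦
        hh e' (Finset.mem_coe.2 (mem_side_edges.2 ⟨he', h3, h1.1 h3⟩))
      by_cases h3 : f (M.src e')
      · simp only [if_pos h3, if_pos (h1.1 h3)]
        exact h2 h3
      · simp only [if_neg h3, if_neg (mt h1.2 h3)]
  have hx' := mem_side_verts.1 hx
  have hy' := mem_side_verts.1 hy
  have := (hM.iff key hx'.1 hy'.1).1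
  simpa [hx'.2, hy'.2] using this

/-- An even set of one side, extended by zero, is even in the whole graph. The other side and the
bridge avoid it, so if its deletion left this side connected, the whole graph would stay connected.
-/
lemma side_good (hM : M.Good) (hf : M.Const (M.edges \ {e} : Finset β) f)
    (he : M.Link e u v) (hu : f u) (hv : ¬ f v) : (M.side f).Good where
  conn := side_conn hM.conn hf he hu hv
  sep d hd := by
    rintro ⟨e', he', hde'⟩ hc
    have hf' : M.Const (M.edges \ {e} : Finset β) (fun x ↦ ¬ f x) := fun e he ↦ not_congr (hf e he)
    have hY := side_conn hM.conn hf' he.symm hv (not_not.2 hu)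
    refine hM.sep (fun e ↦ if e ∈ (M.side f).edges then d e else 0) (fun g ↦ ?_)
      ⟨e', (mem_side_edges.1 he').1, by simpa [he'] using hde'⟩ ⟨⟨u, he.left_mem⟩, fun h hh ↦ ?_⟩
    · refine Eq.trans (Eq.symm ?_) (hd g)
      refine Finset.sum_subset_zero_on_sdiff (fun e he ↦ (mem_side_edges.1 he).1) ?_ ?_
      · intro e he
        simp [(Finset.mem_sdiff.1 he).2]
      · intro e he
        beta_reduce
        rw [if_pos he]
        rfl
    · have hX : ∀ x ∈ M.verts, ∀ y ∈ M.verts, f x → f y → (h x ↔ h y) := by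
        intro x hx y hy hfx hfy
        refine hc.iff (f := h) ?_ (mem_side_verts.2 ⟨hx, hfx⟩) (mem_side_verts.2 ⟨hy, hfy⟩)
        intro e he
        exact hh e ⟨(mem_side_edges.1 he.1).1, by simp [he.2]⟩
      have hY' : ∀ x ∈ M.verts, ∀ y ∈ M.verts, ¬ f x → ¬ f y → (h x ↔ h y) := by
        intro x hx y hy hfx hfy
        refine hY.iff (f := h) ?_ (mem_side_verts.2 ⟨hx, hfx⟩) (mem_side_verts.2 ⟨hy, hfy⟩)
        intro e he
        have he := mem_side_edges.1 (Finset.mem_coe.1 he)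
        exact hh e ⟨he.1, by simp [mem_side_edges, he.2.1]⟩
      have huv : h u ↔ h v := by
        refine hh.link ⟨he.mem, ?_⟩ he
        have : e ∉ (M.side f).edges := by
          intro h'
          have h' := (mem_side_edges.1 h').2
          rcases he with ⟨-, ⟨rfl, rfl⟩ | ⟨rfl, rfl⟩⟩ <;> tauto
        simp [this]
      intro x hx y hy hxx
      by_cases hfx : f x <;> by_cases hfy : f y
      · exact (hX x hx y hy hfx hfy).1 hxx
      · exact (hY' v he.right_mem y hy hv hfy).1 (huv.1 ((hX x hx u he.left_mem hfx hu).1 hxx))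
      · exact (hX u he.left_mem y hy hu hfy).1 (huv.2 ((hY' x hx v he.right_mem hfx hv).1 hxx))
      · exact (hY' x hx y hy hfx hfy).1 hxx
  deg_le x hx := by
    refine le_trans (Finset.card_le_card fun e he ↦ ?_) (hM.deg_le x (mem_side_verts.1 hx).1)
    rw [mem_inc] at he ⊢
    exact ⟨(mem_side_edges.1 he.1).1, he.2⟩

lemma side_lt (he : M.Link e u v) (hv : ¬ f v) :
    (M.side f).verts.card + (M.side f).edges.card < M.verts.card + M.edges.card := by
  refine add_lt_add_of_lt_of_le (Finset.card_lt_card ?_) (Finset.card_filter_le _ _)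
  exact Finset.filter_ssubset.2 ⟨v, he.right_mem, hv⟩

/-- A critical graph has no bridge. -/
lemma Critical.bridgeless (hM : M.Critical) (he : e ∈ M.edges) :
    M.Conn (M.edges \ {e} : Finset β) := by
  refine ⟨hM.conn.1, fun f hf ↦ ?_⟩
  by_contra hcon
  have hne : ¬ (f (M.src e) ↔ f (M.tgt e)) := by
    intro h
    refine hcon (hM.conn.2 f fun e' he' ↦ ?_)
    by_cases hee : e' = e
    · rwa [hee]
    · exact hf e' (by simpa [hee] using he')
  obtain ⟨u, v, hl, hu, hv⟩ : ∃ u v, M.Link e u v ∧ f u ∧ ¬ f v := by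
    by_cases h : f (M.src e)
    · exact ⟨_, _, link_src_tgt he, h, by tauto⟩
    · exact ⟨_, _, (link_src_tgt he).symm, by tauto, h⟩
  have hf' : M.Const (M.edges \ {e} : Finset β) (fun x ↦ ¬ f x) := fun e he ↦ not_congr (hf e he)
  -- The trees of the two sides together with the bridge form a spanning tree of the whole graph.
  obtain ⟨F₁, hF₁, hc₁, hn₁, hm₁⟩ := hM.decomp_of_lt _
    (side_good hM.toGood hf hl hu hv) (side_lt hl hv)
  obtain ⟨F₂, hF₂, hc₂, hn₂, hm₂⟩ := hM.decomp_of_lt _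
    (side_good hM.toGood hf' hl.symm hv (not_not.2 hu)) (side_lt hl.symm (not_not.2 hu))
  have m₁ : ∀ e' ∈ F₁, e' ∈ M.edges ∧ f (M.src e') ∧ f (M.tgt e') := fun e' he' ↦
    mem_side_edges.1 (hF₁ he')
  have m₂ : ∀ e' ∈ F₂, e' ∈ M.edges ∧ ¬ f (M.src e') ∧ ¬ f (M.tgt e') := fun e' he' ↦
    mem_side_edges.1 (hF₂ he')
  -- Every edge at `x` other than the bridge lies on the side of `x`, so the edges omitted at `x`
  -- all come from one of the two matchings.
  have hmix : ∀ e' ∈ M.edges, e' ≠ e → ∀ x, (e' ∈ M.inc x) →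
      (f x ∧ e' ∈ (M.side f).inc x ∨ ¬ f x ∧ e' ∈ (M.side (fun x ↦ ¬ f x)).inc x) := by
    intro e' he' hne' x hx
    have h1 := hf e' (by simpa [hne'] using he')
    rw [mem_inc] at hx ⊢
    rw [mem_inc]
    simp only [mem_side_edges]
    change _ ∧ (_ ∧ (M.src e' = x ∨ M.tgt e' = x)) ∨ _ ∧ (_ ∧ (M.src e' = x ∨ M.tgt e' = x))
    rcases hx with ⟨-, rfl | rfl⟩ <;> tauto
  refine hM.not_decomp ⟨insert e (F₁ ∪ F₂), ?_, ⟨hM.conn.1, fun h hh ↦ ?_⟩, ?_, ?_⟩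
  · intro e' he'
    simp only [Finset.mem_insert, Finset.mem_union] at he'
    rcases he' with rfl | h | h
    · exact he
    · exact (m₁ e' h).1
    · exact (m₂ e' h).1
  · have huv : h u ↔ h v := hh.link (by simp) hl
    have hX : ∀ x ∈ M.verts, f x → (h x ↔ h u) := fun x hx hfx ↦
      hc₁.iff (f := h) (fun e' he' ↦ hh e' (by simp [Finset.mem_coe.1 he']))
        (mem_side_verts.2 ⟨hx, hfx⟩) (mem_side_verts.2 ⟨hl.left_mem, hu⟩)
    have hY : ∀ x ∈ M.verts, ¬ f x → (h x ↔ h v) := fun x hx hfx ↦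
      hc₂.iff (f := h) (fun e' he' ↦ hh e' (by simp [Finset.mem_coe.1 he']))
        (mem_side_verts.2 ⟨hx, hfx⟩) (mem_side_verts.2 ⟨hl.right_mem, hv⟩)
    have hall : ∀ x ∈ M.verts, (h x ↔ h u) := fun x hx ↦ by
      by_cases hfx : f x
      · exact hX x hx hfx
      · exact (hY x hx hfx).trans huv.symm
    exact fun x hx y hy hxx ↦ (hall y hy).2 ((hall x hx).1 hxx)
  · have h1 : e ∉ F₁ ∪ F₂ := by
      intro h
      rcases Finset.mem_union.1 h with h | h
      · exact hne (iff_of_true (m₁ e h).2.1 (m₁ e h).2.2)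
      · exact hne (iff_of_false (m₂ e h).2.1 (m₂ e h).2.2)
    have h2 : Disjoint F₁ F₂ := Finset.disjoint_left.2 fun a ha hb ↦ (m₂ a hb).2.1 (m₁ a ha).2.1
    rw [Finset.card_insert_of_notMem h1, Finset.card_union_of_disjoint h2,
      ← card_side_verts_add (f := f)]
    omega
  · intro x a ha haF b hb hbF
    simp only [Finset.mem_insert, Finset.mem_union, not_or] at haF hbF
    have h1 := hmix a (mem_inc.1 ha).1 haF.1 x ha
    have h2 := hmix b (mem_inc.1 hb).1 hbF.1 x hb
    rcases h1 with ⟨hx, h1⟩ | ⟨hx, h1⟩ <;> rcases h2 with ⟨hx', h2⟩ | ⟨hx', h2⟩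
    · exact hm₁ x a h1 haF.2.1 b h2 hbF.2.1
    · exact absurd hx hx'
    · exact absurd hx' hx
    · exact hm₂ x a h1 haF.2.2 b h2 hbF.2.2

/-- `Good` has no lower bound on degrees, so it admits the one-vertex graph. Since that graph
decomposes, allowing it creates no additional critical graph. -/
lemma decomp_of_subsingleton (hM : M.verts.Nonempty) {x : α} (hx : ∀ y ∈ M.verts, y = x) :
    M.Decomp := by
  obtain ⟨z, hz⟩ := hM
  have hE : M.edges = ∅ := by
    refine Finset.eq_empty_of_forall_notMem fun e he ↦ M.src_ne_tgt e he ?_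
    rw [hx _ (M.src_mem e he), hx _ (M.tgt_mem e he)]
  refine ⟨∅, by simp, ⟨⟨z, hz⟩, ?_⟩, ?_, ?_⟩
  · intro f _ a ha b hb
    rw [hx a ha, hx b hb]; exact id
  · have : M.verts = {x} := by
      ext a
      simp only [Finset.mem_singleton]
      exact ⟨hx a, fun h ↦ by rw [h, ← hx z hz]; exact hz⟩
    simp [this]
  · intro x e he
    simp [mem_inc, hE] at he

/-- A critical graph has at least two vertices. -/
lemma Critical.nontrivial (hM : M.Critical) : ∀ x, ∃ y ∈ M.verts, y ≠ x := by
  by_contra! h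
  obtain ⟨x, hx⟩ := h
  exact hM.not_decomp (decomp_of_subsingleton hM.conn.1 hx)

end FinGraph

namespace FinGraph

variable {α β : Type*} {M : FinGraph α β} {a b e e₁ e₂ e₃ : β} {x y z u v : α}
  {F F' : Set β} {f : α → Prop} {d : β → ZMod 2}

/-! ### Consequences of criticality at a single vertex -/

/-- Moving a single vertex `z` across a cut changes only the edges at `z`. This is the basic
operation on cuts below. -/
lemma const_update {q : Prop} (hF : F ⊆ M.edges)
    (h1 : ∀ e ∈ F, e ∉ M.inc z → (f (M.src e) ↔ f (M.tgt e)))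
    (h2 : ∀ e ∈ F, ∀ w, M.Link e z w → (q ↔ f w)) :
    M.Const F (fun v ↦ if v = z then q else f v) := by
  intro e he
  by_cases hz : e ∈ M.inc z
  · obtain ⟨w, hw⟩ := exists_link hz
    refine hw.iff_of_src_tgt (f := fun v ↦ if v = z then q else f v) ?_
    simpa [hw.ne.symm] using h2 e he w hw
  · simpa only [if_neg (src_ne_of_notMem_inc (hF he) hz), if_neg (tgt_ne_of_notMem_inc (hF he) hz)]
      using h1 e he hz

/-- The form in which bridgelessness is used: a cut with at most one edge is trivial. -/
lemma Critical.iff_of_bridge (hM : M.Critical) (he : e ∈ M.edges)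
    (hf : ∀ e' ∈ M.edges, e' ≠ e → (f (M.src e') ↔ f (M.tgt e'))) (hx : x ∈ M.verts)
    (hy : y ∈ M.verts) : f x ↔ f y :=
  (hM.bridgeless he).iff (fun e' he' ↦ hf e' (by simp_all) (by simp_all)) hx hy

lemma Critical.two_le_card_inc (hM : M.Critical) (hx : x ∈ M.verts) : 2 ≤ (M.inc x).card := by
  by_contra! h
  obtain ⟨y, hy, hyx⟩ := hM.nontrivial x
  have key : ∀ e ∈ M.edges, e ∉ M.inc x → (M.src e = x ↔ M.tgt e = x) := fun e he h ↦
    iff_of_false (src_ne_of_notMem_inc he h) (tgt_ne_of_notMem_inc he h)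
  rcases Nat.lt_succ_iff_lt_or_eq.1 h with h | h
  · rw [Nat.lt_one_iff, Finset.card_eq_zero] at h
    exact hyx ((hM.conn.iff (f := (· = x)) (fun e he ↦ key e he (by simp [h])) hx hy).1 rfl)
  · obtain ⟨e, he⟩ := Finset.card_eq_one.1 h
    have heE : e ∈ M.edges := (mem_inc.1 (he ▸ Finset.mem_singleton_self e)).1
    exact hyx ((hM.iff_of_bridge (f := (· = x)) heE
      (fun e' he' hne ↦ key e' he' (by simp [he, hne])) hx hy).1 rfl)

lemma Critical.card_inc (hM : M.Critical) (hx : x ∈ M.verts) :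
    (M.inc x).card = 2 ∨ (M.inc x).card = 3 := by
  have := hM.two_le_card_inc hx
  have := hM.deg_le x hx
  omega

lemma exists_inc_eq_pair (hx : (M.inc x).card = 2) (he : e ∈ M.inc x) :
    ∃ a y, a ≠ e ∧ M.inc x = {e, a} ∧ M.Link a x y := by
  obtain ⟨p, q, hpq, h⟩ := Finset.card_eq_two.1 hx
  have : ∃ a, a ≠ e ∧ M.inc x = {e, a} := by
    rw [h] at he ⊢
    simp only [Finset.mem_insert, Finset.mem_singleton] at he
    rcases he with rfl | rfl
    · exact ⟨q, hpq.symm, rfl⟩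
    · exact ⟨p, hpq, Finset.pair_comm _ _⟩
  obtain ⟨a, ha, h⟩ := this
  obtain ⟨y, hy⟩ := exists_link (M := M) (e := a) (x := x) (by simp [h])
  exact ⟨a, y, ha, h, hy⟩

lemma exists_inc_eq_triple (hx : (M.inc x).card = 3) (h₁ : e₁ ∈ M.inc x) (h₂ : e₂ ∈ M.inc x)
    (hne : e₁ ≠ e₂) : ∃ a y, a ≠ e₁ ∧ a ≠ e₂ ∧ M.inc x = {e₁, e₂, a} ∧ M.Link a x y := by
  have h : ((M.inc x).erase e₁ |>.erase e₂).card = 1 := by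
    rw [Finset.card_erase_of_mem (by simp [h₂, hne.symm]), Finset.card_erase_of_mem h₁, hx]
  obtain ⟨a, ha⟩ := Finset.card_eq_one.1 h
  have hmem : a ∈ ((M.inc x).erase e₁ |>.erase e₂) := by simp [ha]
  simp only [Finset.mem_erase] at hmem
  obtain ⟨y, hy⟩ := exists_link hmem.2.2
  refine ⟨a, y, hmem.2.1, hmem.1, ?_, hy⟩
  rw [← Finset.insert_erase h₁, ← Finset.insert_erase (a := e₂) (s := (M.inc x).erase e₁)
    (by simp [h₂, hne.symm]), ha]

/-! ### Parallel edges -/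

/-- Moving `u` to the side of `v` uncuts both parallel edges. If `u` had a third edge, that edge
alone would then be cut and would be a bridge. With no third edge nothing is cut any more, so all
vertices other than `u` lie on the side of `v`. -/
lemma Critical.digon_aux (hM : M.Critical) (h₁ : M.Link e₁ u v) (h₂ : M.Link e₂ u v)
    (hne : e₁ ≠ e₂) (hf : ∀ e ∈ M.edges, e ≠ e₁ → e ≠ e₂ → (f (M.src e) ↔ f (M.tgt e)))
    (huv : ¬ (f u ↔ f v)) : M.inc u = {e₁, e₂} ∧ ∀ x ∈ M.verts, x ≠ u → (f x ↔ f v) := by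
  have hoff : ∀ e ∈ M.edges, e ∉ M.inc u → (f (M.src e) ↔ f (M.tgt e)) := fun e he h ↦
    hf e he (fun h' ↦ h (h' ▸ h₁.mem_inc_left)) (fun h' ↦ h (h' ▸ h₂.mem_inc_left))
  have hinc : M.inc u = {e₁, e₂} := by
    rcases hM.card_inc h₁.left_mem with h | h
    · obtain ⟨a, w, ha, h, -⟩ := exists_inc_eq_pair h h₁.mem_inc_left
      have := h ▸ h₂.mem_inc_left
      simp only [Finset.mem_insert, hne.symm, Finset.mem_singleton, false_or] at this
      rw [h, this]
    · obtain ⟨a, w, ha₁, ha₂, h, ha⟩ := exists_inc_eq_triple h h₁.mem_inc_left h₂.mem_inc_left hne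
      exfalso
      have hup := const_update (M := M) (z := u) (q := f v) (f := f) (F := M.edges \ {a})
        Set.sdiff_subset (fun e he h ↦ hoff e he.1 h) (by
          rintro e ⟨he, hea⟩ w hw
          have := h ▸ hw.mem_inc_left
          simp only [Finset.mem_insert, Finset.mem_singleton] at this hea
          rcases this with rfl | rfl | rfl
          · rcases hw.ends h₁ with ⟨-, rfl⟩ | ⟨rfl, rfl⟩
            · rfl
            · exact absurd rfl hw.ne
          · rcases hw.ends h₂ with ⟨-, rfl⟩ | ⟨rfl, rfl⟩
            · rfl
            · exact absurd rfl hw.ne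
          · exact absurd rfl hea)
      have h1 := hM.iff_of_bridge (f := fun v' ↦ if v' = u then f v else f v') ha.mem
        (fun e' he' hne' ↦ hup e' ⟨he', hne'⟩)
        ha.left_mem ha.right_mem
      have h2 : f u ↔ f w := by
        have := hf a ha.mem ha₁ ha₂
        rcases ha with ⟨-, ⟨h, h'⟩ | ⟨h, h'⟩⟩
        · rwa [h, h'] at this
        · rw [h, h'] at this; exact this.symm
      simp only [if_true, if_neg ha.ne.symm] at h1
      exact huv (h2.trans h1.symm)
  refine ⟨hinc, fun x hx hxu ↦ ?_⟩
  have hup := const_update (M := M) (z := u) (q := f v) (f := f) (F := M.edges)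
    subset_rfl (fun e he h ↦ hoff e he h) (by
      intro e he w hw
      have := hinc ▸ hw.mem_inc_left
      simp only [Finset.mem_insert, Finset.mem_singleton] at this
      rcases this with rfl | rfl
      · rcases hw.ends h₁ with ⟨-, rfl⟩ | ⟨rfl, rfl⟩
        · rfl
        · exact absurd rfl hw.ne
      · rcases hw.ends h₂ with ⟨-, rfl⟩ | ⟨rfl, rfl⟩
        · rfl
        · exact absurd rfl hw.ne)
  simpa [hxu] using hM.conn.iff hup hx h₁.left_mem

/-- If the edges of a closed set are deleted from a good graph, some bipartition avoids cutting
the remaining edges. -/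
lemma Good.exists_cut (hM : M.Good) (hd : M.IsEven d) (he : e ∈ M.edges) (hde : d e ≠ 0) :
    ∃ f : α → Prop, (∀ e ∈ M.edges, d e = 0 → (f (M.src e) ↔ f (M.tgt e))) ∧
      ∃ x ∈ M.verts, ∃ y ∈ M.verts, f x ∧ ¬ f y := by
  by_contra! hcon
  exact hM.sep d hd ⟨e, he, hde⟩
    ⟨hM.conn.1, fun f hf ↦ hcon f fun e he hd ↦ hf e ⟨he, hd⟩⟩

lemma isEven_indicator (C : Finset β) (hC : C ⊆ M.edges)
    (h : ∀ g : α → ZMod 2, ∑ e ∈ C, (g (M.src e) + g (M.tgt e)) = 0) :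
    M.IsEven (fun e ↦ if e ∈ C then 1 else 0) := by
  intro g
  refine Eq.trans (Finset.sum_subset_zero_on_sdiff hC ?_ ?_).symm (h g)
  · intro e he
    simp [(Finset.mem_sdiff.1 he).2]
  · intro e he
    simp [he]

/-- Deleting the edges of a closed set `C`, some bipartition avoids cutting the remaining edges. -/
lemma Good.exists_cut_of_closed (hM : M.Good) (C : Finset β) (hC : C ⊆ M.edges) (hne : C.Nonempty)
    (h : ∀ g : α → ZMod 2, ∑ e ∈ C, (g (M.src e) + g (M.tgt e)) = 0) :
    ∃ f : α → Prop, (∀ e ∈ M.edges, e ∉ C → (f (M.src e) ↔ f (M.tgt e))) ∧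
      ∃ x ∈ M.verts, ∃ y ∈ M.verts, f x ∧ ¬ f y := by
  obtain ⟨e, he⟩ := hne
  obtain ⟨f, hf, h⟩ := hM.exists_cut (isEven_indicator C hC h) (hC he) (by simp [he])
  exact ⟨f, fun e he heC ↦ hf e he (by simp [heC]), h⟩

/-- A critical graph has no parallel edges. -/
lemma Critical.eq_of_link (hM : M.Critical) (h₁ : M.Link e₁ u v) (h₂ : M.Link e₂ u v) :
    e₁ = e₂ := by
  by_contra hne
  obtain ⟨f, hf, x, hx, y, hy, hfx, hfy⟩ := hM.exists_cut_of_closed {e₁, e₂}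
    (by simp [Finset.insert_subset_iff, h₁.mem, h₂.mem]) ⟨e₁, by simp⟩ (fun g ↦ by
      rw [Finset.sum_pair hne, h₁.add_eq, h₂.add_eq, CharTwo.add_self_eq_zero])
  have hf' : ∀ e ∈ M.edges, e ≠ e₁ → e ≠ e₂ → (f (M.src e) ↔ f (M.tgt e)) := fun e he h h' ↦
    hf e he (by simp [h, h'])
  have huv : ¬ (f u ↔ f v) := by
    intro h
    refine hfy (hM.conn.2 f (fun e he ↦ ?_) x hx y hy hfx)
    by_cases he₁ : e = e₁
    · exact he₁ ▸ h₁.iff_of_src_tgt h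
    by_cases he₂ : e = e₂
    · exact he₂ ▸ h₂.iff_of_src_tgt h
    exact hf' e he he₁ he₂
  obtain ⟨hu, hu'⟩ := hM.digon_aux h₁ h₂ hne hf' huv
  obtain ⟨-, hv'⟩ := hM.digon_aux h₁.symm h₂.symm hne hf' (fun h ↦ huv h.symm)
  -- A third vertex would lie on the side of `u` and on that of `v`. Hence the graph is a digon,
  -- which decomposes.
  have hV : ∀ w ∈ M.verts, w = u ∨ w = v := by
    intro w hw
    by_contra! h
    exact huv ((hv' w hw h.2).symm.trans (hu' w hw h.1))
  have hE : ∀ e ∈ M.edges, e = e₁ ∨ e = e₂ := by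
    intro e he
    have : e ∈ M.inc u := by
      rw [mem_inc]
      refine ⟨he, ?_⟩
      have := M.src_ne_tgt e he
      rcases hV _ (M.src_mem e he) with h | h
      · exact Or.inl h
      · rcases hV _ (M.tgt_mem e he) with h' | h'
        · exact Or.inr h'
        · exact absurd (h.trans h'.symm) this
    simpa [hu] using this
  refine hM.not_decomp ⟨{e₁}, by simpa using h₁.mem, ⟨hM.conn.1, fun g hg ↦ ?_⟩, ?_, ?_⟩
  · have h : g u ↔ g v := hg.link (by simp) h₁
    intro x hx y hy
    rcases hV x hx with rfl | rfl <;> rcases hV y hy with rfl | rfl <;> simp [h]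
  · have : M.verts = {u, v} := by
      ext w
      simp only [Finset.mem_insert, Finset.mem_singleton]
      refine ⟨hV w, ?_⟩
      rintro (rfl | rfl)
      exacts [h₁.left_mem, h₁.right_mem]
    rw [this, Finset.card_pair h₁.ne]
    rfl
  · intro x a ha ha' b hb hb'
    rcases hE a (mem_inc.1 ha).1 with rfl | rfl <;> rcases hE b (mem_inc.1 hb).1 with rfl | rfl <;>
      simp_all

/-! ### Identifying vertices -/

/-- The graph on `V'` whose edges are those of `E'`, with ends moved along `φ`. -/
def quot (M : FinGraph α β) (φ : α → α) (V' : Finset α) (E' : Finset β)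
    (hs : ∀ e ∈ E', φ (M.src e) ∈ V') (ht : ∀ e ∈ E', φ (M.tgt e) ∈ V')
    (hne : ∀ e ∈ E', φ (M.src e) ≠ φ (M.tgt e)) : FinGraph α β where
  verts := V'
  edges := E'
  src := φ ∘ M.src
  tgt := φ ∘ M.tgt
  src_mem := hs
  tgt_mem := ht
  src_ne_tgt := hne

section Quot

variable {φ : α → α} {V' : Finset α} {E' : Finset β} {hs : ∀ e ∈ E', φ (M.src e) ∈ V'}
  {ht : ∀ e ∈ E', φ (M.tgt e) ∈ V'} {hne : ∀ e ∈ E', φ (M.src e) ≠ φ (M.tgt e)}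

lemma mem_inc_quot : e ∈ (M.quot φ V' E' hs ht hne).inc x ↔
    e ∈ E' ∧ (φ (M.src e) = x ∨ φ (M.tgt e) = x) := mem_inc

lemma Link.quot (h : M.Link e x y) (he : e ∈ E') :
    (M.quot φ V' E' hs ht hne).Link e (φ x) (φ y) := by
  rcases h with ⟨-, ⟨rfl, rfl⟩ | ⟨rfl, rfl⟩⟩
  exacts [⟨he, Or.inl ⟨rfl, rfl⟩⟩, ⟨he, Or.inr ⟨rfl, rfl⟩⟩]

lemma mem_inc_quot_of_mem_inc (h : e ∈ M.inc x) (he : e ∈ E') :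
    e ∈ (M.quot φ V' E' hs ht hne).inc (φ x) := by
  obtain ⟨y, hy⟩ := exists_link h
  exact (hy.quot he).mem_inc_left

lemma mem_inc_of_mem_inc_quot (h : e ∈ (M.quot φ V' E' hs ht hne).inc x) (hE : E' ⊆ M.edges) :
    ∃ z, φ z = x ∧ e ∈ M.inc z := by
  rw [mem_inc_quot] at h
  rcases h with ⟨he, h | h⟩
  · exact ⟨_, h, mem_inc.2 ⟨hE he, Or.inl rfl⟩⟩
  · exact ⟨_, h, mem_inc.2 ⟨hE he, Or.inr rfl⟩⟩

end Quot

/-- Evenness may be tested separately on functions factoring through `φ` and on their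
complement. -/
lemma isEven_of_map (φ : α → α)
    (h₁ : ∀ g : α → ZMod 2, ∑ e ∈ M.edges, d e * (g (φ (M.src e)) + g (φ (M.tgt e))) = 0)
    (h₂ : ∀ g : α → ZMod 2, ∑ e ∈ M.edges, d e *
      ((g (M.src e) + g (φ (M.src e))) + (g (M.tgt e) + g (φ (M.tgt e)))) = 0) :
    M.IsEven d := by
  intro g
  -- In characteristic two, `g` is the sum of `g ∘ φ` and `g + g ∘ φ`.
  have h := congrArg₂ (· + ·) (h₁ g) (h₂ g)
  simp only [add_zero, ← Finset.sum_add_distrib] at h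
  rw [← h]
  refine Finset.sum_congr rfl fun e _ ↦ ?_
  rw [← mul_add]
  congr 1
  linear_combination (-(g (φ (M.src e)) + g (φ (M.tgt e)))) * CharTwo.two_eq_zero (R := ZMod 2)

/-! ### Contracting an edge at a vertex of degree two -/

/-- In a critical graph, contracting the edge `e = xy` at a vertex `y` of degree two destroys the
separation property, so some closed set through `e` separates `y` only. -/
lemma Critical.exists_even_of_deg_two (hM : M.Critical) (he : M.Link e x y)
    (hy : M.inc y = {e, b}) (hbe : b ≠ e) :
    ∃ d, M.IsEven d ∧ d e = 1 ∧ ∀ f : α → Prop,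
      (∀ e' ∈ M.edges, d e' = 0 → (f (M.src e') ↔ f (M.tgt e'))) → (f x ↔ f y) →
        ∀ u ∈ M.verts, ∀ v ∈ M.verts, f u → f v := by
  set φ : α → α := fun w ↦ if w = y then x else w with hφ
  have hφy : φ y = x := by simp [hφ]
  have hφn : ∀ w, w ≠ y → φ w = w := fun w hw ↦ by simp [hφ, hw]
  have hφx : φ x = x := hφn x he.ne
  have hφV : ∀ w ∈ M.verts, φ w ∈ M.verts.erase y := by
    intro w hw
    by_cases h : w = y
    · rw [h, hφy]; exact Finset.mem_erase.2 ⟨he.ne, he.left_mem⟩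
    · rw [hφn w h]; exact Finset.mem_erase.2 ⟨h, hw⟩
  have hfφ : ∀ f : α → Prop, (f x ↔ f y) → ∀ w, f (φ w) ↔ f w := by
    intro f hf w
    by_cases h : w = y
    · rw [h, hφy]; exact hf
    · rw [hφn w h]
  have hE : ∀ e' ∈ M.edges.erase e, e' ∈ M.edges := fun e' ↦ Finset.mem_of_mem_erase
  -- Contraction of `e`, with `x` kept as the merged vertex. A loop would come from an edge parallel
  -- to `e`.
  let H := M.quot φ (M.verts.erase y) (M.edges.erase e)
    (fun e' h ↦ hφV _ (M.src_mem e' (hE e' h))) (fun e' h ↦ hφV _ (M.tgt_mem e' (hE e' h))) (by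
      intro e' h heq
      have hl := link_src_tgt (hE e' h)
      refine (Finset.mem_erase.1 h).1 (hM.eq_of_link (e₂ := e) (u := x) (v := y) ?_ he)
      by_cases hs : M.src e' = y
      · have ht : M.tgt e' ≠ y := fun ht ↦ hl.ne (hs.trans ht.symm)
        rw [hs, hφy, hφn _ ht] at heq
        rw [hs, ← heq] at hl
        exact hl.symm
      · by_cases ht : M.tgt e' = y
        · rw [ht, hφy, hφn _ hs] at heq
          rwa [ht, heq] at hl
        · rw [hφn _ hs, hφn _ ht] at heq
          exact absurd heq hl.ne)
  have hHne : H.verts.Nonempty := ⟨x, Finset.mem_erase.2 ⟨he.ne, he.left_mem⟩⟩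
  have hconn : H.Conn H.edges := by
    refine ⟨hHne, fun f hf u hu v hv hfu ↦ ?_⟩
    have hu := Finset.mem_erase.1 hu
    have hv := Finset.mem_erase.1 hv
    have := (hM.conn.iff (f := f ∘ φ) (fun e' he' ↦ ?_) hu.2 hv.2)
    · simp only [Function.comp_apply, hφn _ hu.1, hφn _ hv.1] at this
      exact this.1 hfu
    · by_cases h : e' = e
      · rw [h]; exact he.iff_of_src_tgt (f := f ∘ φ) (by simp [hφx, hφy])
      · exact hf e' (by simpa [H, quot, h] using he')
  have hdeg : ∀ w ∈ H.verts, (H.inc w).card ≤ 3 := by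
    intro w hw
    have hw := Finset.mem_erase.1 hw
    -- The merged vertex loses `e` and gains only `b`, so its degree does not exceed that of `x`.
    -- This is where degree two of `y` keeps the contraction subcubic.
    have hsub : H.inc w ⊆ if w = x then insert b ((M.inc x).erase e) else M.inc w := by
      intro e' he'
      have hE' := (mem_inc_quot.1 he').1
      obtain ⟨z, hz, h⟩ := mem_inc_of_mem_inc_quot he' (Finset.erase_subset _ _)
      by_cases hzy : z = y
      · rw [hzy, hφy] at hz
        rw [hzy, hy] at h
        simp only [Finset.mem_insert, Finset.mem_singleton, (Finset.mem_erase.1 hE').1,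
          false_or] at h
        simp [← hz, h]
      · rw [hφn z hzy] at hz
        subst hz
        split_ifs with hzx
        · subst hzx
          simp [h, (Finset.mem_erase.1 hE').1]
        · exact h
    refine (Finset.card_le_card hsub).trans ?_
    split_ifs with hwx
    · refine (Finset.card_insert_le _ _).trans ?_
      have := hM.deg_le x he.left_mem
      rw [Finset.card_erase_of_mem he.mem_inc_left]
      omega
    · exact hM.deg_le w hw.2
  have hnot : ¬ H.Good := by
    intro hH
    obtain ⟨F, hFE, hFc, hFn, hFm⟩ := hM.decomp_of_lt H hH (by
      have h1 := Finset.card_erase_lt_of_mem he.right_mem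
      have h2 := Finset.card_erase_lt_of_mem he.mem
      exact add_lt_add h1 h2)
    have heF : e ∉ F := fun h ↦ (Finset.mem_erase.1 (hFE h)).1 rfl
    -- A decomposition of the contraction lifts by adding `e` to the tree; the omitted edges at `z`
    -- are among those omitted at `φ z`.
    refine hM.not_decomp ⟨insert e F, ?_, ⟨hM.conn.1, fun f hf u hu v hv hfu ↦ ?_⟩, ?_, ?_⟩
    · exact Finset.insert_subset he.mem (hFE.trans (Finset.erase_subset _ _))
    · have hxy : f x ↔ f y := hf.link (by simp) he
      rw [← hfφ f hxy] at hfu ⊢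
      refine (hFc.iff (fun e' he' ↦ ?_) (hφV u hu) (hφV v hv)).1 hfu
      change f (φ _) ↔ f (φ _)
      rw [hfφ f hxy, hfφ f hxy]
      exact hf e' (by simp [Finset.mem_coe.1 he'])
    · rw [Finset.card_insert_of_notMem heF, hFn]
      change (M.verts.erase y).card + 1 = _
      exact Finset.card_erase_add_one he.right_mem
    · intro z p hp hpF q hq hqF
      simp only [Finset.mem_insert, not_or] at hpF hqF
      exact hFm (φ z) p (mem_inc_quot_of_mem_inc hp (by simp [hpF.1, (mem_inc.1 hp).1])) hpF.2
        q (mem_inc_quot_of_mem_inc hq (by simp [hqF.1, (mem_inc.1 hq).1])) hqF.2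
  have : ∃ d, H.IsEven d ∧ (∃ e ∈ H.edges, d e ≠ 0) ∧ H.Conn {e | e ∈ H.edges ∧ d e = 0} := by
    by_contra! hcon
    exact hnot ⟨hconn, hcon, hdeg⟩
  obtain ⟨d, hd, ⟨e', he', hde'⟩, hc⟩ := this
  have he'' := Finset.mem_erase.1 he'
  -- Evenness at `y`, whose only edges are `e` and `b`, forces this value on `e`.
  set d' : β → ZMod 2 := fun p ↦ if p = e then d b else d p with hd'
  have hd'e : d' e = d b := by simp [hd']
  have hd'n : ∀ p, p ≠ e → d' p = d p := fun p hp ↦ by simp [hd', hp]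
  have heven : M.IsEven d' := by
    refine isEven_of_map φ (fun g ↦ ?_) (fun g ↦ ?_)
    · rw [← Finset.add_sum_erase _ _ he.mem, he.add_eq (fun w ↦ g (φ w)), hφx, hφy,
        CharTwo.add_self_eq_zero, mul_zero, zero_add]
      refine (Finset.sum_congr rfl fun p hp ↦ ?_).trans (hd g)
      rw [hd'n p (Finset.mem_erase.1 hp).1]
      rfl
    · have hbl : b ∈ M.inc y := by simp [hy]
      obtain ⟨w, hb⟩ := exists_link hbl
      rw [← Finset.sum_subset (s₁ := M.inc y) (fun p hp ↦ (mem_inc.1 hp).1), hy,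
        Finset.sum_pair hbe.symm, hd'e, hd'n b hbe, he.add_eq (fun w ↦ g w + g (φ w)),
        hb.add_eq (fun w ↦ g w + g (φ w)), hφn w hb.ne.symm, hφy, hφx]
      · linear_combination (d b * (g x + g w + g y + g x)) * CharTwo.two_eq_zero (R := ZMod 2)
      · intro p hp hpy
        rw [hφn _ (src_ne_of_notMem_inc hp hpy), hφn _ (tgt_ne_of_notMem_inc hp hpy),
          CharTwo.add_self_eq_zero, CharTwo.add_self_eq_zero, zero_add, mul_zero]
  have hP : ∀ f : α → Prop,
      (∀ e' ∈ M.edges, d' e' = 0 → (f (M.src e') ↔ f (M.tgt e'))) → (f x ↔ f y) →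
        ∀ u ∈ M.verts, ∀ v ∈ M.verts, f u → f v := by
    intro f hf hxy u hu v hv hfu
    rw [← hfφ f hxy] at hfu ⊢
    refine (hc.iff (fun p hp ↦ ?_) (hφV u hu) (hφV v hv)).1 hfu
    change f (φ _) ↔ f (φ _)
    rw [hfφ f hxy, hfφ f hxy]
    have hp1 := Finset.mem_erase.1 hp.1
    exact hf p hp1.2 (by rw [hd'n p hp1.1]; exact hp.2)
  -- If `d' e = 0`, then `e` itself survives the deletion and ensures `f x ↔ f y`, so `hP` makes
  -- `d'` non-separating in `M`.
  refine ⟨d', heven, zmod_two_eq_one fun h0 ↦ ?_, hP⟩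
  refine hM.sep d' heven ⟨e', he''.2, by rwa [hd'n _ he''.1]⟩ ⟨hM.conn.1, fun f hf ↦ ?_⟩
  exact hP f (fun p hp hdp ↦ hf p ⟨hp, hdp⟩) (hf.link ⟨he.mem, h0⟩ he)

/-- No two vertices of degree two of a critical graph are adjacent. -/
lemma Critical.not_link_of_card_two (hM : M.Critical) (hx : (M.inc x).card = 2)
    (hy : (M.inc y).card = 2) : ¬ M.Link e x y := by
  intro he
  obtain ⟨a, x', hae, hx, ha⟩ := exists_inc_eq_pair hx he.mem_inc_left
  obtain ⟨b, y', hbe, hy, -⟩ := exists_inc_eq_pair hy he.mem_inc_right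
  obtain ⟨d, hd, hde, h⟩ := hM.exists_even_of_deg_two he hy hbe
  have hda : d a = 1 := by rw [← hd.eq_of_inc_pair hx hae.symm, hde]
  have hdb : d b = 1 := by rw [← hd.eq_of_inc_pair hy hbe.symm, hde]
  -- Only `a` and `b` leave the set `{x, y}`, and both belong to the even set, so no remaining edge
  -- cuts `{x, y}`. It would have to contain all vertices, making `a` parallel to `e`.
  have := h (fun w ↦ w = x ∨ w = y) (fun p hp hdp ↦ ?_) (by simp) x he.left_mem x' ha.right_mem
    (Or.inl rfl)
  · rcases this with h | h
    · exact ha.ne h.symm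
    · exact hae (hM.eq_of_link (h ▸ ha) he)
  · have h0 : p ≠ a ∧ p ≠ b ∧ p ≠ e := by
      refine ⟨?_, ?_, ?_⟩ <;> rintro rfl <;> simp_all
    have hpx : p ∉ M.inc x := by simp [hx, h0]
    have hpy : p ∉ M.inc y := by simp [hy, h0]
    simp [src_ne_of_notMem_inc hp hpx, src_ne_of_notMem_inc hp hpy, tgt_ne_of_notMem_inc hp hpx,
      tgt_ne_of_notMem_inc hp hpy]

end FinGraph

namespace FinGraph

variable {α β : Type*} {M : FinGraph α β} {a b e e₁ e₂ e₃ p q r m n : β} {x y z u v : α}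
  {F F' : Set β} {f : α → Prop} {d : β → ZMod 2}

lemma Conn.exists_mem_inc (hc : M.Conn F) (hF : F ⊆ M.edges) (hx : x ∈ M.verts)
    (hy : y ∈ M.verts) (hxy : y ≠ x) : ∃ e ∈ F, e ∈ M.inc x := by
  by_contra! h
  refine hxy ((hc.iff (f := (· = x)) (fun e he ↦ ?_) hx hy).1 rfl)
  exact iff_of_false (src_ne_of_notMem_inc (hF he) (h e he)) (tgt_ne_of_notMem_inc (hF he) (h e he))

lemma not_conn (h : ¬ M.Conn F) (hne : M.verts.Nonempty) :
    ∃ f, M.Const F f ∧ ∃ x ∈ M.verts, ∃ y ∈ M.verts, f x ∧ ¬ f y := by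
  by_contra! hcon
  exact h ⟨hne, hcon⟩

section Quot

variable {φ : α → α} {V' : Finset α} {E' : Finset β} {hs : ∀ e ∈ E', φ (M.src e) ∈ V'}
  {ht : ∀ e ∈ E', φ (M.tgt e) ∈ V'} {hne : ∀ e ∈ E', φ (M.src e) ≠ φ (M.tgt e)}

/-- A closed set of the quotient that avoids the moved ends is closed in the original graph,
hence separating, also in the quotient. -/
lemma Good.not_conn_quot (hM : M.Good) (hE : E' ⊆ M.edges)
    (hd : (M.quot φ V' E' hs ht hne).IsEven d) (hd0 : ∃ e ∈ E', d e ≠ 0)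
    (hfix : ∀ e ∈ E', d e ≠ 0 → φ (M.src e) = M.src e ∧ φ (M.tgt e) = M.tgt e)
    (hV : ∀ w ∈ M.verts, φ w ∈ V')
    (hf : ∀ f : α → Prop, (∀ e ∈ M.edges, e ∉ E' → (f (M.src e) ↔ f (M.tgt e))) →
      ∀ w ∈ M.verts, (f (φ w) ↔ f w)) :
    ¬ (M.quot φ V' E' hs ht hne).Conn {e | e ∈ E' ∧ d e = 0} := by
  intro hc
  obtain ⟨e₀, he₀, hde₀⟩ := hd0
  refine hM.sep (fun e ↦ if e ∈ E' then d e else 0) (fun g ↦ ?_) ⟨e₀, hE he₀, by simpa [he₀]⟩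
    ⟨hM.conn.1, fun f hf' u hu v hv hfu ↦ ?_⟩
  · refine Eq.trans (Eq.symm ?_) (hd g)
    refine Finset.sum_subset_zero_on_sdiff hE ?_ ?_
    · intro e he
      have : e ∉ E' := (Finset.mem_sdiff.1 he).2
      beta_reduce
      rw [if_neg this, zero_mul]
    · intro e (he : e ∈ E')
      beta_reduce
      rw [if_pos he]
      change d e * (g (φ (M.src e)) + g (φ (M.tgt e))) = _
      by_cases h : d e = 0
      · rw [h, zero_mul, zero_mul]
      · rw [(hfix e he h).1, (hfix e he h).2]
  · have key := hf f (fun e he heE ↦ hf' e ⟨he, by simp [heE]⟩)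
    rw [← key u hu] at hfu
    rw [← key v hv]
    refine (hc.iff (fun e he ↦ ?_) (hV u hu) (hV v hv)).1 hfu
    change f (φ _) ↔ f (φ _)
    have heM := hE he.1
    rw [key _ (M.src_mem e heM), key _ (M.tgt_mem e heM)]
    exact hf' e ⟨heM, by simp [he.1, he.2]⟩

end Quot

/-! ### Vertices of degree two at distance two -/

set_option maxHeartbeats 1000000 in
/-- No two vertices of degree two of a critical graph have a common neighbour. -/
lemma Critical.not_link_link_of_card_two (hM : M.Critical) (hx : (M.inc x).card = 2)
    (hy : (M.inc y).card = 2) (hxy : x ≠ y) (hp : M.Link p x z) (hq : M.Link q y z) : False := by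
  have hadj : ∀ e, ¬ M.Link e x y := fun e ↦ hM.not_link_of_card_two hx hy
  have hpq : p ≠ q := by
    rintro rfl
    rcases hp.ends hq with ⟨h, -⟩ | ⟨-, h⟩
    exacts [hxy h, hq.ne h.symm]
  have hz : (M.inc z).card = 3 :=
    (hM.card_inc hp.right_mem).resolve_left fun h ↦ hM.not_link_of_card_two hx h hp
  obtain ⟨a, x', hap, hx, ha⟩ := exists_inc_eq_pair hx hp.mem_inc_left
  obtain ⟨b, y', hbq, hy, hb⟩ := exists_inc_eq_pair hy hq.mem_inc_left
  obtain ⟨c, z', hcp, hcq, hz, hc⟩ :=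
    exists_inc_eq_triple hz hp.mem_inc_right hq.mem_inc_right hpq
  have hab : a ≠ b := by
    rintro rfl
    rcases ha.ends hb with ⟨h, -⟩ | ⟨-, h⟩
    · exact hxy h
    · exact hadj _ (h ▸ ha)
  have hy'x : y' ≠ x := fun h ↦ hadj b (h ▸ hb.symm)
  have hpy : p ∉ M.inc y := by simp [hp.mem_inc_iff, hxy.symm, hq.ne]
  have hqx : q ∉ M.inc x := by simp [hq.mem_inc_iff, hxy, hp.ne]
  have haq : a ≠ q := fun h ↦ hqx (h ▸ ha.mem_inc_left)
  have hbp : b ≠ p := fun h ↦ hpy (h ▸ hb.mem_inc_left)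
  set φ : α → α := fun w ↦ if w = y then x else w with hφ
  have hφy : φ y = x := by simp [hφ]
  have hφn : ∀ w, w ≠ y → φ w = w := fun w hw ↦ by simp [hφ, hw]
  have hφx : φ x = x := hφn x hxy
  have hφV : ∀ w ∈ M.verts, φ w ∈ M.verts.erase y := by
    intro w hw
    by_cases h : w = y
    · rw [h, hφy]; exact Finset.mem_erase.2 ⟨hxy, hp.left_mem⟩
    · rw [hφn w h]; exact Finset.mem_erase.2 ⟨h, hw⟩
  have hfφ : ∀ f : α → Prop, (f x ↔ f y) → ∀ w, f (φ w) ↔ f w := by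
    intro f hf w
    by_cases h : w = y
    · rw [h, hφy]; exact hf
    · rw [hφn w h]
  have hmE : ∀ e, e ∈ M.edges \ {p, q} ↔ e ∈ M.edges ∧ e ≠ p ∧ e ≠ q := by simp
  have hE : M.edges \ {p, q} ⊆ M.edges := Finset.sdiff_subset
  -- After deleting `p` and `q`, the vertices `x` and `y` are glued into a vertex with edges `a` and
  -- `b`, and `z` becomes a leaf at `c`.
  let H := M.quot φ (M.verts.erase y) (M.edges \ {p, q})
    (fun e' h ↦ hφV _ (M.src_mem e' (hE h))) (fun e' h ↦ hφV _ (M.tgt_mem e' (hE h))) (by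
      intro e' h heq
      have hl := link_src_tgt (hE h)
      by_cases hs : M.src e' = y
      · have ht : M.tgt e' ≠ y := fun ht ↦ hl.ne (hs.trans ht.symm)
        rw [hs, hφy, hφn _ ht] at heq
        rw [hs, ← heq] at hl
        exact hadj e' hl.symm
      · by_cases ht : M.tgt e' = y
        · rw [ht, hφy, hφn _ hs] at heq
          rw [ht, heq] at hl
          exact hadj e' hl
        · rw [hφn _ hs, hφn _ ht] at heq
          exact absurd heq hl.ne)
  have hzH : z ∈ H.verts := Finset.mem_erase.2 ⟨hq.ne.symm, hp.right_mem⟩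
  have hxH : x ∈ H.verts := Finset.mem_erase.2 ⟨hxy, hp.left_mem⟩
  have haE : a ∈ M.edges \ {p, q} := (hmE a).2 ⟨ha.mem, hap, haq⟩
  have hbE : b ∈ M.edges \ {p, q} := (hmE b).2 ⟨hb.mem, hbp, hbq⟩
  have hcE : c ∈ M.edges \ {p, q} := (hmE c).2 ⟨hc.mem, hcp, hcq⟩
  have hincx : H.inc x = {a, b} := by
    ext e
    constructor
    · intro h
      have he := (hmE e).1 (mem_inc_quot.1 h).1
      obtain ⟨w, hw, h⟩ := mem_inc_of_mem_inc_quot h hE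
      by_cases hwy : w = y
      · rw [hwy, hy] at h
        have : e = b := by simpa [he] using h
        simp [this]
      · rw [hφn w hwy] at hw
        rw [hw, hx] at h
        have : e = a := by simpa [he] using h
        simp [this]
    · intro h
      rw [← hφx]
      rcases Finset.mem_insert.1 h with rfl | h
      · exact mem_inc_quot_of_mem_inc ha.mem_inc_left haE
      · rw [Finset.mem_singleton.1 h, hφx, ← hφy]
        exact mem_inc_quot_of_mem_inc hb.mem_inc_left hbE
  have hincn : ∀ w, w ≠ x → H.inc w ⊆ M.inc w := by
    intro w hwx e he
    obtain ⟨v, hv, h⟩ := mem_inc_of_mem_inc_quot he hE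
    by_cases hvy : v = y
    · rw [hvy, hφy] at hv
      exact absurd hv.symm hwx
    · rwa [← hv, hφn v hvy]
  have hgood : H.Good := by
    refine ⟨⟨⟨z, hzH⟩, fun f hf u hu v hv hfu ↦ ?_⟩, fun d hd hd0 ↦ ?_, fun w hw ↦ ?_⟩
    · have hf' : ∀ e ∈ M.edges, e ≠ p → e ≠ q → (f (φ (M.src e)) ↔ f (φ (M.tgt e))) :=
        fun e he h1 h2 ↦ hf e ((hmE e).2 ⟨he, h1, h2⟩)
      -- Giving `z` the value of the glued vertex uncuts `p` and `q`. Only `c` could still be cut,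
      -- and it is not a bridge.
      have hxz : f (φ x) ↔ f (φ z) := by
        have hup := const_update (M := M) (z := z) (q := f (φ x)) (f := f ∘ φ)
          (F := M.edges \ {c}) Set.sdiff_subset (by
            rintro e ⟨he, -⟩ hez
            refine hf' e he ?_ ?_ <;> rintro rfl
            exacts [hez hp.mem_inc_right, hez hq.mem_inc_right]) (by
            rintro e ⟨he, hec⟩ w hw
            have := hz ▸ hw.mem_inc_left
            simp only [Finset.mem_insert, Finset.mem_singleton] at this hec
            rcases this with rfl | rfl | rfl
            · rcases hw.ends hp with ⟨h, -⟩ | ⟨-, rfl⟩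
              · exact absurd h.symm hp.ne
              · rfl
            · rcases hw.ends hq with ⟨h, -⟩ | ⟨-, rfl⟩
              · exact absurd h.symm hq.ne
              · simp [hφx, hφy]
            · exact absurd rfl hec)
        have h1 := hM.iff_of_bridge (f := fun v ↦ if v = z then f (φ x) else (f ∘ φ) v) hc.mem
          (fun e' he' hne' ↦ hup e' ⟨he', hne'⟩) hc.left_mem hc.right_mem
        have h2 : f (φ z) ↔ f (φ z') :=
          Const.link (M := M) (F := {c}) (f := f ∘ φ) (by
            rintro e rfl
            exact hf' _ hc.mem hcp hcq) rfl hc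
        simp only [if_true, if_neg hc.ne.symm, Function.comp_apply] at h1
        exact h1.trans h2.symm
      have hu := Finset.mem_erase.1 hu
      have hv := Finset.mem_erase.1 hv
      have := (hM.conn.iff (f := f ∘ φ) (fun e he ↦ ?_) hu.2 hv.2)
      · simp only [Function.comp_apply, hφn _ hu.1, hφn _ hv.1] at this
        exact this.1 hfu
      · by_cases h1 : e = p
        · rw [h1]; exact hp.iff_of_src_tgt (f := f ∘ φ) hxz
        by_cases h2 : e = q
        · rw [h2]; exact hq.iff_of_src_tgt (f := f ∘ φ) (by
            simpa [hφx, hφy] using hxz)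
        exact hf' e he h1 h2
    · have hdab := hd.eq_of_inc_pair hincx hab
      -- If the even set uses one edge at the glued vertex it uses both, and its deletion isolates
      -- that vertex. Otherwise it avoids `a` and `b` and is an even set of `M`.
      have hdb : ¬ H.Conn {e | e ∈ H.edges ∧ d e = 0} ∨ d b = 0 := by
        by_contra! h
        obtain ⟨e, he, hex⟩ := h.1.exists_mem_inc (fun e he ↦ he.1) hxH hzH hp.ne.symm
        rw [hincx] at hex
        have := he.2
        rcases Finset.mem_insert.1 hex with rfl | hex
        · exact h.2 (hdab ▸ this)
        · exact h.2 (Finset.mem_singleton.1 hex ▸ this)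
      refine hdb.elim id fun hdb ↦ ?_
      refine hM.not_conn_quot hE hd hd0 (fun e he hde ↦ ?_) hφV (fun f hf w _ ↦ hfφ f ?_ w)
      · have hey : e ∉ M.inc y := by
          rw [hy]
          simp only [Finset.mem_insert, Finset.mem_singleton, not_or]
          exact ⟨((hmE e).1 he).2.2, fun h ↦ hde (h ▸ hdb)⟩
        exact ⟨hφn _ (src_ne_of_notMem_inc (hE he) hey), hφn _ (tgt_ne_of_notMem_inc (hE he) hey)⟩
      · have hc : M.Const {p, q} f := by
          rintro e (rfl | rfl)
          exacts [hf _ hp.mem (by simp), hf _ hq.mem (by simp)]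
        exact (hc.link (by simp) hp).trans (hc.link (by simp) hq).symm
    · by_cases h : w = x
      · rw [h, hincx]
        exact Finset.card_le_two.trans (by norm_num)
      · exact (Finset.card_le_card (hincn w h)).trans (hM.deg_le w (Finset.mem_of_mem_erase hw))
  obtain ⟨F, hFE, hFc, hFn, hFm⟩ := hM.decomp_of_lt H hgood
    (add_lt_add_of_lt_of_le (Finset.card_erase_lt_of_mem hq.left_mem) (Finset.card_le_card hE))
  have hFE' : ∀ e ∈ F, e ∈ M.edges ∧ e ≠ p ∧ e ≠ q := fun e he ↦ (hmE e).1 (hFE he)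
  have hcF : c ∈ F := by
    obtain ⟨e, he, hez⟩ := hFc.exists_mem_inc (Finset.coe_subset.2 hFE) hzH hxH hp.ne
    have := hincn z hp.ne.symm hez
    have he' := hFE' e he
    simp only [hz, Finset.mem_insert, Finset.mem_singleton, he'.2, false_or] at this
    exact this ▸ he
  -- The edge `r` at `z` joins the tree and `s` joins the matching. No conflict arises at `z`, where
  -- `c` is in the tree, nor at the other end `w` of `s`, by the hypothesis on `w`.
  have finish : ∀ r s w w', M.Link r w' z → M.Link s w z → (r = p ∧ s = q ∨ r = q ∧ s = p) →
      (∀ e ∈ M.inc w, e = s ∨ e ∈ F) → ¬ M.Conn (insert r F : Finset β) := by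
    intro r s w w' hr hs hrs hw hconn
    refine hM.not_decomp ⟨insert r F, ?_, hconn, ?_, ?_⟩
    · exact Finset.insert_subset hr.mem fun e he ↦ (hFE' e he).1
    · have : r ∉ F := fun h ↦ hrs.elim (fun h' ↦ (hFE' r h).2.1 h'.1) fun h' ↦ (hFE' r h).2.2 h'.1
      rw [Finset.card_insert_of_notMem this, hFn]
      exact Finset.card_erase_add_one hq.left_mem
    · have hz' : ∀ e ∈ M.inc z, e = s ∨ e ∈ insert r F := by
        intro e he
        rw [hz] at he
        simp only [Finset.mem_insert, Finset.mem_singleton] at he ⊢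
        rcases he with he | he | he
        · exact hrs.elim (fun h ↦ Or.inr (Or.inl (he.trans h.1.symm)))
            fun h ↦ Or.inl (he.trans h.2.symm)
        · exact hrs.elim (fun h ↦ Or.inl (he.trans h.2.symm))
            fun h ↦ Or.inr (Or.inl (he.trans h.1.symm))
        · exact Or.inr (Or.inr (he ▸ hcF))
      have hw' : ∀ e ∈ M.inc w, e = s ∨ e ∈ insert r F := fun e he ↦
        (hw e he).imp_right (Finset.mem_insert_of_mem)
      intro t e₁ h₁ hF₁ e₂ h₂ hF₂
      by_cases ht : s ∈ M.inc t
      · rcases hs.mem_inc_iff.1 ht with rfl | rfl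
        · rw [(hw' e₁ h₁).resolve_right hF₁, (hw' e₂ h₂).resolve_right hF₂]
        · rw [(hz' e₁ h₁).resolve_right hF₁, (hz' e₂ h₂).resolve_right hF₂]
      · simp only [Finset.mem_insert, not_or] at hF₁ hF₂
        have k : ∀ e ∈ M.inc t, e ≠ r → e ∈ H.inc (φ t) := by
          intro e he her
          refine mem_inc_quot_of_mem_inc he ((hmE e).2 ⟨(mem_inc.1 he).1, ?_⟩)
          have : e ≠ s := fun h ↦ ht (h ▸ he)
          rcases hrs with ⟨rfl, rfl⟩ | ⟨rfl, rfl⟩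
          exacts [⟨her, this⟩, ⟨this, her⟩]
        exact hFm (φ t) e₁ (k e₁ h₁ hF₁.1) hF₁.2 e₂ (k e₂ h₂ hF₂.1) hF₂.2
  have finish_q : a ∈ F → ¬ M.Conn (insert q F : Finset β) := fun haF ↦
    finish q p x y hq hp (Or.inr ⟨rfl, rfl⟩) (by simp [hx, haF])
  have finish_p : b ∈ F → ¬ M.Conn (insert p F : Finset β) := fun hbF ↦
    finish p q y x hp hq (Or.inl ⟨rfl, rfl⟩) (by simp [hy, hbF])
  have hneM : M.verts.Nonempty := ⟨x, hp.left_mem⟩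
  by_cases haF : a ∈ F <;> by_cases hbF : b ∈ F
  · obtain ⟨f₁, hf₁, u₁, hu₁, v₁, hv₁, hfu₁, hfv₁⟩ := not_conn (finish_q haF) hneM
    obtain ⟨f₂, hf₂, u₂, hu₂, v₂, hv₂, hfu₂, hfv₂⟩ := not_conn (finish_p hbF) hneM
    have key : ∀ f : α → Prop, M.Const F f → (f x ↔ f y) → ∀ u ∈ M.verts, ∀ v ∈ M.verts,
        (f u ↔ f v) := by
      intro f hf hxy u hu v hv
      rw [← hfφ f hxy, ← hfφ f hxy v]
      refine hFc.iff (fun e he ↦ ?_) (hφV u hu) (hφV v hv)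
      change f (φ _) ↔ f (φ _)
      rw [hfφ f hxy, hfφ f hxy]
      exact hf e he
    have hF₁ : M.Const F f₁ := hf₁.mono (by simp)
    have hF₂ : M.Const F f₂ := hf₂.mono (by simp)
    have h₁ : ¬ (f₁ x ↔ f₁ y) := fun h ↦ hfv₁ ((key f₁ hF₁ h u₁ hu₁ v₁ hv₁).1 hfu₁)
    have h₂ : ¬ (f₂ x ↔ f₂ y) := fun h ↦ hfv₂ ((key f₂ hF₂ h u₂ hu₂ v₂ hv₂).1 hfu₂)
    have h₃ : f₁ y ↔ f₁ z := hf₁.link (by simp) hq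
    have h₄ : f₂ x ↔ f₂ z := hf₂.link (by simp) hp
    -- Both cuts separate `x` from `y`, so their agreement predicate does not and must be constant.
    -- At `z` the two cuts follow `y` and `x` respectively, which contradicts this.
    have h₅ := key (fun w ↦ (f₁ w ↔ f₂ w)) (fun e he ↦ by simp only [hF₁ e he, hF₂ e he])
      (by clear * - h₁ h₂; tauto) z hp.right_mem x hp.left_mem
    clear * - h₁ h₂ h₃ h₄ h₅
    tauto
  -- As `b` is not in the tree, `y` is attached as a leaf by `q`.
  · refine finish_q haF ⟨hneM, fun f hf ↦ ?_⟩
    have hyz : f y ↔ f z := hf.link (by simp) hq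
    have key : ∀ w ∈ M.verts, (f w ↔ f z) := by
      intro w hw
      by_cases hwy : w = y
      · rw [hwy, hyz]
      · refine hFc.iff (fun e he ↦ ?_) (Finset.mem_erase.2 ⟨hwy, hw⟩) hzH
        have he' := hFE' e he
        have hey : e ∉ M.inc y := by
          rw [hy]
          simp only [Finset.mem_insert, Finset.mem_singleton, not_or]
          exact ⟨he'.2.2, fun h ↦ hbF (h ▸ he)⟩
        change f (φ _) ↔ f (φ _)
        rw [hφn _ (src_ne_of_notMem_inc he'.1 hey), hφn _ (tgt_ne_of_notMem_inc he'.1 hey)]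
        exact hf e (by simp [Finset.mem_coe.1 he])
    exact fun u hu v hv hfu ↦ (key v hv).2 ((key u hu).1 hfu)
  · refine finish_p hbF ⟨hneM, fun f hf ↦ ?_⟩
    have hxz : f x ↔ f z := hf.link (by simp) hp
    -- The glued vertex bears the name `x`, but with `a` outside the tree it stands for `y`. Hence
    -- it receives the value `f y`, and `x` is attached as a leaf by `p`.
    set g : α → Prop := fun w ↦ if w = x then f y else f w with hg
    have hgφ : ∀ w, w ≠ x → (g (φ w) ↔ f w) := by
      intro w hw
      by_cases hwy : w = y
      · simp [hwy, hφy, hg]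
      · simp [hφn w hwy, hg, hw]
    have key : ∀ w ∈ M.verts, (f w ↔ f z) := by
      intro w hw
      by_cases hwx : w = x
      · rw [hwx, hxz]
      · rw [← hgφ w hwx, ← hgφ z hp.ne.symm]
        refine hFc.iff (fun e he ↦ ?_) (hφV w hw) (hφV z hp.right_mem)
        have he' := hFE' e he
        have hex : e ∉ M.inc x := by
          rw [hx]
          simp only [Finset.mem_insert, Finset.mem_singleton, not_or]
          exact ⟨he'.2.1, fun h ↦ haF (h ▸ he)⟩
        change g (φ _) ↔ g (φ _)
        rw [hgφ _ (src_ne_of_notMem_inc he'.1 hex), hgφ _ (tgt_ne_of_notMem_inc he'.1 hex)]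
        exact hf e (by simp [Finset.mem_coe.1 he])
    exact fun u hu v hv hfu ↦ (key v hv).2 ((key u hu).1 hfu)
  · exact hab (hFm x a (by simp [hincx]) haF b (by simp [hincx]) hbF)

end FinGraph

namespace FinGraph

variable {α β : Type*} {M : FinGraph α β} {a b c e e₁ e₂ e₃ p q r m n : β} {x y z u v u₁ u₂ : α}
  {F F' : Set β} {f : α → Prop} {d : β → ZMod 2}

/-! ### Triangles -/

/-- A bipartition cutting at most two edges at a vertex of degree three of a critical graph, whose
other ends are on the same side, does not cut them. -/
lemma Critical.iff_of_pair (hM : M.Critical) (hv : (M.inc v).card = 3) (h₁ : M.Link e₁ v u₁)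
    (h₂ : M.Link e₂ v u₂) (hne : e₁ ≠ e₂) (hu : f u₁ ↔ f u₂)
    (hf : ∀ e ∈ M.edges, e ≠ e₁ → e ≠ e₂ → (f (M.src e) ↔ f (M.tgt e))) : f v ↔ f u₁ := by
  obtain ⟨a, w, ha₁, ha₂, hinc, ha⟩ :=
    exists_inc_eq_triple hv h₁.mem_inc_left h₂.mem_inc_left hne
  have hup := const_update (M := M) (z := v) (q := f u₁) (f := f) (F := M.edges \ {a})
    Set.sdiff_subset (by
      rintro e ⟨he, -⟩ hev
      refine hf e he ?_ ?_ <;> rintro rfl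
      exacts [hev h₁.mem_inc_left, hev h₂.mem_inc_left]) (by
      rintro e ⟨he, hea⟩ w hw
      have := hinc ▸ hw.mem_inc_left
      simp only [Finset.mem_insert, Finset.mem_singleton] at this hea
      rcases this with rfl | rfl | rfl
      · rcases hw.ends h₁ with ⟨-, rfl⟩ | ⟨h, rfl⟩
        · rfl
        · exact absurd rfl hw.ne
      · rcases hw.ends h₂ with ⟨-, rfl⟩ | ⟨h, rfl⟩
        · exact hu
        · exact absurd rfl hw.ne
      · exact absurd rfl hea)
  have h1 := hM.iff_of_bridge (f := fun w ↦ if w = v then f u₁ else f w) ha.mem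
    (fun e' he' hne' ↦ hup e' ⟨he', hne'⟩) ha.left_mem ha.right_mem
  have h2 : f v ↔ f w := Const.link (M := M) (F := {a}) (f := f) (by
    rintro e rfl
    exact hf _ ha.mem ha₁ ha₂) rfl ha
  simp only [if_true, if_neg ha.ne.symm] at h1
  exact h2.trans h1.symm

lemma Link.edge_ne_of_notMem (h : M.Link e x y) (hu : e₁ ∈ M.inc u) (hx : u ≠ x) (hy : u ≠ y) :
    e₁ ≠ e := by
  rintro rfl
  exact (h.mem_inc_iff.1 hu).elim hx hy

/-- Deleting the triangle leaves a nontrivial cut. Two of its three vertices lie on the same side,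
and by `iff_of_pair` a third vertex of degree three must join them. Then no edge at all is cut. -/
lemma Critical.card_two_of_triangle (hM : M.Critical) (hp : M.Link p x y) (hq : M.Link q x z)
    (hr : M.Link r y z) : (M.inc x).card = 2 ∨ (M.inc y).card = 2 ∨ (M.inc z).card = 2 := by
  by_contra! h
  have hx := (hM.card_inc hp.left_mem).resolve_left h.1
  have hy := (hM.card_inc hp.right_mem).resolve_left h.2.1
  have hz := (hM.card_inc hq.right_mem).resolve_left h.2.2
  have hpq : p ≠ q := hq.edge_ne_of_notMem hp.mem_inc_right hp.ne.symm hr.ne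
  have hpr : p ≠ r := hr.edge_ne_of_notMem hp.mem_inc_left hp.ne hq.ne
  have hqr : q ≠ r := hr.edge_ne_of_notMem hq.mem_inc_left hp.ne hq.ne
  obtain ⟨f, hf, u, hu, v, hv, hfu, hfv⟩ := hM.exists_cut_of_closed {p, q, r}
    (by simp [Finset.insert_subset_iff, hp.mem, hq.mem, hr.mem]) ⟨p, by simp⟩ (fun g ↦ by
      rw [Finset.sum_insert (by simp [hpq, hpr]), Finset.sum_pair hqr, hp.add_eq, hq.add_eq,
        hr.add_eq]
      linear_combination (g x + g y + g z) * CharTwo.two_eq_zero (R := ZMod 2))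
  have hf' : ∀ e ∈ M.edges, e ≠ p → e ≠ q → e ≠ r → (f (M.src e) ↔ f (M.tgt e)) :=
    fun e he h1 h2 h3 ↦ hf e he (by simp [h1, h2, h3])
  have key : (f x ↔ f y) ∧ (f x ↔ f z) := by
    have h1 : (f y ↔ f z) → (f x ↔ f y) := fun h ↦
      hM.iff_of_pair hx hp hq hpq h fun e he h1 h2 ↦ by
        by_cases h3 : e = r
        · exact h3 ▸ hr.iff_of_src_tgt h
        · exact hf' e he h1 h2 h3
    have h2 : (f x ↔ f z) → (f y ↔ f x) := fun h ↦
      hM.iff_of_pair hy hp.symm hr hpr h fun e he h1 h2 ↦ by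
        by_cases h3 : e = q
        · exact h3 ▸ hq.iff_of_src_tgt h
        · exact hf' e he h1 h3 h2
    have h3 : (f x ↔ f y) → (f z ↔ f x) := fun h ↦
      hM.iff_of_pair hz hq.symm hr.symm hqr h fun e he h1 h2 ↦ by
        by_cases h3 : e = p
        · exact h3 ▸ hp.iff_of_src_tgt h
        · exact hf' e he h3 h1 h2
    clear * - h1 h2 h3
    tauto
  refine hfv (hM.conn.2 f (fun e he ↦ ?_) u hu v hv hfu)
  by_cases h1 : e = p
  · exact h1 ▸ hp.iff_of_src_tgt key.1
  by_cases h2 : e = q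
  · exact h2 ▸ hq.iff_of_src_tgt key.2
  by_cases h3 : e = r
  · exact h3 ▸ hr.iff_of_src_tgt (key.1.symm.trans key.2)
  exact hf' e he h1 h2 h3

-- The triangle is contracted to `x`, which then has just the edges `b` and `c`. At least one of
-- these is in the tree of the contraction, and two triangle edges can be added so that the third
-- fits into the matching.
set_option maxHeartbeats 1000000 in
lemma Critical.no_triangle_of_card_two (hM : M.Critical) (hp : M.Link p x y) (hq : M.Link q x z)
    (hr : M.Link r y z) (hx : (M.inc x).card = 2) : False := by
  have hpq : p ≠ q := hq.edge_ne_of_notMem hp.mem_inc_right hp.ne.symm hr.ne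
  have hpr : p ≠ r := hr.edge_ne_of_notMem hp.mem_inc_left hp.ne hq.ne
  have hqr : q ≠ r := hr.edge_ne_of_notMem hq.mem_inc_left hp.ne hq.ne
  have hy : (M.inc y).card = 3 :=
    (hM.card_inc hp.right_mem).resolve_left fun h ↦ hM.not_link_of_card_two hx h hp
  have hz : (M.inc z).card = 3 :=
    (hM.card_inc hq.right_mem).resolve_left fun h ↦ hM.not_link_of_card_two hx h hq
  have hx : M.inc x = {p, q} := by
    obtain ⟨q', _, hq', hx, -⟩ := exists_inc_eq_pair hx hp.mem_inc_left
    have := hx ▸ hq.mem_inc_left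
    simp only [Finset.mem_insert, hpq.symm, Finset.mem_singleton, false_or] at this
    rw [hx, this]
  obtain ⟨b, y', hbp, hbr, hy, hb⟩ :=
    exists_inc_eq_triple hy hp.mem_inc_right hr.mem_inc_left hpr
  obtain ⟨c, z', hcq, hcr, hz, hc⟩ :=
    exists_inc_eq_triple hz hq.mem_inc_right hr.mem_inc_right hqr
  have hy'x : y' ≠ x := fun h ↦ hbp (hM.eq_of_link (h ▸ hb) hp.symm)
  have hy'z : y' ≠ z := fun h ↦ hbr (hM.eq_of_link (h ▸ hb) hr)
  have hz'x : z' ≠ x := fun h ↦ hcq (hM.eq_of_link (h ▸ hc) hq.symm)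
  have hz'y : z' ≠ y := fun h ↦ hcr (hM.eq_of_link (h ▸ hc) hr.symm)
  have hbc : b ≠ c := hc.edge_ne_of_notMem hb.mem_inc_left hr.ne hz'y.symm
  have hbq : b ≠ q := hq.edge_ne_of_notMem hb.mem_inc_left hp.ne.symm hr.ne
  have hcp : c ≠ p := hp.edge_ne_of_notMem hc.mem_inc_left hq.ne.symm hr.ne.symm
  set φ : α → α := fun w ↦ if w = y ∨ w = z then x else w with hφ
  have hφy : φ y = x := by simp [hφ]
  have hφz : φ z = x := by simp [hφ]
  have hφn : ∀ w, w ≠ y → w ≠ z → φ w = w := fun w hw hw' ↦ by simp [hφ, hw, hw']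
  have hφx : φ x = x := hφn x hp.ne hq.ne
  have hmV : ∀ w, w ∈ M.verts \ {y, z} ↔ w ∈ M.verts ∧ w ≠ y ∧ w ≠ z := by simp
  have hφV : ∀ w ∈ M.verts, φ w ∈ M.verts \ {y, z} := by
    intro w hw
    rw [hmV]
    by_cases h : w = y ∨ w = z
    · have : φ w = x := if_pos h
      rw [this]
      exact ⟨hp.left_mem, hp.ne, hq.ne⟩
    · rw [not_or] at h
      rw [hφn w h.1 h.2]
      exact ⟨hw, h⟩
  have hfφ : ∀ f : α → Prop, (f x ↔ f y) → (f x ↔ f z) → ∀ w, f (φ w) ↔ f w := by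
    intro f h₁ h₂ w
    by_cases h : w = y
    · rw [h, hφy]; exact h₁
    by_cases h' : w = z
    · rw [h', hφz]; exact h₂
    rw [hφn w h h']
  have hmE : ∀ e, e ∈ M.edges \ {p, q, r} ↔ e ∈ M.edges ∧ e ≠ p ∧ e ≠ q ∧ e ≠ r := by simp
  have hE : M.edges \ {p, q, r} ⊆ M.edges := Finset.sdiff_subset
  have hbE : b ∈ M.edges \ {p, q, r} := (hmE b).2 ⟨hb.mem, hbp, hbq, hbr⟩
  have hcE : c ∈ M.edges \ {p, q, r} := (hmE c).2 ⟨hc.mem, hcp, hcq, hcr⟩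
  have hoff : ∀ e ∈ M.edges \ {p, q, r}, e ≠ b → e ≠ c →
      φ (M.src e) = M.src e ∧ φ (M.tgt e) = M.tgt e := by
    intro e he h₁ h₂
    have he := (hmE e).1 he
    have hey : e ∉ M.inc y := by simp [hy, he, h₁]
    have hez : e ∉ M.inc z := by simp [hz, he, h₂]
    exact ⟨hφn _ (src_ne_of_notMem_inc he.1 hey) (src_ne_of_notMem_inc he.1 hez),
      hφn _ (tgt_ne_of_notMem_inc he.1 hey) (tgt_ne_of_notMem_inc he.1 hez)⟩
  let H := M.quot φ (M.verts \ {y, z}) (M.edges \ {p, q, r})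
    (fun e' h ↦ hφV _ (M.src_mem e' (hE h))) (fun e' h ↦ hφV _ (M.tgt_mem e' (hE h))) (by
      intro e he heq
      by_cases h₁ : e = b
      · subst h₁
        rcases hb with ⟨-, ⟨h, h'⟩ | ⟨h, h'⟩⟩ <;>
          rw [h, h', hφy, hφn _ (fun h ↦ ?_) hy'z] at heq
        · exact hy'x heq.symm
        · exact M.src_ne_tgt e (hE he) (by grind)
        · exact hy'x heq
        · exact M.src_ne_tgt e (hE he) (by grind)
      by_cases h₂ : e = c
      · subst h₂
        rcases hc with ⟨-, ⟨h, h'⟩ | ⟨h, h'⟩⟩ <;>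
          rw [h, h', hφz, hφn _ hz'y (fun h ↦ ?_)] at heq
        · exact hz'x heq.symm
        · exact M.src_ne_tgt e (hE he) (by grind)
        · exact hz'x heq
        · exact M.src_ne_tgt e (hE he) (by grind)
      rw [(hoff e he h₁ h₂).1, (hoff e he h₁ h₂).2] at heq
      exact M.src_ne_tgt e (hE he) heq)
  have hxH : x ∈ H.verts := (hmV x).2 ⟨hp.left_mem, hp.ne, hq.ne⟩
  have hy'H : y' ∈ H.verts := (hmV y').2 ⟨hb.right_mem, hb.ne.symm, hy'z⟩
  have hincx : H.inc x = {b, c} := by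
    ext e
    constructor
    · intro h
      have he := (hmE e).1 (mem_inc_quot.1 h).1
      obtain ⟨w, hw, h⟩ := mem_inc_of_mem_inc_quot h hE
      by_cases hwy : w = y
      · rw [hwy, hy] at h
        have : e = b := by simpa [he] using h
        simp [this]
      by_cases hwz : w = z
      · rw [hwz, hz] at h
        have : e = c := by simpa [he] using h
        simp [this]
      rw [hφn w hwy hwz] at hw
      rw [hw, hx] at h
      simp [he] at h
    · intro h
      rcases Finset.mem_insert.1 h with rfl | h
      · rw [← hφy]
        exact mem_inc_quot_of_mem_inc hb.mem_inc_left hbE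
      · rw [Finset.mem_singleton.1 h, ← hφz]
        exact mem_inc_quot_of_mem_inc hc.mem_inc_left hcE
  have hincn : ∀ w, w ≠ x → H.inc w ⊆ M.inc w := by
    intro w hwx e he
    obtain ⟨v, hv, h⟩ := mem_inc_of_mem_inc_quot he hE
    by_cases hvy : v = y
    · rw [hvy, hφy] at hv
      exact absurd hv.symm hwx
    by_cases hvz : v = z
    · rw [hvz, hφz] at hv
      exact absurd hv.symm hwx
    rwa [← hv, hφn v hvy hvz]
  have hconst : ∀ F : Set β, (∀ f, M.Const F f → (f x ↔ f y) ∧ (f x ↔ f z)) →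
      ∀ F' ⊆ F, H.Conn F' → M.Conn F := by
    intro F hF F' hF' hc
    refine ⟨⟨x, hp.left_mem⟩, fun f hf u hu v hv hfu ↦ ?_⟩
    obtain ⟨h₁, h₂⟩ := hF f hf
    rw [← hfφ f h₁ h₂] at hfu ⊢
    refine (hc.iff (fun e he ↦ ?_) (hφV u hu) (hφV v hv)).1 hfu
    change f (φ _) ↔ f (φ _)
    rw [hfφ f h₁ h₂, hfφ f h₁ h₂]
    exact hf e (hF' he)
  have hgood : H.Good := by
    refine ⟨⟨⟨x, hxH⟩, fun f hf u hu v hv hfu ↦ ?_⟩, fun d hd hd0 ↦ ?_, fun w hw ↦ ?_⟩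
    · have hu := (hmV u).1 hu
      have hv := (hmV v).1 hv
      have := (hM.conn.iff (f := f ∘ φ) (fun e he ↦ ?_) hu.1 hv.1)
      · simp only [Function.comp_apply, hφn _ hu.2.1 hu.2.2, hφn _ hv.2.1 hv.2.2] at this
        exact this.1 hfu
      · by_cases h₁ : e = p
        · rw [h₁]; exact hp.iff_of_src_tgt (f := f ∘ φ) (by simp [hφx, hφy])
        by_cases h₂ : e = q
        · rw [h₂]; exact hq.iff_of_src_tgt (f := f ∘ φ) (by simp [hφx, hφz])
        by_cases h₃ : e = r
        · rw [h₃]; exact hr.iff_of_src_tgt (f := f ∘ φ) (by simp [hφy, hφz])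
        exact hf e ((hmE e).2 ⟨he, h₁, h₂, h₃⟩)
    · have hdbc := hd.eq_of_inc_pair hincx hbc
      -- An even set through the contracted vertex uses both of its edges and isolates it; any other
      -- even set is already one of `M`.
      have hdb : ¬ H.Conn {e | e ∈ H.edges ∧ d e = 0} ∨ d b = 0 := by
        by_contra! h
        obtain ⟨e, he, hex⟩ := h.1.exists_mem_inc (fun e he ↦ he.1) hxH hy'H hy'x
        rw [hincx] at hex
        have := he.2
        rcases Finset.mem_insert.1 hex with rfl | hex
        · exact h.2 this
        · exact h.2 (hdbc.trans (Finset.mem_singleton.1 hex ▸ this))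
      refine hdb.elim id fun hdb₀ ↦ ?_
      refine hM.not_conn_quot hE hd hd0 (fun e he hde ↦ hoff e he ?_ ?_) hφV
        (fun f hf w _ ↦ ?_)
      · rintro rfl; exact hde hdb₀
      · rintro rfl; exact hde (hdbc ▸ hdb₀)
      · have hc : M.Const {p, q} f := by
          rintro e (rfl | rfl)
          exacts [hf _ hp.mem (by simp), hf _ hq.mem (by simp)]
        exact hfφ f (hc.link (by simp) hp) (hc.link (by simp) hq) w
    · by_cases h : w = x
      · rw [h, hincx]
        exact Finset.card_le_two.trans (by norm_num)
      · exact (Finset.card_le_card (hincn w h)).trans (hM.deg_le w ((hmV w).1 hw).1)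
  have hcardV : (M.verts \ {y, z}).card + 2 = M.verts.card := by
    rw [← Finset.card_pair hr.ne]
    exact Finset.card_sdiff_add_card_eq_card
      (by simp [Finset.insert_subset_iff, hr.left_mem, hr.right_mem])
  obtain ⟨F, hFE, hFc, hFn, hFm⟩ := hM.decomp_of_lt H hgood
    (add_lt_add_of_lt_of_le (by change (M.verts \ {y, z}).card < _; omega)
      (Finset.card_le_card hE))
  have hFE' : ∀ e ∈ F, e ∈ M.edges ∧ e ≠ p ∧ e ≠ q ∧ e ≠ r := fun e he ↦ (hmE e).1 (hFE he)
  -- The triangle edges `s` and `t` join the tree and `o` joins the matching. This works when every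
  -- edge at the ends of `o` outside the triangle is in the tree.
  have finish : ∀ s t o w w', M.Link o w w' → s ≠ t →
      (∀ e, e = p ∨ e = q ∨ e = r ↔ e = s ∨ e = t ∨ e = o) →
      (∀ e ∈ M.inc w, e = s ∨ e = t ∨ e = o ∨ e ∈ F) →
      (∀ e ∈ M.inc w', e = s ∨ e = t ∨ e = o ∨ e ∈ F) →
      (∀ f : α → Prop, M.Const {s, t} f → (f x ↔ f y) ∧ (f x ↔ f z)) → False := by
    intro s t o w w' ho hst hsto hw hw' hf
    have hs := (hsto s).2 (Or.inl rfl)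
    have ht := (hsto t).2 (Or.inr (Or.inl rfl))
    have hE₃ : ∀ e, e = p ∨ e = q ∨ e = r → e ∈ M.edges := by
      rintro e (rfl | rfl | rfl)
      exacts [hp.mem, hq.mem, hr.mem]
    have hF₃ : ∀ e, e = p ∨ e = q ∨ e = r → e ∉ F := by
      intro e he heF
      have := (hFE' e heF).2
      exact he.elim this.1 (fun h ↦ h.elim this.2.1 this.2.2)
    refine hM.not_decomp ⟨insert s (insert t F), ?_, hconst _ (fun f hf' ↦ hf f (hf'.mono ?_)) F
      ?_ hFc, ?_, ?_⟩
    · exact Finset.insert_subset (hE₃ s hs) (Finset.insert_subset (hE₃ t ht)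
        (fun e he ↦ (hFE' e he).1))
    · rintro e (rfl | rfl) <;> simp
    · intro e he; simp [Finset.mem_coe.1 he]
    · rw [Finset.card_insert_of_notMem (by simp [hst, hF₃ s hs]),
        Finset.card_insert_of_notMem (hF₃ t ht)]
      have : F.card + 1 = (M.verts \ {y, z}).card := hFn
      omega
    · intro k e₁ h₁ hF₁ e₂ h₂ hF₂
      simp only [Finset.mem_insert, not_or] at hF₁ hF₂
      by_cases hk : o ∈ M.inc k
      · have : ∀ e ∈ M.inc k, e = s ∨ e = t ∨ e = o ∨ e ∈ F := by
          rcases ho.mem_inc_iff.1 hk with rfl | rfl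
          exacts [hw, hw']
        have h₁ := this e₁ h₁
        have h₂ := this e₂ h₂
        simp only [hF₁, hF₂, false_or, or_false] at h₁ h₂
        rw [h₁, h₂]
      · have k : ∀ e ∈ M.inc k, e ≠ s → e ≠ t → e ∈ H.inc (φ k) := by
          intro e he hes het
          refine mem_inc_quot_of_mem_inc he ((hmE e).2 ⟨(mem_inc.1 he).1, ?_⟩)
          have heo : e ≠ o := fun h ↦ hk (h ▸ he)
          have := mt (hsto e).1 (by simp [hes, het, heo])
          simpa only [not_or] using this
        exact hFm (φ _) e₁ (k e₁ h₁ hF₁.1 hF₁.2.1) hF₁.2.2 e₂ (k e₂ h₂ hF₂.1 hF₂.2.1) hF₂.2.2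
  by_cases hbF : b ∈ F <;> by_cases hcF : c ∈ F
  · refine finish p q r y z hr hpq (fun e ↦ Iff.rfl) ?_ ?_
      (fun f hf ↦ ⟨hf.link (by simp) hp, hf.link (by simp) hq⟩)
    · intro e he
      simp only [hy, Finset.mem_insert, Finset.mem_singleton] at he
      rcases he with rfl | rfl | rfl <;> simp [hbF]
    · intro e he
      simp only [hz, Finset.mem_insert, Finset.mem_singleton] at he
      rcases he with rfl | rfl | rfl <;> simp [hcF]
  · refine finish q r p x y hp hqr (fun e ↦ by clear * -; tauto) ?_ ?_
      (fun f hf ↦ ?_)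
    · intro e he
      simp only [hx, Finset.mem_insert, Finset.mem_singleton] at he
      rcases he with rfl | rfl <;> simp
    · intro e he
      simp only [hy, Finset.mem_insert, Finset.mem_singleton] at he
      rcases he with rfl | rfl | rfl <;> simp [hbF]
    · have h₁ := hf.link (by simp) hq
      exact ⟨h₁.trans (hf.link (by simp) hr).symm, h₁⟩
  · refine finish p r q x z hq hpr (fun e ↦ by clear * -; tauto) ?_ ?_
      (fun f hf ↦ ?_)
    · intro e he
      simp only [hx, Finset.mem_insert, Finset.mem_singleton] at he
      rcases he with rfl | rfl <;> simp
    · intro e he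
      simp only [hz, Finset.mem_insert, Finset.mem_singleton] at he
      rcases he with rfl | rfl | rfl <;> simp [hcF]
    · have h₁ := hf.link (by simp) hp
      exact ⟨h₁, h₁.trans (hf.link (by simp) hr)⟩
  · exact hbc (hFm x b (by simp [hincx]) hbF c (by simp [hincx]) hcF)

/-- A critical graph has no triangle. -/
lemma Critical.no_triangle (hM : M.Critical) (hp : M.Link p x y) (hq : M.Link q x z)
    (hr : M.Link r y z) : False := by
  rcases hM.card_two_of_triangle hp hq hr with h | h | h
  · exact hM.no_triangle_of_card_two hp hq hr h
  · exact hM.no_triangle_of_card_two hp.symm hr hq h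
  · exact hM.no_triangle_of_card_two hq.symm hr.symm hp h

end FinGraph

namespace FinGraph

variable {α β : Type*} {M : FinGraph α β} {e e₁ e₂ p q m n : β}
  {a b c d u v w x y t u₁ u₂ : α} {F F' : Set β} {f : α → Prop}

/-! ### Quadrilaterals -/

/-- The third edge at a vertex of a quadrilateral leaves it: reaching a neighbour of `v` on the
quadrilateral would give parallel edges, and reaching the opposite vertex `t` a triangle. -/
lemma Critical.exists_stub (hM : M.Critical) (hv : (M.inc v).card = 3) (h₁ : M.Link e₁ v u₁)
    (h₂ : M.Link e₂ v u₂) (hne : u₁ ≠ u₂) (ht : M.Link e u₁ t) :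
    ∃ s w, s ≠ e₁ ∧ s ≠ e₂ ∧ M.inc v = {e₁, e₂, s} ∧ M.Link s v w ∧
      w ≠ v ∧ w ≠ u₁ ∧ w ≠ u₂ ∧ w ≠ t := by
  have he : e₁ ≠ e₂ := h₂.edge_ne_of_notMem h₁.mem_inc_right h₁.ne.symm hne
  obtain ⟨s, w, hs₁, hs₂, hinc, hs⟩ :=
    exists_inc_eq_triple hv h₁.mem_inc_left h₂.mem_inc_left he
  refine ⟨s, w, hs₁, hs₂, hinc, hs, hs.ne.symm, ?_, ?_, ?_⟩
  · rintro rfl; exact hs₁ (hM.eq_of_link hs h₁)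
  · rintro rfl; exact hs₂ (hM.eq_of_link hs h₂)
  · rintro rfl; exact hM.no_triangle h₁ hs ht

set_option maxHeartbeats 2000000 in
lemma Critical.no_square_of_card_two (hM : M.Critical) (hp : M.Link p a b) (hm : M.Link m b c)
    (hq : M.Link q c d) (hn : M.Link n a d) (hac : a ≠ c) (hbd : b ≠ d)
    (ha : (M.inc a).card = 2) : False := by
  have hb : (M.inc b).card = 3 :=
    (hM.card_inc hp.right_mem).resolve_left fun h ↦ hM.not_link_of_card_two ha h hp
  have hd : (M.inc d).card = 3 :=
    (hM.card_inc hn.right_mem).resolve_left fun h ↦ hM.not_link_of_card_two ha h hn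
  have hc : (M.inc c).card = 3 :=
    (hM.card_inc hm.right_mem).resolve_left fun h ↦
      hM.not_link_link_of_card_two ha h hac hp hm.symm
  have hpn : p ≠ n := hn.edge_ne_of_notMem hp.mem_inc_right hp.ne.symm hbd
  have hinca : M.inc a = {p, n} := by
    obtain ⟨n', _, hn', hx, -⟩ := exists_inc_eq_pair ha hp.mem_inc_left
    have := hx ▸ hn.mem_inc_left
    simp only [Finset.mem_insert, hpn.symm, Finset.mem_singleton, false_or] at this
    rw [hx, this]
  obtain ⟨sb, b', hsbp, hsbm, hincb, hsb, hb'b, hb'a, hb'c, hb'd⟩ :=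
    hM.exists_stub hb hp.symm hm hac hn
  obtain ⟨sc, c', hscm, hscq, hincc, hsc, hc'c, hc'b, hc'd, hc'a⟩ :=
    hM.exists_stub hc hm.symm hq hbd hp.symm
  obtain ⟨sd, d', hsdq, hsdn, hincd, hsd, hd'd, hd'c, hd'a, hd'b⟩ :=
    hM.exists_stub hd hq.symm hn.symm hac.symm hm.symm
  have hb'c' : b' ≠ c' := by
    rintro rfl; exact hM.no_triangle hsb hm hsc.symm
  have hab := hp.ne
  have had := hn.ne
  have hbc := hm.ne
  have hcd := hq.ne
  have hpm : p ≠ m := hm.edge_ne_of_notMem hp.mem_inc_left hab hac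
  have hpq : p ≠ q := hq.edge_ne_of_notMem hp.mem_inc_left hac had
  have hmq : m ≠ q := hq.edge_ne_of_notMem hm.mem_inc_left hbc hbd
  have hmn : m ≠ n := hn.edge_ne_of_notMem hm.mem_inc_left hab.symm hbd
  have hqn : q ≠ n := hn.edge_ne_of_notMem hq.mem_inc_left hac.symm hcd
  have hsbq : sb ≠ q := hq.edge_ne_of_notMem hsb.mem_inc_left hbc hbd
  have hsbn : sb ≠ n := hn.edge_ne_of_notMem hsb.mem_inc_left hab.symm hbd
  have hscp : sc ≠ p := hp.edge_ne_of_notMem hsc.mem_inc_left hac.symm hbc.symm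
  have hscn : sc ≠ n := hn.edge_ne_of_notMem hsc.mem_inc_left hac.symm hcd
  have hsdp : sd ≠ p := hp.edge_ne_of_notMem hsd.mem_inc_left had.symm hbd.symm
  have hsdm : sd ≠ m := hm.edge_ne_of_notMem hsd.mem_inc_left hbd.symm hcd.symm
  have hsbc : sb ≠ sc := hsc.edge_ne_of_notMem hsb.mem_inc_left hbc hc'b.symm
  have hsbd : sb ≠ sd := hsd.edge_ne_of_notMem hsb.mem_inc_left hbd hd'b.symm
  have hscd : sc ≠ sd := hsd.edge_ne_of_notMem hsc.mem_inc_left hcd hd'c.symm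
  set φ : α → α := fun w ↦ if w = b then b' else if w = c then c' else w with hφ
  have hφb : φ b = b' := by simp [hφ]
  have hφc : φ c = c' := by simp [hφ, hbc.symm]
  have hφn : ∀ w, w ≠ b → w ≠ c → φ w = w := fun w h h' ↦ by simp [hφ, h, h']
  obtain ⟨V', hV'⟩ : ∃ V', V' = M.verts \ {a, b, c, d} := ⟨_, rfl⟩
  obtain ⟨E', hE'⟩ : ∃ E', E' = M.edges \ {p, q, n, sb, sc, sd} := ⟨_, rfl⟩
  have hmV : ∀ w, w ∈ V' ↔ w ∈ M.verts ∧ w ≠ a ∧ w ≠ b ∧ w ≠ c ∧ w ≠ d := by simp [hV']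
  have hmE : ∀ e, e ∈ E' ↔
      e ∈ M.edges ∧ e ≠ p ∧ e ≠ q ∧ e ≠ n ∧ e ≠ sb ∧ e ≠ sc ∧ e ≠ sd := by simp [hE']
  have hE : E' ⊆ M.edges := fun e he ↦ ((hmE e).1 he).1
  have hb'V : b' ∈ V' := (hmV _).2 ⟨hsb.right_mem, hb'a, hb'b, hb'c, hb'd⟩
  have hc'V : c' ∈ V' := (hmV _).2 ⟨hsc.right_mem, hc'a, hc'b, hc'c, hc'd⟩
  have hd'V : d' ∈ V' := (hmV _).2 ⟨hsd.right_mem, hd'a, hd'b, hd'c, hd'd⟩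
  have hmmE : m ∈ E' := (hmE m).2 ⟨hm.mem, hpm.symm, hmq, hmn, hsbm.symm, hscm.symm, hsdm.symm⟩
  have hφV : ∀ w ∈ V', φ w = w := fun w hw ↦ hφn w ((hmV w).1 hw).2.2.1 ((hmV w).1 hw).2.2.2.1
  have hends : ∀ e ∈ E', e ≠ m → M.src e ∈ V' ∧ M.tgt e ∈ V' := by
    intro e he hem
    have he := (hmE e).1 he
    have h1 : e ∉ M.inc a := by simp [hinca, he]
    have h2 : e ∉ M.inc b := by simp [hincb, he, hem]
    have h3 : e ∉ M.inc c := by simp [hincc, he, hem]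
    have h4 : e ∉ M.inc d := by simp [hincd, he]
    rw [hmV, hmV]
    exact ⟨⟨M.src_mem e he.1, src_ne_of_notMem_inc he.1 h1, src_ne_of_notMem_inc he.1 h2,
      src_ne_of_notMem_inc he.1 h3, src_ne_of_notMem_inc he.1 h4⟩,
      ⟨M.tgt_mem e he.1, tgt_ne_of_notMem_inc he.1 h1, tgt_ne_of_notMem_inc he.1 h2,
      tgt_ne_of_notMem_inc he.1 h3, tgt_ne_of_notMem_inc he.1 h4⟩⟩
  have hφE : ∀ e ∈ E', e ≠ m → φ (M.src e) = M.src e ∧ φ (M.tgt e) = M.tgt e :=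
    fun e he hem ↦ ⟨hφV _ (hends e he hem).1, hφV _ (hends e he hem).2⟩
  have hquot : ∀ e ∈ E', φ (M.src e) ∈ V' ∧ φ (M.tgt e) ∈ V' ∧
      φ (M.src e) ≠ φ (M.tgt e) := by
    intro e he
    by_cases hem : e = m
    · rw [hem]
      rcases hm with ⟨-, ⟨h, h'⟩ | ⟨h, h'⟩⟩ <;> rw [h, h', hφb, hφc]
      exacts [⟨hb'V, hc'V, hb'c'⟩, ⟨hc'V, hb'V, hb'c'.symm⟩]
    · rw [(hφE e he hem).1, (hφE e he hem).2]
      exact ⟨(hends e he hem).1, (hends e he hem).2, M.src_ne_tgt e (hE he)⟩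
  obtain ⟨H, hH⟩ : ∃ H, H = M.quot φ V' E' (fun e he ↦ (hquot e he).1)
    (fun e he ↦ (hquot e he).2.1) (fun e he ↦ (hquot e he).2.2) := ⟨_, rfl⟩
  have hHv : H.verts = V' := by rw [hH]; rfl
  have hHe : H.edges = E' := by rw [hH]; rfl
  have hHm : H.Link m b' c' := by
    have := hm.quot (hs := fun e he ↦ (hquot e he).1) (ht := fun e he ↦ (hquot e he).2.1)
      (hne := fun e he ↦ (hquot e he).2.2) hmmE
    rwa [hφb, hφc, ← hH] at this
  have hHl : ∀ e ∈ E', e ≠ m → H.src e = M.src e ∧ H.tgt e = M.tgt e := by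
    intro e he hem
    rw [hH]
    exact hφE e he hem
  have hHconst : ∀ (F : Set β) (f : α → Prop), F ⊆ E' → (m ∈ F → (f b' ↔ f c')) →
      (∀ e ∈ F, e ≠ m → (f (M.src e) ↔ f (M.tgt e))) → H.Const F f := by
    intro F f hF h1 h2 e he
    by_cases hem : e = m
    · subst hem
      exact hHm.iff_of_src_tgt (h1 he)
    · rw [(hHl e (hF he) hem).1, (hHl e (hF he) hem).2]
      exact h2 e he hem
  have hHinc : ∀ w ∈ V', ∀ e ∈ M.inc w, e ∈ E' → e ∈ H.inc w := by
    intro w hw e he heE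
    have := mem_inc_quot_of_mem_inc (hs := fun e he ↦ (hquot e he).1)
      (ht := fun e he ↦ (hquot e he).2.1) (hne := fun e he ↦ (hquot e he).2.2) he heE
    rwa [hφV w hw, ← hH] at this
  have hgood : H.Good := by
    refine ⟨⟨⟨b', hHv ▸ hb'V⟩, fun f hf u hu v hv hfu ↦ ?_⟩, fun z hz hz0 hzc ↦ ?_, fun w hw ↦ ?_⟩
    · rw [hHv] at hu hv
      rw [hHe] at hf
      have hbc' : f b' ↔ f c' := hf.link hmmE hHm
      -- All four vertices of the quadrilateral receive the common value of `b'` and `c'`. Then only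
      -- `sd` could be cut, and it is not a bridge.
      set g : α → Prop := fun w ↦ if w = a ∨ w = d then f b' else f (φ w) with hg
      have ga : g a ↔ f b' := by simp [hg]
      have gd : g d ↔ f b' := by simp [hg]
      have gb : g b ↔ f b' := by simp [hg, hab.symm, hbd, hφb]
      have gc : g c ↔ f b' := by simp [hg, hac.symm, hcd, hφc, hbc']
      have gV : ∀ w ∈ V', (g w ↔ f w) := fun w hw ↦ by
        have := (hmV w).1 hw
        simp [hg, this, hφV w hw]
      rw [← gV u hu] at hfu
      rw [← gV v hv]
      refine (hM.iff_of_bridge (f := g) hsd.mem (fun e he hes ↦ ?_) ((hmV u).1 hu).1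
        ((hmV v).1 hv).1).1 hfu
      by_cases h1 : e = p
      · exact h1 ▸ hp.iff_of_src_tgt (ga.trans gb.symm)
      by_cases h2 : e = q
      · exact h2 ▸ hq.iff_of_src_tgt (gc.trans gd.symm)
      by_cases h3 : e = n
      · exact h3 ▸ hn.iff_of_src_tgt (ga.trans gd.symm)
      by_cases h4 : e = sb
      · exact h4 ▸ hsb.iff_of_src_tgt (gb.trans (gV _ hb'V).symm)
      by_cases h5 : e = sc
      · exact h5 ▸ hsc.iff_of_src_tgt (gc.trans (hbc'.trans (gV _ hc'V).symm))
      by_cases h6 : e = m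
      · exact h6 ▸ hm.iff_of_src_tgt (gb.trans gc.symm)
      have heE := (hmE e).2 ⟨he, h1, h2, h3, h4, h5, hes⟩
      rw [gV _ (hends e heE h6).1, gV _ (hends e heE h6).2, ← (hHl e heE h6).1, ← (hHl e heE h6).2]
      exact hf e heE
    · rw [hHe] at hz0
      -- An even set using the new edge is routed along `sb`, `m`, `sc`.
      set z' : β → ZMod 2 := fun e ↦ if e = sb ∨ e = sc then z m else if e ∈ E' then z e else 0
        with hz'
      have z'E : ∀ e ∈ E', z' e = z e := fun e he ↦ by
        have := (hmE e).1 he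
        simp [hz', this, he]
      have z'sb : z' sb = z m := by simp [hz']
      have z'sc : z' sc = z m := by simp [hz']
      have z'n : ∀ e, e ∉ E' → e ≠ sb → e ≠ sc → z' e = 0 := fun e he h h' ↦ by
        simp [hz', he, h, h']
      have hpE : p ∉ E' := by simp [hmE]
      have hqE : q ∉ E' := by simp [hmE]
      have hnE : n ∉ E' := by simp [hmE]
      have hsbE : sb ∉ E' := by simp [hmE]
      have hscE : sc ∉ E' := by simp [hmE]
      have hsdE : sd ∉ E' := by simp [hmE]
      obtain ⟨e₀, he₀, hze₀⟩ := hz0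
      refine hM.sep z' (fun g ↦ ?_) ⟨e₀, hE he₀, by rwa [z'E e₀ he₀]⟩
        ⟨hM.conn.1, fun f hf u hu v hv hfu ↦ ?_⟩
      · have h1 := hz g
        rw [hHe, ← Finset.add_sum_erase _ _ hmmE, hHm.add_eq] at h1
        rw [← Finset.sum_subset (s₁ := insert sb (insert sc E')),
          Finset.sum_insert (by simp [hsbc, hsbE]), Finset.sum_insert hscE,
          ← Finset.add_sum_erase _ _ hmmE, hsb.add_eq, hsc.add_eq, hm.add_eq, z'sb, z'sc,
          z'E m hmmE, Finset.sum_congr rfl (g := fun e ↦ z e * (g (H.src e) + g (H.tgt e)))]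
        · linear_combination h1 + (z m * (g b + g c)) * CharTwo.two_eq_zero (R := ZMod 2)
        · intro e he
          have he := Finset.mem_erase.1 he
          rw [z'E e he.2, (hHl e he.2 he.1).1, (hHl e he.2 he.1).2]
        · exact Finset.insert_subset hsb.mem (Finset.insert_subset hsc.mem hE)
        · intro e _ he
          simp only [Finset.mem_insert, not_or] at he
          rw [z'n e he.2.2 he.1 he.2.1, zero_mul]
      -- The lifted set avoids `p`, `q`, `n` and `sd`, so after its deletion all four vertices are
      -- still joined to `d'`. Hence connectivity carries over from `H`.
      · have kp : f a ↔ f b := hf.link ⟨hp.mem, z'n p hpE hsbp.symm hscp.symm⟩ hp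
        have kq : f c ↔ f d := hf.link ⟨hq.mem, z'n q hqE hsbq.symm hscq.symm⟩ hq
        have kn : f a ↔ f d := hf.link ⟨hn.mem, z'n n hnE hsbn.symm hscn.symm⟩ hn
        have kd : f d ↔ f d' := hf.link ⟨hsd.mem, z'n sd hsdE hsbd.symm hscd.symm⟩ hsd
        have key : ∀ w ∈ M.verts, ∃ w' ∈ V', (f w ↔ f w') := by
          intro w hw
          by_cases h1 : w = a
          · exact ⟨d', hd'V, h1 ▸ kn.trans kd⟩
          by_cases h2 : w = b
          · exact ⟨d', hd'V, h2 ▸ kp.symm.trans (kn.trans kd)⟩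
          by_cases h3 : w = c
          · exact ⟨d', hd'V, h3 ▸ kq.trans kd⟩
          by_cases h4 : w = d
          · exact ⟨d', hd'V, h4 ▸ kd⟩
          exact ⟨w, (hmV w).2 ⟨hw, h1, h2, h3, h4⟩, Iff.rfl⟩
        obtain ⟨u', hu', huu⟩ := key u hu
        obtain ⟨v', hv', hvv⟩ := key v hv
        rw [hvv]
        rw [huu] at hfu
        refine (hzc.iff (f := f) (hHconst _ f (fun e he ↦ hHe ▸ he.1) (fun hmz ↦ ?_)
          fun e he hem ↦ ?_) (hHv ▸ hu') (hHv ▸ hv')).1 hfu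
        · have k1 : f b ↔ f b' := hf.link ⟨hsb.mem, z'sb.trans hmz.2⟩ hsb
          have k2 : f c ↔ f c' := hf.link ⟨hsc.mem, z'sc.trans hmz.2⟩ hsc
          exact k1.symm.trans (kp.symm.trans (kn.trans (kq.symm.trans k2)))
        · have heE : e ∈ E' := hHe ▸ he.1
          exact hf e ⟨hE heE, (z'E e heE).trans he.2⟩
    · rw [hHv] at hw
      set ψ : β → β := fun e ↦ if e = sb ∨ e = sc then m else e with hψ
      have hsub : H.inc w ⊆ (M.inc w).image ψ := by
        intro e he
        rw [hH] at he
        have heE := (hmE e).1 (mem_inc_quot.1 he).1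
        obtain ⟨v, hv, he⟩ := mem_inc_of_mem_inc_quot he hE
        by_cases hvb : v = b
        · rw [hvb, hincb] at he
          have : e = m := by simpa [heE] using he
          rw [← hv, hvb, hφb]
          exact Finset.mem_image.2 ⟨sb, hsb.mem_inc_right, by simp [hψ, this]⟩
        by_cases hvc : v = c
        · rw [hvc, hincc] at he
          have : e = m := by simpa [heE] using he
          rw [← hv, hvc, hφc]
          exact Finset.mem_image.2 ⟨sc, hsc.mem_inc_right, by simp [hψ, this]⟩
        rw [hφn v hvb hvc] at hv
        exact Finset.mem_image.2 ⟨e, hv ▸ he, by simp [hψ, heE]⟩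
      exact (Finset.card_le_card hsub).trans (Finset.card_image_le.trans
        (hM.deg_le w ((hmV w).1 hw).1))
  have hcardV : V'.card + 4 = M.verts.card := by
    have h4 : ({a, b, c, d} : Finset α).card = 4 := by
      rw [Finset.card_insert_of_notMem (by simp [hab, hac, had]),
        Finset.card_insert_of_notMem (by simp [hbc, hbd]), Finset.card_pair hcd]
    rw [hV', ← h4]
    exact Finset.card_sdiff_add_card_eq_card (by
      simp [Finset.insert_subset_iff, hp.left_mem, hp.right_mem, hq.left_mem, hq.right_mem])
  obtain ⟨F, hFE, hFc, hFn, hFm⟩ := hM.decomp_of_lt H hgood (by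
    rw [hHv, hHe]
    exact add_lt_add_of_lt_of_le (by omega) (Finset.card_le_card hE))
  rw [hHe] at hFE
  rw [hHv] at hFn
  have hFE' := fun e (he : e ∈ F) ↦ (hmE e).1 (hFE he)
  have finish : ∀ F' : Finset β, F' ⊆ M.edges → F'.card = F.card + 4 →
      (∀ f, M.Const F' f → (f a ↔ f d') ∧ (f b ↔ f d') ∧ (f c ↔ f d') ∧ (f d ↔ f d') ∧
        H.Const F f) →
      (∀ w, w = a ∨ w = b ∨ w = c ∨ w = d → ∃ o, ∀ e ∈ M.inc w, e = o ∨ e ∈ F') →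
      (∀ w ∈ V', ∀ e ∈ M.inc w, e ∉ F' → ∀ e' ∈ M.inc w, e' ∉ F' → e = e') → False := by
    intro F' hF' hcard hconn hsq hout
    refine hM.not_decomp ⟨F', hF', ⟨hM.conn.1, fun f hf u hu v hv hfu ↦ ?_⟩, by omega, ?_⟩
    · obtain ⟨ka, kb, kc, kd, kF⟩ := hconn f hf
      have key : ∀ w ∈ M.verts, (f w ↔ f d') := by
        intro w hw
        by_cases h1 : w = a
        · exact h1 ▸ ka
        by_cases h2 : w = b
        · exact h2 ▸ kb
        by_cases h3 : w = c
        · exact h3 ▸ kc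
        by_cases h4 : w = d
        · exact h4 ▸ kd
        exact hFc.iff kF (hHv ▸ (hmV w).2 ⟨hw, h1, h2, h3, h4⟩) (hHv ▸ hd'V)
      exact (key v hv).2 ((key u hu).1 hfu)
    · intro w e₁ h₁ hF₁ e₂ h₂ hF₂
      by_cases hw : w = a ∨ w = b ∨ w = c ∨ w = d
      · obtain ⟨o, ho⟩ := hsq w hw
        rw [(ho e₁ h₁).resolve_right hF₁, (ho e₂ h₂).resolve_right hF₂]
      · have hwM : w ∈ M.verts := by
          obtain ⟨_, h⟩ := exists_link h₁
          exact h.left_mem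
        refine hout w ((hmV w).2 ⟨hwM, ?_⟩) e₁ h₁ hF₁ e₂ h₂ hF₂
        simpa only [not_or] using hw
  -- If the new edge is in the tree, the path it stands for is restored, `n` and `sd` attach `a` and
  -- `d`, and `p`, `q` are omitted. If not, the path `a b c d` is hung on `d'` by `sd`. Then `n`,
  -- `sb`, `sc` are omitted; the last two replace the matching edge `m` at `b'` and `c'`.
  by_cases hmF : m ∈ F
  · refine finish (insert sb (insert sc (insert sd (insert n F)))) ?_ ?_ ?_ ?_ ?_
    · simp only [Finset.insert_subset_iff, hsb.mem, hsc.mem, hsd.mem, hn.mem, true_and]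
      exact hFE.trans hE
    · rw [Finset.card_insert_of_notMem, Finset.card_insert_of_notMem,
        Finset.card_insert_of_notMem, Finset.card_insert_of_notMem] <;>
      try simp only [Finset.mem_insert, not_or]
      · exact fun h ↦ (hFE' n h).2.2.2.1 rfl
      · exact ⟨hsdn, fun h ↦ (hFE' sd h).2.2.2.2.2.2 rfl⟩
      · exact ⟨hscd, hscn, fun h ↦ (hFE' sc h).2.2.2.2.2.1 rfl⟩
      · exact ⟨hsbc, hsbd, hsbn, fun h ↦ (hFE' sb h).2.2.2.2.1 rfl⟩
    · intro f hf
      have k1 : f b ↔ f b' := hf.link (by simp) hsb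
      have k2 : f c ↔ f c' := hf.link (by simp) hsc
      have k3 : f d ↔ f d' := hf.link (by simp) hsd
      have k4 : f a ↔ f d := hf.link (by simp) hn
      have k5 : f b ↔ f c := hf.link (by simp [hmF]) hm
      have kF : H.Const F f := hHconst F f (by exact_mod_cast hFE)
        (fun _ ↦ k1.symm.trans (k5.trans k2)) fun e he _ ↦ hf e (by simp [Finset.mem_coe.1 he])
      have k6 : f b' ↔ f d' := hFc.iff kF (hHv ▸ hb'V) (hHv ▸ hd'V)
      exact ⟨k4.trans k3, k1.trans k6, k5.symm.trans (k1.trans k6), k3, kF⟩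
    · rintro w (rfl | rfl | rfl | rfl)
      · exact ⟨p, by simp [hinca]⟩
      · exact ⟨p, by simp [hincb, hmF]⟩
      · exact ⟨q, by simp [hincc, hmF]⟩
      · exact ⟨q, by simp [hincd]⟩
    · intro w hw e₁ h₁ hF₁ e₂ h₂ hF₂
      have hw' := (hmV w).1 hw
      have k : ∀ e ∈ M.inc w, e ∉ insert sb (insert sc (insert sd (insert n F))) →
          e ∈ H.inc w ∧ e ∉ F := by
        intro e he heF
        simp only [Finset.mem_insert, not_or] at heF
        refine ⟨hHinc w hw e he ((hmE e).2 ⟨(mem_inc.1 he).1, ?_, ?_, heF.2.2.2.1, heF.1, heF.2.1,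
          heF.2.2.1⟩), heF.2.2.2.2⟩
        · exact hp.edge_ne_of_notMem he hw'.2.1 hw'.2.2.1
        · exact hq.edge_ne_of_notMem he hw'.2.2.2.1 hw'.2.2.2.2
      exact hFm w e₁ (k e₁ h₁ hF₁).1 (k e₁ h₁ hF₁).2 e₂ (k e₂ h₂ hF₂).1 (k e₂ h₂ hF₂).2
  · refine finish (insert p (insert m (insert q (insert sd F)))) ?_ ?_ ?_ ?_ ?_
    · simp only [Finset.insert_subset_iff, hp.mem, hm.mem, hsd.mem, hq.mem, true_and]
      exact hFE.trans hE
    · rw [Finset.card_insert_of_notMem, Finset.card_insert_of_notMem,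
        Finset.card_insert_of_notMem, Finset.card_insert_of_notMem] <;>
      try simp only [Finset.mem_insert, not_or]
      · exact fun h ↦ (hFE' sd h).2.2.2.2.2.2 rfl
      · exact ⟨hsdq.symm, fun h ↦ (hFE' q h).2.2.1 rfl⟩
      · exact ⟨hmq, hsdm.symm, hmF⟩
      · exact ⟨hpm, hpq, hsdp.symm, fun h ↦ (hFE' p h).2.1 rfl⟩
    · intro f hf
      have k1 : f a ↔ f b := hf.link (by simp) hp
      have k2 : f b ↔ f c := hf.link (by simp) hm
      have k3 : f c ↔ f d := hf.link (by simp) hq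
      have k4 : f d ↔ f d' := hf.link (by simp) hsd
      exact ⟨k1.trans (k2.trans (k3.trans k4)), k2.trans (k3.trans k4), k3.trans k4, k4,
        hHconst F f (by exact_mod_cast hFE) (fun h ↦ absurd h hmF)
          fun e he _ ↦ hf e (by simp [Finset.mem_coe.1 he])⟩
    · rintro w (rfl | rfl | rfl | rfl)
      · exact ⟨n, by simp [hinca]⟩
      · exact ⟨sb, by simp [hincb]⟩
      · exact ⟨sc, by simp [hincc]⟩
      · exact ⟨n, by simp [hincd]⟩
    · intro w hw e₁ h₁ hF₁ e₂ h₂ hF₂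
      have hw' := (hmV w).1 hw
      have k : ∀ e ∈ M.inc w, e ∉ insert p (insert m (insert q (insert sd F))) →
          e = sb ∧ w = b' ∨ e = sc ∧ w = c' ∨ e ∈ H.inc w ∧ e ∉ F ∧ e ≠ m := by
        intro e he heF
        simp only [Finset.mem_insert, not_or] at heF
        by_cases h1 : e = sb
        · exact Or.inl ⟨h1, (hsb.mem_inc_iff.1 (h1 ▸ he)).resolve_left hw'.2.2.1⟩
        by_cases h2 : e = sc
        · exact Or.inr (Or.inl ⟨h2, (hsc.mem_inc_iff.1 (h2 ▸ he)).resolve_left hw'.2.2.2.1⟩)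
        refine Or.inr (Or.inr ⟨hHinc w hw e he ((hmE e).2 ⟨(mem_inc.1 he).1, heF.1, heF.2.2.1, ?_,
          h1, h2, heF.2.2.2.1⟩), heF.2.2.2.2, heF.2.1⟩)
        exact hn.edge_ne_of_notMem he hw'.2.1 hw'.2.2.2.2
      have kb : ∀ e ∈ H.inc b', e ∉ F → e = m := fun e he heF ↦
        hFm b' e he heF m hHm.mem_inc_left hmF
      have kc : ∀ e ∈ H.inc c', e ∉ F → e = m := fun e he heF ↦
        hFm c' e he heF m hHm.mem_inc_right hmF
      rcases k e₁ h₁ hF₁ with ⟨h, h'⟩ | ⟨h, h'⟩ | ⟨h, h', h''⟩ <;>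
        rcases k e₂ h₂ hF₂ with ⟨j, j'⟩ | ⟨j, j'⟩ | ⟨j, j', j''⟩
      · rw [h, j]
      · exact absurd (h'.symm.trans j') hb'c'
      · exact absurd (kb e₂ (h' ▸ j) j') j''
      · exact absurd (j'.symm.trans h') hb'c'
      · rw [h, j]
      · exact absurd (kc e₂ (h' ▸ j) j') j''
      · exact absurd (kb e₁ (j' ▸ h) h') h''
      · exact absurd (kc e₁ (j' ▸ h) h') h''
      · exact hFm w e₁ h h' e₂ j j'

end FinGraph

/-! ### Quadrilaterals all of whose vertices have degree three -/

namespace FinGraph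

variable {α β : Type*} {M : FinGraph α β} {e e₁ e₂ p q m n : β}
  {a b c d u v w x y t u₁ u₂ : α} {F F' : Set β} {f : α → Prop}

-- The cut `h` crosses both `m` and `n`. The quadrilateral is removed, and the two paths `b' b c c'`
-- and `a' a d d'` are replaced by edges that keep the names `m` and `n`. In the new graph `h` cuts
-- exactly these two edges: an even set contains both or neither, and every spanning tree contains
-- at least one.
set_option maxHeartbeats 2000000 in
lemma Critical.no_square_of_cut (hM : M.Critical) (hp : M.Link p a b) (hm : M.Link m b c)
    (hq : M.Link q c d) (hn : M.Link n a d) (hac : a ≠ c) (hbd : b ≠ d)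
    (ha : (M.inc a).card = 3) (hb : (M.inc b).card = 3) (hc : (M.inc c).card = 3)
    (hd : (M.inc d).card = 3) {h : α → Prop}
    (hh : ∀ e ∈ M.edges, e ∉ ({p, m, q, n} : Finset β) → (h (M.src e) ↔ h (M.tgt e)))
    (h₁ : ¬ (h b ↔ h c)) (h₂ : ¬ (h a ↔ h d)) : False := by
  obtain ⟨sa, a', hsap, hsan, hinca, hsa, ha'a, ha'b, ha'd, ha'c⟩ :=
    hM.exists_stub ha hp hn hbd hm
  obtain ⟨sb, b', hsbp, hsbm, hincb, hsb, hb'b, hb'a, hb'c, hb'd⟩ :=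
    hM.exists_stub hb hp.symm hm hac hn
  obtain ⟨sc, c', hscm, hscq, hincc, hsc, hc'c, hc'b, hc'd, hc'a⟩ :=
    hM.exists_stub hc hm.symm hq hbd hp.symm
  obtain ⟨sd, d', hsdq, hsdn, hincd, hsd, hd'd, hd'c, hd'a, hd'b⟩ :=
    hM.exists_stub hd hq.symm hn.symm hac.symm hm.symm
  have hb'c' : b' ≠ c' := by
    rintro rfl; exact hM.no_triangle hsb hm hsc.symm
  have ha'd' : a' ≠ d' := by
    rintro rfl; exact hM.no_triangle hsa hn hsd.symm
  have hab := hp.ne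
  have had := hn.ne
  have hbc := hm.ne
  have hcd := hq.ne
  have hpn : p ≠ n := hn.edge_ne_of_notMem hp.mem_inc_right hab.symm hbd
  have hpm : p ≠ m := hm.edge_ne_of_notMem hp.mem_inc_left hab hac
  have hpq : p ≠ q := hq.edge_ne_of_notMem hp.mem_inc_left hac had
  have hmq : m ≠ q := hq.edge_ne_of_notMem hm.mem_inc_left hbc hbd
  have hmn : m ≠ n := hn.edge_ne_of_notMem hm.mem_inc_left hab.symm hbd
  have hqn : q ≠ n := hn.edge_ne_of_notMem hq.mem_inc_left hac.symm hcd
  have hsam : sa ≠ m := hm.edge_ne_of_notMem hsa.mem_inc_left hab hac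
  have hsaq : sa ≠ q := hq.edge_ne_of_notMem hsa.mem_inc_left hac had
  have hsbq : sb ≠ q := hq.edge_ne_of_notMem hsb.mem_inc_left hbc hbd
  have hsbn : sb ≠ n := hn.edge_ne_of_notMem hsb.mem_inc_left hab.symm hbd
  have hscp : sc ≠ p := hp.edge_ne_of_notMem hsc.mem_inc_left hac.symm hbc.symm
  have hscn : sc ≠ n := hn.edge_ne_of_notMem hsc.mem_inc_left hac.symm hcd
  have hsdp : sd ≠ p := hp.edge_ne_of_notMem hsd.mem_inc_left had.symm hbd.symm
  have hsdm : sd ≠ m := hm.edge_ne_of_notMem hsd.mem_inc_left hbd.symm hcd.symm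
  have hsab : sa ≠ sb := hsb.edge_ne_of_notMem hsa.mem_inc_left hab hb'a.symm
  have hsac : sa ≠ sc := hsc.edge_ne_of_notMem hsa.mem_inc_left hac hc'a.symm
  have hsad : sa ≠ sd := hsd.edge_ne_of_notMem hsa.mem_inc_left had hd'a.symm
  have hsbc : sb ≠ sc := hsc.edge_ne_of_notMem hsb.mem_inc_left hbc hc'b.symm
  have hsbd : sb ≠ sd := hsd.edge_ne_of_notMem hsb.mem_inc_left hbd hd'b.symm
  have hscd : sc ≠ sd := hsd.edge_ne_of_notMem hsc.mem_inc_left hcd hd'c.symm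
  set φ : α → α := fun w ↦ if w = a then a' else if w = b then b' else if w = c then c' else
    if w = d then d' else w with hφ
  have hφa : φ a = a' := by simp [hφ]
  have hφb : φ b = b' := by simp [hφ, hab.symm]
  have hφc : φ c = c' := by simp [hφ, hac.symm, hbc.symm]
  have hφd : φ d = d' := by simp [hφ, had.symm, hbd.symm, hcd.symm]
  obtain ⟨V', hV'⟩ : ∃ V', V' = M.verts \ {a, b, c, d} := ⟨_, rfl⟩
  obtain ⟨E', hE'⟩ : ∃ E', E' = M.edges \ {p, q, sa, sb, sc, sd} := ⟨_, rfl⟩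
  have hmV : ∀ w, w ∈ V' ↔ w ∈ M.verts ∧ w ≠ a ∧ w ≠ b ∧ w ≠ c ∧ w ≠ d := by simp [hV']
  have hmE : ∀ e, e ∈ E' ↔
      e ∈ M.edges ∧ e ≠ p ∧ e ≠ q ∧ e ≠ sa ∧ e ≠ sb ∧ e ≠ sc ∧ e ≠ sd := by simp [hE']
  have hE : E' ⊆ M.edges := fun e he ↦ ((hmE e).1 he).1
  have ha'V : a' ∈ V' := (hmV _).2 ⟨hsa.right_mem, ha'a, ha'b, ha'c, ha'd⟩
  have hb'V : b' ∈ V' := (hmV _).2 ⟨hsb.right_mem, hb'a, hb'b, hb'c, hb'd⟩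
  have hc'V : c' ∈ V' := (hmV _).2 ⟨hsc.right_mem, hc'a, hc'b, hc'c, hc'd⟩
  have hd'V : d' ∈ V' := (hmV _).2 ⟨hsd.right_mem, hd'a, hd'b, hd'c, hd'd⟩
  have hmmE : m ∈ E' :=
    (hmE m).2 ⟨hm.mem, hpm.symm, hmq, hsam.symm, hsbm.symm, hscm.symm, hsdm.symm⟩
  have hnnE : n ∈ E' :=
    (hmE n).2 ⟨hn.mem, hpn.symm, hqn.symm, hsan.symm, hsbn.symm, hscn.symm, hsdn.symm⟩
  have hφn : ∀ w, w ≠ a → w ≠ b → w ≠ c → w ≠ d → φ w = w := fun w h h' h'' h''' ↦ by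
    simp [hφ, h, h', h'', h''']
  have hφV : ∀ w ∈ V', φ w = w := fun w hw ↦ by
    have := (hmV w).1 hw
    exact hφn w this.2.1 this.2.2.1 this.2.2.2.1 this.2.2.2.2
  have hends : ∀ e ∈ E', e ≠ m → e ≠ n → M.src e ∈ V' ∧ M.tgt e ∈ V' := by
    intro e he hem hen
    have he := (hmE e).1 he
    have h1 : e ∉ M.inc a := by simp [hinca, he, hen]
    have h2 : e ∉ M.inc b := by simp [hincb, he, hem]
    have h3 : e ∉ M.inc c := by simp [hincc, he, hem]
    have h4 : e ∉ M.inc d := by simp [hincd, he, hen]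
    rw [hmV, hmV]
    exact ⟨⟨M.src_mem e he.1, src_ne_of_notMem_inc he.1 h1, src_ne_of_notMem_inc he.1 h2,
      src_ne_of_notMem_inc he.1 h3, src_ne_of_notMem_inc he.1 h4⟩,
      ⟨M.tgt_mem e he.1, tgt_ne_of_notMem_inc he.1 h1, tgt_ne_of_notMem_inc he.1 h2,
      tgt_ne_of_notMem_inc he.1 h3, tgt_ne_of_notMem_inc he.1 h4⟩⟩
  have hφE : ∀ e ∈ E', e ≠ m → e ≠ n → φ (M.src e) = M.src e ∧ φ (M.tgt e) = M.tgt e :=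
    fun e he hem hen ↦ ⟨hφV _ (hends e he hem hen).1, hφV _ (hends e he hem hen).2⟩
  have hquot : ∀ e ∈ E', φ (M.src e) ∈ V' ∧ φ (M.tgt e) ∈ V' ∧
      φ (M.src e) ≠ φ (M.tgt e) := by
    intro e he
    by_cases hem : e = m
    · rw [hem]
      rcases hm with ⟨-, ⟨h, h'⟩ | ⟨h, h'⟩⟩ <;> rw [h, h', hφb, hφc]
      exacts [⟨hb'V, hc'V, hb'c'⟩, ⟨hc'V, hb'V, hb'c'.symm⟩]
    by_cases hen : e = n
    · rw [hen]
      rcases hn with ⟨-, ⟨h, h'⟩ | ⟨h, h'⟩⟩ <;> rw [h, h', hφa, hφd]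
      exacts [⟨ha'V, hd'V, ha'd'⟩, ⟨hd'V, ha'V, ha'd'.symm⟩]
    · rw [(hφE e he hem hen).1, (hφE e he hem hen).2]
      exact ⟨(hends e he hem hen).1, (hends e he hem hen).2, M.src_ne_tgt e (hE he)⟩
  have hφmem : ∀ w ∈ M.verts, φ w ∈ V' := by
    intro w hw
    by_cases h1 : w = a
    · rwa [h1, hφa]
    by_cases h2 : w = b
    · rwa [h2, hφb]
    by_cases h3 : w = c
    · rwa [h3, hφc]
    by_cases h4 : w = d
    · rwa [h4, hφd]
    rw [hφn w h1 h2 h3 h4]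
    exact (hmV w).2 ⟨hw, h1, h2, h3, h4⟩
  have hφiff : ∀ f : α → Prop, (f a ↔ f a') → (f b ↔ f b') → (f c ↔ f c') → (f d ↔ f d') →
      ∀ w, (f (φ w) ↔ f w) := by
    intro f k1 k2 k3 k4 w
    by_cases h1 : w = a
    · rw [h1, hφa]; exact k1.symm
    by_cases h2 : w = b
    · rw [h2, hφb]; exact k2.symm
    by_cases h3 : w = c
    · rw [h3, hφc]; exact k3.symm
    by_cases h4 : w = d
    · rw [h4, hφd]; exact k4.symm
    rw [hφn w h1 h2 h3 h4]
  obtain ⟨H, hH⟩ : ∃ H, H = M.quot φ V' E' (fun e he ↦ (hquot e he).1)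
    (fun e he ↦ (hquot e he).2.1) (fun e he ↦ (hquot e he).2.2) := ⟨_, rfl⟩
  have hHv : H.verts = V' := by rw [hH]; rfl
  have hHe : H.edges = E' := by rw [hH]; rfl
  have hHq : ∀ e, H.src e = φ (M.src e) ∧ H.tgt e = φ (M.tgt e) := by
    intro e
    rw [hH]
    exact ⟨rfl, rfl⟩
  have hHm : H.Link m b' c' := by
    have := hm.quot (hs := fun e he ↦ (hquot e he).1) (ht := fun e he ↦ (hquot e he).2.1)
      (hne := fun e he ↦ (hquot e he).2.2) hmmE
    rwa [hφb, hφc, ← hH] at this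
  have hHn : H.Link n a' d' := by
    have := hn.quot (hs := fun e he ↦ (hquot e he).1) (ht := fun e he ↦ (hquot e he).2.1)
      (hne := fun e he ↦ (hquot e he).2.2) hnnE
    rwa [hφa, hφd, ← hH] at this
  have hHl : ∀ e ∈ E', e ≠ m → e ≠ n → H.src e = M.src e ∧ H.tgt e = M.tgt e := by
    intro e he hem hen
    rw [hH]
    exact hφE e he hem hen
  have hHconst : ∀ (F : Set β) (f : α → Prop), F ⊆ E' → (m ∈ F → (f b' ↔ f c')) →
      (n ∈ F → (f a' ↔ f d')) →
      (∀ e ∈ F, e ≠ m → e ≠ n → (f (M.src e) ↔ f (M.tgt e))) → H.Const F f := by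
    intro F f hF h1 h3 h2 e he
    by_cases hem : e = m
    · subst hem
      exact hHm.iff_of_src_tgt (h1 he)
    by_cases hen : e = n
    · subst hen
      exact hHn.iff_of_src_tgt (h3 he)
    · rw [(hHl e (hF he) hem hen).1, (hHl e (hF he) hem hen).2]
      exact h2 e he hem hen
  have hHinc : ∀ w ∈ V', ∀ e ∈ M.inc w, e ∈ E' → e ∈ H.inc w := by
    intro w hw e he heE
    have := mem_inc_quot_of_mem_inc (hs := fun e he ↦ (hquot e he).1)
      (ht := fun e he ↦ (hquot e he).2.1) (hne := fun e he ↦ (hquot e he).2.2) he heE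
    rwa [hφV w hw, ← hH] at this
  have hhE : ∀ e ∈ E', e ≠ m → e ≠ n → (h (M.src e) ↔ h (M.tgt e)) := by
    intro e he hem hen
    have := (hmE e).1 he
    exact hh e this.1 (by simp [this, hem, hen])
  have hha : h a ↔ h a' := Const.link (M := M) (F := {sa}) (by
    rintro e rfl; exact hh e hsa.mem (by simp [hsap, hsan, hsam, hsaq])) rfl hsa
  have hhb : h b ↔ h b' := Const.link (M := M) (F := {sb}) (by
    rintro e rfl; exact hh e hsb.mem (by simp [hsbp, hsbm, hsbq, hsbn])) rfl hsb
  have hhc : h c ↔ h c' := Const.link (M := M) (F := {sc}) (by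
    rintro e rfl; exact hh e hsc.mem (by simp [hscm, hscq, hscp, hscn])) rfl hsc
  have hhd : h d ↔ h d' := Const.link (M := M) (F := {sd}) (by
    rintro e rfl; exact hh e hsd.mem (by simp [hsdq, hsdn, hsdp, hsdm])) rfl hsd
  have h₁' : ¬ (h b' ↔ h c') := by rwa [← hhb, ← hhc]
  have h₂' : ¬ (h a' ↔ h d') := by rwa [← hha, ← hhd]
  have hgood : H.Good := by
    refine ⟨⟨⟨b', hHv ▸ hb'V⟩, fun f hf u hu v hv hfu ↦ ?_⟩, fun z hz hz0 hzc ↦ ?_, fun w hw ↦ ?_⟩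
    · rw [hHv] at hu hv
      rw [hHe] at hf
      set g : α → Prop := fun w ↦ f (φ w) with hg
      have gV : ∀ w ∈ V', (g w ↔ f w) := fun w hw ↦ by simp [hg, hφV w hw]
      have ga : g a ↔ g a' := by rw [gV a' ha'V, hg]; beta_reduce; rw [hφa]
      have gb : g b ↔ g b' := by rw [gV b' hb'V, hg]; beta_reduce; rw [hφb]
      have gc : g c ↔ g c' := by rw [gV c' hc'V, hg]; beta_reduce; rw [hφc]
      have gd : g d ↔ g d' := by rw [gV d' hd'V, hg]; beta_reduce; rw [hφd]
      rw [← gV u hu] at hfu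
      rw [← gV v hv]
      have goff : ∀ e ∈ M.edges, e ≠ p → e ≠ q → (g (M.src e) ↔ g (M.tgt e)) := by
        intro e he hep heq
        by_cases h1 : e = sa
        · exact h1 ▸ hsa.iff_of_src_tgt ga
        by_cases h2 : e = sb
        · exact h2 ▸ hsb.iff_of_src_tgt gb
        by_cases h3 : e = sc
        · exact h3 ▸ hsc.iff_of_src_tgt gc
        by_cases h4 : e = sd
        · exact h4 ▸ hsd.iff_of_src_tgt gd
        have := hf e ((hmE e).2 ⟨he, hep, heq, h1, h2, h3, h4⟩)
        rwa [(hHq e).1, (hHq e).2] at this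
      have gab : g a ↔ g b := by
        by_contra hgab
        have gbc : g b ↔ g c := Const.link (M := M) (F := {m}) (by
          rintro e rfl; exact goff e hm.mem hpm.symm hmq) rfl hm
        -- Intersecting the sides of `a` in the two cuts separates `a` from `b` and `c` by `g` and
        -- from `d` by `h`. Only `p` and `n`, both at `a`, cross the result, which `iff_of_pair`
        -- forbids.
        set k : α → Prop := fun w ↦ (h w ↔ h a) ∧ (g w ↔ g a) with hk
        have ka : k a := ⟨Iff.rfl, Iff.rfl⟩
        have kb : ¬ k b := fun h ↦ hgab h.2.symm
        have kc : ¬ k c := fun h ↦ hgab (h.2.symm.trans gbc.symm)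
        have kd : ¬ k d := fun h ↦ h₂ h.1.symm
        refine kb ((hM.iff_of_pair (f := k) ha hp hn hpn (iff_of_false kb kd) ?_).1 ka)
        intro e he hep hen
        by_cases hem : e = m
        · exact hem ▸ hm.iff_of_src_tgt (iff_of_false kb kc)
        by_cases heq : e = q
        · exact heq ▸ hq.iff_of_src_tgt (iff_of_false kc kd)
        rw [hk]
        beta_reduce
        rw [goff e he hep heq, hh e he (by simp [hep, hem, heq, hen])]
      refine (hM.iff_of_bridge (f := g) hq.mem (fun e he hes ↦ ?_) ((hmV u).1 hu).1
        ((hmV v).1 hv).1).1 hfu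
      by_cases hep : e = p
      · exact hep ▸ hp.iff_of_src_tgt gab
      exact goff e he hep hes
    -- Pairing the even set with the coboundary of `h`, which is carried by `m` and `n` alone.
    · have hzmn : z m + z n = 0 := by
        have h0 := hz (fun w ↦ if h w then 1 else 0)
        have e3 : (if h (H.src m) then 1 else 0) + (if h (H.tgt m) then 1 else 0) =
            (if h b' then 1 else 0) + (if h c' then 1 else 0 : ZMod 2) :=
          hHm.add_eq fun w ↦ if h w then 1 else 0
        have e4 : (if h (H.src n) then 1 else 0) + (if h (H.tgt n) then 1 else 0) =
            (if h a' then 1 else 0) + (if h d' then 1 else 0 : ZMod 2) :=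
          hHn.add_eq fun w ↦ if h w then 1 else 0
        rw [hHe, ← Finset.add_sum_erase _ _ hmmE,
          ← Finset.add_sum_erase _ _ (Finset.mem_erase.2 ⟨hmn.symm, hnnE⟩), e3, e4,
          Finset.sum_eq_zero, add_zero] at h0
        · have e1 : (if h b' then 1 else 0) + (if h c' then 1 else 0) = (1 : ZMod 2) := by
            clear * - h₁'
            by_cases i : h b' <;> by_cases j : h c' <;> simp [i, j] at h₁' ⊢
          have e2 : (if h a' then 1 else 0) + (if h d' then 1 else 0) = (1 : ZMod 2) := by
            clear * - h₂'
            by_cases i : h a' <;> by_cases j : h d' <;> simp [i, j] at h₂' ⊢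
          rwa [e1, e2, mul_one, mul_one] at h0
        · intro e he
          obtain ⟨hen, hem, he⟩ := by simpa only [Finset.mem_erase] using he
          rw [(hHl e he hem hen).1, (hHl e he hem hen).2, if_congr (hhE e he hem hen) rfl rfl,
            CharTwo.add_self_eq_zero, mul_zero]
      by_cases hzm : z m = 0
      · have hzn : z n = 0 := by rwa [hzm, zero_add] at hzmn
        rw [hHe] at hz0 hzc
        rw [hH] at hz hzc
        refine hM.not_conn_quot hE hz hz0 (fun e he hze ↦ hφE e he ?_ ?_) hφmem
          (fun f hf w _ ↦ ?_) hzc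
        · rintro rfl; exact hze hzm
        · rintro rfl; exact hze hzn
        · have hf' : M.Const (M.edges \ E') f := fun e he ↦ hf e he.1 he.2
          exact hφiff f (hf'.link ⟨hsa.mem, by simp [hmE]⟩ hsa)
            (hf'.link ⟨hsb.mem, by simp [hmE]⟩ hsb) (hf'.link ⟨hsc.mem, by simp [hmE]⟩ hsc)
            (hf'.link ⟨hsd.mem, by simp [hmE]⟩ hsd) w
      -- With both `m` and `n` deleted, `h` itself is a cut of what remains.
      · have hzn : z n ≠ 0 := fun hzn ↦ hzm (by rwa [hzn, add_zero] at hzmn)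
        refine h₁' (hzc.iff (hHconst _ h (fun e he ↦ hHe ▸ he.1) (fun hmz ↦ absurd hmz.2 hzm)
          (fun hnz ↦ absurd hnz.2 hzn) fun e he ↦ hhE e (hHe ▸ he.1)) (hHv ▸ hb'V) (hHv ▸ hc'V))
    · rw [hHv] at hw
      set ψ : β → β := fun e ↦ if e = sb ∨ e = sc then m else if e = sa ∨ e = sd then n else e
        with hψ
      have hsub : H.inc w ⊆ (M.inc w).image ψ := by
        intro e he
        rw [hH] at he
        have heE := (hmE e).1 (mem_inc_quot.1 he).1
        obtain ⟨v, hv, he⟩ := mem_inc_of_mem_inc_quot he hE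
        by_cases hva : v = a
        · rw [hva, hinca] at he
          have : e = n := by simpa [heE] using he
          rw [← hv, hva, hφa]
          exact Finset.mem_image.2 ⟨sa, hsa.mem_inc_right, by simp [hψ, this, hsab, hsac]⟩
        by_cases hvb : v = b
        · rw [hvb, hincb] at he
          have : e = m := by simpa [heE] using he
          rw [← hv, hvb, hφb]
          exact Finset.mem_image.2 ⟨sb, hsb.mem_inc_right, by simp [hψ, this]⟩
        by_cases hvc : v = c
        · rw [hvc, hincc] at he
          have : e = m := by simpa [heE] using he
          rw [← hv, hvc, hφc]
          exact Finset.mem_image.2 ⟨sc, hsc.mem_inc_right, by simp [hψ, this]⟩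
        by_cases hvd : v = d
        · rw [hvd, hincd] at he
          have : e = n := by simpa [heE] using he
          rw [← hv, hvd, hφd]
          exact Finset.mem_image.2
            ⟨sd, hsd.mem_inc_right, by simp [hψ, this, hsbd.symm, hscd.symm]⟩
        rw [hφn v hva hvb hvc hvd] at hv
        exact Finset.mem_image.2 ⟨e, hv ▸ he, by simp [hψ, heE]⟩
      exact (Finset.card_le_card hsub).trans (Finset.card_image_le.trans
        (hM.deg_le w ((hmV w).1 hw).1))
  have hcardV : V'.card + 4 = M.verts.card := by
    have h4 : ({a, b, c, d} : Finset α).card = 4 := by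
      rw [Finset.card_insert_of_notMem (by simp [hab, hac, had]),
        Finset.card_insert_of_notMem (by simp [hbc, hbd]), Finset.card_pair hcd]
    rw [hV', ← h4]
    exact Finset.card_sdiff_add_card_eq_card (by
      simp [Finset.insert_subset_iff, hp.left_mem, hp.right_mem, hq.left_mem, hq.right_mem])
  obtain ⟨F, hFE, hFc, hFn, hFm⟩ := hM.decomp_of_lt H hgood (by
    rw [hHv, hHe]
    exact add_lt_add_of_lt_of_le (by omega) (Finset.card_le_card hE))
  rw [hHe] at hFE
  rw [hHv] at hFn
  have hFE' := fun e (he : e ∈ F) ↦ (hmE e).1 (hFE he)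
  have haF : sa ∉ F := fun h ↦ (hFE' sa h).2.2.2.1 rfl
  have hbF : sb ∉ F := fun h ↦ (hFE' sb h).2.2.2.2.1 rfl
  have hcF : sc ∉ F := fun h ↦ (hFE' sc h).2.2.2.2.2.1 rfl
  have hdF : sd ∉ F := fun h ↦ (hFE' sd h).2.2.2.2.2.2 rfl
  have hpF : p ∉ F := fun h ↦ (hFE' p h).2.1 rfl
  have hqF : q ∉ F := fun h ↦ (hFE' q h).2.2.1 rfl
  have finish : ∀ F' : Finset β, F' ⊆ M.edges → F'.card = F.card + 4 →
      (∀ f, M.Const F' f → (f a ↔ f a') ∧ (f b ↔ f a') ∧ (f c ↔ f a') ∧ (f d ↔ f a') ∧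
        H.Const F f) →
      (∀ w, w = a ∨ w = b ∨ w = c ∨ w = d → ∃ o, ∀ e ∈ M.inc w, e = o ∨ e ∈ F') →
      (∀ w ∈ V', ∀ e ∈ M.inc w, e ∉ F' → ∀ e' ∈ M.inc w, e' ∉ F' → e = e') → False := by
    intro F' hF' hcard hconn hsq hout
    refine hM.not_decomp ⟨F', hF', ⟨hM.conn.1, fun f hf u hu v hv hfu ↦ ?_⟩, by omega, ?_⟩
    · obtain ⟨ka, kb, kc, kd, kF⟩ := hconn f hf
      have key : ∀ w ∈ M.verts, (f w ↔ f a') := by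
        intro w hw
        by_cases h1 : w = a
        · exact h1 ▸ ka
        by_cases h2 : w = b
        · exact h2 ▸ kb
        by_cases h3 : w = c
        · exact h3 ▸ kc
        by_cases h4 : w = d
        · exact h4 ▸ kd
        exact hFc.iff kF (hHv ▸ (hmV w).2 ⟨hw, h1, h2, h3, h4⟩) (hHv ▸ ha'V)
      exact (key v hv).2 ((key u hu).1 hfu)
    · intro w e₁ h₁ hF₁ e₂ h₂ hF₂
      by_cases hw : w = a ∨ w = b ∨ w = c ∨ w = d
      · obtain ⟨o, ho⟩ := hsq w hw
        rw [(ho e₁ h₁).resolve_right hF₁, (ho e₂ h₂).resolve_right hF₂]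
      · have hwM : w ∈ M.verts := by
          obtain ⟨_, h⟩ := exists_link h₁
          exact h.left_mem
        refine hout w ((hmV w).2 ⟨hwM, ?_⟩) e₁ h₁ hF₁ e₂ h₂ hF₂
        simpa only [not_or] using hw
  by_cases hmF : m ∈ F <;> by_cases hnF : n ∈ F
  · refine finish (insert sa (insert sb (insert sc (insert sd F)))) ?_ ?_ ?_ ?_ ?_
    · simp only [Finset.insert_subset_iff, hsa.mem, hsb.mem, hsc.mem, hsd.mem, true_and]
      exact hFE.trans hE
    · rw [Finset.card_insert_of_notMem, Finset.card_insert_of_notMem,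
        Finset.card_insert_of_notMem, Finset.card_insert_of_notMem hdF] <;>
      simp [hsab, hsac, hsad, hsbc, hsbd, hscd, haF, hbF, hcF]
    · intro f hf
      have k0 : f a ↔ f a' := hf.link (by simp) hsa
      have k1 : f b ↔ f b' := hf.link (by simp) hsb
      have k2 : f c ↔ f c' := hf.link (by simp) hsc
      have k3 : f d ↔ f d' := hf.link (by simp) hsd
      have k4 : f a ↔ f d := hf.link (by simp [hnF]) hn
      have k5 : f b ↔ f c := hf.link (by simp [hmF]) hm
      have kF : H.Const F f := hHconst F f (by exact_mod_cast hFE)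
        (fun _ ↦ k1.symm.trans (k5.trans k2)) (fun _ ↦ k0.symm.trans (k4.trans k3))
        fun e he _ _ ↦ hf e (by simp [Finset.mem_coe.1 he])
      have k6 : f b' ↔ f a' := hFc.iff kF (hHv ▸ hb'V) (hHv ▸ ha'V)
      exact ⟨k0, k1.trans k6, k5.symm.trans (k1.trans k6), k4.symm.trans k0, kF⟩
    · rintro w (rfl | rfl | rfl | rfl)
      · exact ⟨p, by simp [hinca, hnF]⟩
      · exact ⟨p, by simp [hincb, hmF]⟩
      · exact ⟨q, by simp [hincc, hmF]⟩
      · exact ⟨q, by simp [hincd, hnF]⟩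
    · intro w hw e₁ h₁ hF₁ e₂ h₂ hF₂
      have hw' := (hmV w).1 hw
      have k : ∀ e ∈ M.inc w, e ∉ insert sa (insert sb (insert sc (insert sd F))) →
          e ∈ H.inc w ∧ e ∉ F := by
        intro e he heF
        simp only [Finset.mem_insert, not_or] at heF
        refine ⟨hHinc w hw e he ((hmE e).2 ⟨(mem_inc.1 he).1, ?_, ?_, heF.1, heF.2.1,
          heF.2.2.1, heF.2.2.2.1⟩), heF.2.2.2.2⟩
        · exact hp.edge_ne_of_notMem he hw'.2.1 hw'.2.2.1
        · exact hq.edge_ne_of_notMem he hw'.2.2.2.1 hw'.2.2.2.2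
      exact hFm w e₁ (k e₁ h₁ hF₁).1 (k e₁ h₁ hF₁).2 e₂ (k e₂ h₂ hF₂).1 (k e₂ h₂ hF₂).2
  -- The tree edge `m` is expanded to the detour `b' b a d c c'`, which passes all four vertices.
  -- The original `m` joins the matching, and `sa`, `sd` replace the matching edge `n` at `a'` and
  -- `d'`.
  · refine finish (insert n (insert p (insert q (insert sb (insert sc (F.erase m))))))
      ?_ ?_ ?_ ?_ ?_
    · simp only [Finset.insert_subset_iff, hp.mem, hn.mem, hsb.mem, hsc.mem, hq.mem, true_and]
      exact (Finset.erase_subset _ _).trans (hFE.trans hE)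
    · have := Finset.card_erase_add_one hmF
      rw [Finset.card_insert_of_notMem, Finset.card_insert_of_notMem,
        Finset.card_insert_of_notMem, Finset.card_insert_of_notMem,
        Finset.card_insert_of_notMem (by simp [hcF])]
      · omega
      all_goals simp [hsbc, hbF, hpq, hpF, hqF, hnF, hsbp.symm, hscp.symm, hsbq.symm, hscq.symm,
        hsbn.symm, hscn.symm, hpn.symm, hqn.symm]
    · intro f hf
      have k1 : f a ↔ f b := hf.link (by simp) hp
      have k2 : f a ↔ f d := hf.link (by simp) hn
      have k3 : f c ↔ f d := hf.link (by simp) hq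
      have k4 : f b ↔ f b' := hf.link (by simp) hsb
      have k5 : f c ↔ f c' := hf.link (by simp) hsc
      have kF : H.Const F f := hHconst F f (by exact_mod_cast hFE)
        (fun _ ↦ k4.symm.trans (k1.symm.trans (k2.trans (k3.symm.trans k5))))
        (fun h ↦ absurd h hnF) fun e he hem _ ↦ hf e (by simp [Finset.mem_coe.1 he, hem])
      have k6 : f b' ↔ f a' := hFc.iff kF (hHv ▸ hb'V) (hHv ▸ ha'V)
      have k7 := k1.trans (k4.trans k6)
      exact ⟨k7, k4.trans k6, k3.trans (k2.symm.trans k7), k2.symm.trans k7, kF⟩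
    · rintro w (rfl | rfl | rfl | rfl)
      · exact ⟨sa, by simp [hinca]⟩
      · exact ⟨m, by simp [hincb]⟩
      · exact ⟨m, by simp [hincc]⟩
      · exact ⟨sd, by simp [hincd]⟩
    · intro w hw e₁ h₁ hF₁ e₂ h₂ hF₂
      have hw' := (hmV w).1 hw
      have k : ∀ e ∈ M.inc w,
          e ∉ insert n (insert p (insert q (insert sb (insert sc (F.erase m))))) →
          e = sa ∧ w = a' ∨ e = sd ∧ w = d' ∨ e ∈ H.inc w ∧ e ∉ F ∧ e ≠ n := by
        intro e he heF
        simp only [Finset.mem_insert, not_or, Finset.mem_erase, not_and] at heF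
        by_cases h1 : e = sa
        · exact Or.inl ⟨h1, (hsa.mem_inc_iff.1 (h1 ▸ he)).resolve_left hw'.2.1⟩
        by_cases h2 : e = sd
        · exact Or.inr (Or.inl ⟨h2, (hsd.mem_inc_iff.1 (h2 ▸ he)).resolve_left hw'.2.2.2.2⟩)
        refine Or.inr (Or.inr ⟨hHinc w hw e he ((hmE e).2 ⟨(mem_inc.1 he).1, heF.2.1, heF.2.2.1,
          h1, heF.2.2.2.1, heF.2.2.2.2.1, h2⟩), heF.2.2.2.2.2 ?_, heF.1⟩)
        exact hm.edge_ne_of_notMem he hw'.2.2.1 hw'.2.2.2.1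
      have kb : ∀ e ∈ H.inc a', e ∉ F → e = n := fun e he heF ↦
        hFm a' e he heF n hHn.mem_inc_left hnF
      have kc : ∀ e ∈ H.inc d', e ∉ F → e = n := fun e he heF ↦
        hFm d' e he heF n hHn.mem_inc_right hnF
      rcases k e₁ h₁ hF₁ with ⟨h, h'⟩ | ⟨h, h'⟩ | ⟨h, h', h''⟩ <;>
        rcases k e₂ h₂ hF₂ with ⟨j, j'⟩ | ⟨j, j'⟩ | ⟨j, j', j''⟩
      · rw [h, j]
      · exact absurd (h'.symm.trans j') ha'd'
      · exact absurd (kb e₂ (h' ▸ j) j') j''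
      · exact absurd (j'.symm.trans h') ha'd'
      · rw [h, j]
      · exact absurd (kc e₂ (h' ▸ j) j') j''
      · exact absurd (kb e₁ (j' ▸ h) h') h''
      · exact absurd (kc e₁ (j' ▸ h) h') h''
      · exact hFm w e₁ h h' e₂ j j'
  -- Symmetrically, the tree edge `n` is expanded to the detour `a' a b c d d'`.
  · refine finish (insert m (insert p (insert q (insert sa (insert sd (F.erase n))))))
      ?_ ?_ ?_ ?_ ?_
    · simp only [Finset.insert_subset_iff, hp.mem, hm.mem, hsa.mem, hsd.mem, hq.mem, true_and]
      exact (Finset.erase_subset _ _).trans (hFE.trans hE)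
    · have := Finset.card_erase_add_one hnF
      rw [Finset.card_insert_of_notMem, Finset.card_insert_of_notMem,
        Finset.card_insert_of_notMem, Finset.card_insert_of_notMem,
        Finset.card_insert_of_notMem (by simp [hdF])]
      · omega
      all_goals simp [hsad, haF, hpq, hpF, hqF, hmF, hsap.symm, hsdp.symm, hsaq.symm, hsdq.symm,
        hsam.symm, hsdm.symm, hpm.symm, hmq]
    · intro f hf
      have k1 : f a ↔ f b := hf.link (by simp) hp
      have k2 : f b ↔ f c := hf.link (by simp) hm
      have k3 : f c ↔ f d := hf.link (by simp) hq
      have k4 : f d ↔ f d' := hf.link (by simp) hsd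
      have k5 : f a ↔ f a' := hf.link (by simp) hsa
      have kF : H.Const F f := hHconst F f (by exact_mod_cast hFE) (fun h ↦ absurd h hmF)
        (fun _ ↦ k5.symm.trans (k1.trans (k2.trans (k3.trans k4))))
        fun e he _ hen ↦ hf e (by simp [Finset.mem_coe.1 he, hen])
      have k6 := k1.symm.trans k5
      have k7 := k2.symm.trans k6
      exact ⟨k5, k6, k7, k3.symm.trans k7, kF⟩
    · rintro w (rfl | rfl | rfl | rfl)
      · exact ⟨n, by simp [hinca]⟩
      · exact ⟨sb, by simp [hincb]⟩
      · exact ⟨sc, by simp [hincc]⟩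
      · exact ⟨n, by simp [hincd]⟩
    · intro w hw e₁ h₁ hF₁ e₂ h₂ hF₂
      have hw' := (hmV w).1 hw
      have k : ∀ e ∈ M.inc w,
          e ∉ insert m (insert p (insert q (insert sa (insert sd (F.erase n))))) →
          e = sb ∧ w = b' ∨ e = sc ∧ w = c' ∨ e ∈ H.inc w ∧ e ∉ F ∧ e ≠ m := by
        intro e he heF
        simp only [Finset.mem_insert, not_or, Finset.mem_erase, not_and] at heF
        by_cases h1 : e = sb
        · exact Or.inl ⟨h1, (hsb.mem_inc_iff.1 (h1 ▸ he)).resolve_left hw'.2.2.1⟩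
        by_cases h2 : e = sc
        · exact Or.inr (Or.inl ⟨h2, (hsc.mem_inc_iff.1 (h2 ▸ he)).resolve_left hw'.2.2.2.1⟩)
        refine Or.inr (Or.inr ⟨hHinc w hw e he ((hmE e).2 ⟨(mem_inc.1 he).1, heF.2.1, heF.2.2.1,
          heF.2.2.2.1, h1, h2, heF.2.2.2.2.1⟩), heF.2.2.2.2.2 ?_, heF.1⟩)
        exact hn.edge_ne_of_notMem he hw'.2.1 hw'.2.2.2.2
      have kb : ∀ e ∈ H.inc b', e ∉ F → e = m := fun e he heF ↦
        hFm b' e he heF m hHm.mem_inc_left hmF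
      have kc : ∀ e ∈ H.inc c', e ∉ F → e = m := fun e he heF ↦
        hFm c' e he heF m hHm.mem_inc_right hmF
      rcases k e₁ h₁ hF₁ with ⟨h, h'⟩ | ⟨h, h'⟩ | ⟨h, h', h''⟩ <;>
        rcases k e₂ h₂ hF₂ with ⟨j, j'⟩ | ⟨j, j'⟩ | ⟨j, j', j''⟩
      · rw [h, j]
      · exact absurd (h'.symm.trans j') hb'c'
      · exact absurd (kb e₂ (h' ▸ j) j') j''
      · exact absurd (j'.symm.trans h') hb'c'
      · rw [h, j]
      · exact absurd (kc e₂ (h' ▸ j) j') j''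
      · exact absurd (kb e₁ (j' ▸ h) h') h''
      · exact absurd (kc e₁ (j' ▸ h) h') h''
      · exact hFm w e₁ h h' e₂ j j'
  -- A tree avoiding both `m` and `n` would not cross the nontrivial cut `h`.
  · exact h₁' (hFc.iff (hHconst F h (by exact_mod_cast hFE) (fun h ↦ absurd h hmF)
      (fun h ↦ absurd h hnF) fun e he ↦ hhE e (hFE he)) (hHv ▸ hb'V) (hHv ▸ hc'V))

-- All four vertices have degree three, and deleting the quadrilateral leaves a nontrivial cut. By
-- `iff_of_pair` no vertex is alone on its side, so the cut splits the vertices two against two and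
-- crosses some pair of opposite edges. A rotation brings this pair into the required position.
set_option maxHeartbeats 1000000 in
lemma Critical.no_square (hM : M.Critical) (hp : M.Link p a b) (hm : M.Link m b c)
    (hq : M.Link q c d) (hn : M.Link n a d) (hac : a ≠ c) (hbd : b ≠ d) : False := by
  have ha := (hM.card_inc hp.left_mem).resolve_left
    fun h ↦ hM.no_square_of_card_two hp hm hq hn hac hbd h
  have hb := (hM.card_inc hm.left_mem).resolve_left
    fun h ↦ hM.no_square_of_card_two hm hq hn.symm hp.symm hbd hac.symm h
  have hc := (hM.card_inc hq.left_mem).resolve_left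
    fun h ↦ hM.no_square_of_card_two hq hn.symm hp hm.symm hac.symm hbd.symm h
  have hd := (hM.card_inc hn.right_mem).resolve_left
    fun h ↦ hM.no_square_of_card_two hn.symm hp hm hq.symm hbd.symm hac h
  have hpn : p ≠ n := hn.edge_ne_of_notMem hp.mem_inc_right hp.ne.symm hbd
  have hpm : p ≠ m := hm.edge_ne_of_notMem hp.mem_inc_left hp.ne hac
  have hpq : p ≠ q := hq.edge_ne_of_notMem hp.mem_inc_left hac hn.ne
  have hmq : m ≠ q := hq.edge_ne_of_notMem hm.mem_inc_left hm.ne hbd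
  have hmn : m ≠ n := hn.edge_ne_of_notMem hm.mem_inc_left hp.ne.symm hbd
  have hqn : q ≠ n := hn.edge_ne_of_notMem hq.mem_inc_left hac.symm hq.ne
  obtain ⟨h, hh, u, hu, v, hv, hhu, hhv⟩ := hM.exists_cut_of_closed {p, m, q, n}
    (by simp [Finset.insert_subset_iff, hp.mem, hm.mem, hq.mem, hn.mem]) ⟨p, by simp⟩ (fun g ↦ by
      rw [Finset.sum_insert (by simp [hpm, hpq, hpn]), Finset.sum_insert (by simp [hmq, hmn]),
        Finset.sum_pair hqn,
        hp.add_eq, hm.add_eq, hq.add_eq, hn.add_eq]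
      have : ∀ a b c d : ZMod 2, a + b + (b + c + (c + d + (a + d))) = 0 := by decide
      exact this _ _ _ _)
  have hoff : ∀ e ∈ M.edges, (e = p → (h a ↔ h b)) → (e = m → (h b ↔ h c)) →
      (e = q → (h c ↔ h d)) → (e = n → (h a ↔ h d)) → (h (M.src e) ↔ h (M.tgt e)) := by
    intro e he k1 k2 k3 k4
    by_cases j1 : e = p
    · exact j1 ▸ hp.iff_of_src_tgt (k1 j1)
    by_cases j2 : e = m
    · exact j2 ▸ hm.iff_of_src_tgt (k2 j2)
    by_cases j3 : e = q
    · exact j3 ▸ hq.iff_of_src_tgt (k3 j3)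
    by_cases j4 : e = n
    · exact j4 ▸ hn.iff_of_src_tgt (k4 j4)
    exact hh e he (by simp [j1, j2, j3, j4])
  have ka : (h b ↔ h d) → (h b ↔ h c) → (h c ↔ h d) → (h a ↔ h b) := fun k1 k2 k3 ↦
    hM.iff_of_pair ha hp hn hpn k1 fun e he h1 h2 ↦
      hoff e he (fun h ↦ absurd h h1) (fun _ ↦ k2) (fun _ ↦ k3) (fun h ↦ absurd h h2)
  have kb : (h a ↔ h c) → (h c ↔ h d) → (h a ↔ h d) → (h b ↔ h a) := fun k1 k2 k3 ↦
    hM.iff_of_pair hb hp.symm hm hpm k1 fun e he h1 h2 ↦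
      hoff e he (fun h ↦ absurd h h1) (fun h ↦ absurd h h2) (fun _ ↦ k2) (fun _ ↦ k3)
  have kc : (h b ↔ h d) → (h a ↔ h b) → (h a ↔ h d) → (h c ↔ h b) := fun k1 k2 k3 ↦
    hM.iff_of_pair hc hm.symm hq hmq k1 fun e he h1 h2 ↦
      hoff e he (fun _ ↦ k2) (fun h ↦ absurd h h1) (fun h ↦ absurd h h2) (fun _ ↦ k3)
  have kd : (h c ↔ h a) → (h a ↔ h b) → (h b ↔ h c) → (h d ↔ h c) := fun k1 k2 k3 ↦
    hM.iff_of_pair hd hq.symm hn.symm hqn k1 fun e he h1 h2 ↦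
      hoff e he (fun _ ↦ k2) (fun _ ↦ k3) (fun h ↦ absurd h h1) (fun h ↦ absurd h h2)
  have kall : (h a ↔ h b) → (h b ↔ h c) → (h c ↔ h d) → (h a ↔ h d) → False := fun k1 k2 k3 k4 ↦
    hhv ((hM.conn.iff (fun e he ↦ hoff e he (fun _ ↦ k1) (fun _ ↦ k2) (fun _ ↦ k3) fun _ ↦ k4)
      hu hv).1 hhu)
  -- The alternating split satisfies both alternatives, so it needs no separate treatment.
  have hcases : ¬ (h b ↔ h c) ∧ ¬ (h a ↔ h d) ∨ ¬ (h c ↔ h d) ∧ ¬ (h b ↔ h a) := by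
    clear * - ka kb kc kd kall
    grind
  rcases hcases with ⟨h₁, h₂⟩ | ⟨h₁, h₂⟩
  · exact hM.no_square_of_cut hp hm hq hn hac hbd ha hb hc hd hh h₁ h₂
  · refine hM.no_square_of_cut hm hq hn.symm hp.symm hbd hac.symm hb hc hd ha
      (fun e he h ↦ hh e he fun h' ↦ h ?_) h₁ h₂
    simp only [Finset.mem_insert, Finset.mem_singleton] at h' ⊢
    rcases h' with h' | h' | h' | h' <;> simp [h']

end FinGraph

namespace FinGraph

variable {α β : Type*} {M : FinGraph α β} {e e₁ e₂ : β} {u v w x y z : α} {f : α → Prop}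
  {d : β → ZMod 2}

/-! ### Spanning trees and the cycle space -/

section Rank

variable {F : Finset β}

/-- The coboundary map over `ZMod 2`, restricted to the edges in `F`. -/
noncomputable def coboundary (M : FinGraph α β) (hF : F ⊆ M.edges) :
    (M.verts → ZMod 2) →ₗ[ZMod 2] (F → ZMod 2) where
  toFun g e := g ⟨M.src e, M.src_mem e (hF e.2)⟩ + g ⟨M.tgt e, M.tgt_mem e (hF e.2)⟩
  map_add' g h := by
    ext e
    simp only [Pi.add_apply]
    ring
  map_smul' c g := by
    ext e
    simp only [Pi.smul_apply, smul_eq_mul, RingHom.id_apply]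
    ring

lemma coboundary_apply (hF : F ⊆ M.edges) (g : M.verts → ZMod 2) (e : F) :
    M.coboundary hF g e =
      g ⟨M.src e, M.src_mem e (hF e.2)⟩ + g ⟨M.tgt e, M.tgt_mem e (hF e.2)⟩ := rfl

/-- A potential with zero coboundary is equal at the ends of every edge of `F`, hence constant by
connectivity applied to its level sets. -/
lemma Conn.ker_coboundary (hc : M.Conn F) (hF : F ⊆ M.edges) :
    LinearMap.ker (M.coboundary hF) = Submodule.span (ZMod 2) {1} := by
  ext g
  rw [LinearMap.mem_ker, Submodule.mem_span_singleton]
  constructor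
  · intro hg
    obtain ⟨v, hv⟩ := hc.1
    refine ⟨g ⟨v, hv⟩, funext fun w ↦ ?_⟩
    have key := hc.iff (f := fun w ↦ ∃ h : w ∈ M.verts, g ⟨w, h⟩ = g ⟨v, hv⟩) (fun e he ↦ ?_)
      hv w.2
    · obtain ⟨_, h⟩ := key.1 ⟨hv, rfl⟩
      simpa using h.symm
    · have he : e ∈ F := he
      have h := congrFun hg ⟨e, he⟩
      rw [coboundary_apply, Pi.zero_apply, CharTwo.add_eq_zero] at h
      simp only [M.src_mem e (hF he), M.tgt_mem e (hF he), exists_true_left, h]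
  · rintro ⟨c, rfl⟩
    ext e
    simp [coboundary_apply, CharTwo.add_self_eq_zero]

lemma Conn.finrank_range_coboundary (hc : M.Conn F) (hF : F ⊆ M.edges) :
    Module.finrank (ZMod 2) (LinearMap.range (M.coboundary hF)) + 1 = M.verts.card := by
  have h := LinearMap.finrank_range_add_finrank_ker (M.coboundary hF)
  obtain ⟨v, hv⟩ := hc.1
  rw [hc.ker_coboundary hF, finrank_span_singleton, Module.finrank_fintype_fun_eq_card,
    Fintype.card_coe] at h
  · exact h
  · exact fun h ↦ one_ne_zero (congrFun h ⟨v, hv⟩)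

lemma isEven_of_subset (hF : F ⊆ M.edges) (hd0 : ∀ e, e ∉ F → d e = 0)
    (hd : ∀ g : α → ZMod 2, ∑ e ∈ F, d e * (g (M.src e) + g (M.tgt e)) = 0) : M.IsEven d := by
  intro g
  refine Eq.trans (Finset.sum_subset hF fun e _ he ↦ ?_).symm (hd g)
  rw [hd0 e he, zero_mul]

/-- A connected spanning edge set has `|V| - 1` elements if and only if it contains no nonempty
closed set. -/
lemma Conn.card_add_one_iff (hc : M.Conn F) (hF : F ⊆ M.edges) :
    F.card + 1 = M.verts.card ↔
      ∀ d, M.IsEven d → (∀ e, e ∉ F → d e = 0) → ∀ e ∈ F, d e = 0 := by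
  rw [← hc.finrank_range_coboundary hF, add_left_inj]
  -- By rank-nullity the rank is the number of vertices minus one, so the edge count is right
  -- exactly when the coboundary map is onto.
  have htop : F.card = Module.finrank (ZMod 2) (LinearMap.range (M.coboundary hF)) ↔
      LinearMap.range (M.coboundary hF) = ⊤ := by
    have hcard : Module.finrank (ZMod 2) (F → ZMod 2) = F.card := by
      rw [Module.finrank_fintype_fun_eq_card, Fintype.card_coe]
    constructor
    · intro h
      exact Submodule.eq_top_of_finrank_eq (by rw [hcard, h])
    · intro h
      rw [h, finrank_top, hcard]
  rw [htop]
  constructor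
  · intro h d hd hd0 e he
    -- A potential whose coboundary is the single edge `e`; pairing it with `d` reads off `d e`.
    obtain ⟨g, hg⟩ := LinearMap.range_eq_top.1 h (Pi.single ⟨e, he⟩ 1)
    have h1 := hd fun v ↦ if h : v ∈ M.verts then g ⟨v, h⟩ else 0
    rw [← Finset.sum_subset hF fun e _ he ↦ by rw [hd0 e he, zero_mul], ← Finset.sum_coe_sort] at h1
    rw [Finset.sum_eq_single ⟨e, he⟩] at h1
    · simp only [M.src_mem e (hF he), M.tgt_mem e (hF he), dif_pos] at h1
      have h2 := congrFun hg ⟨e, he⟩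
      rw [coboundary_apply, Pi.single_eq_same] at h2
      rwa [h2, mul_one] at h1
    · intro e' _ hne
      simp only [M.src_mem e' (hF e'.2), M.tgt_mem e' (hF e'.2), dif_pos]
      have h2 := congrFun hg e'
      rw [coboundary_apply, Pi.single_eq_of_ne hne] at h2
      rw [h2, mul_zero]
    · simp
  · intro h
    by_contra hlt
    -- A nonzero functional vanishing on all coboundaries is, by its coordinates, a nonzero even set
    -- inside `F`.
    obtain ⟨φ, hφ, hφk⟩ := Submodule.exists_le_ker_of_lt_top _ (lt_top_iff_ne_top.2 hlt)
    refine hφ (LinearMap.pi_ext' fun e ↦ LinearMap.ext_ring ?_)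
    set d : β → ZMod 2 := fun e ↦ if h : e ∈ F then φ (Pi.single ⟨e, h⟩ 1) else 0 with hd
    have hde : ∀ e : F, d e = φ (Pi.single e 1) := fun e ↦ by simp [hd]
    have h1 := h d (isEven_of_subset hF (fun e he ↦ by simp [hd, he]) fun g ↦ ?_)
      (fun e he ↦ by simp [hd, he]) e e.2
    · rw [hde] at h1
      simpa using h1
    · have h2 : φ (M.coboundary hF fun v ↦ g v) = 0 :=
        LinearMap.mem_ker.1 (hφk (LinearMap.mem_range_self _ _))
      rw [← Finset.sum_coe_sort]
      refine Eq.trans ?_ h2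
      have h3 : M.coboundary hF (fun v ↦ g v) =
          ∑ e : F, (g (M.src e) + g (M.tgt e)) • (Pi.single e 1 : F → ZMod 2) := by
        ext e
        simp [coboundary_apply, Finset.sum_apply, Pi.single_apply]
      rw [h3, map_sum]
      refine Finset.sum_congr rfl fun e _ ↦ ?_
      rw [map_smul, hde, smul_eq_mul, mul_comm]

end Rank

/-! ### Vertices of degree three -/

lemma Critical.exists_link_of_mem (hM : M.Critical) (hv : v ∈ M.verts) : ∃ e w, M.Link e v w := by
  obtain ⟨e, he⟩ := Finset.card_pos.1 (lt_of_lt_of_le two_pos (hM.two_le_card_inc hv))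
  exact ⟨e, exists_link he⟩

lemma Critical.card_three_of_link (hM : M.Critical) (hv : (M.inc v).card = 2) (h : M.Link e v w) :
    (M.inc w).card = 3 :=
  (hM.card_inc h.right_mem).resolve_left fun hw ↦ hM.not_link_of_card_two hv hw h

/-- If `f` were a nontrivial cut of the part of degree three, its extension to the vertices of
degree two would be crossed by some edge `e` at such a vertex. The even set given by
`exists_even_of_deg_two` for `e` crosses that extension a second time, at another vertex of degree
two, and isolates this vertex. -/
lemma Critical.iff_of_card_three (hM : M.Critical)
    (hf : ∀ e ∈ M.edges, (M.inc (M.src e)).card = 3 → (M.inc (M.tgt e)).card = 3 →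
      (f (M.src e) ↔ f (M.tgt e)))
    (hx : x ∈ M.verts) (hx3 : (M.inc x).card = 3) (hy : y ∈ M.verts) (hy3 : (M.inc y).card = 3) :
    f x ↔ f y := by
  have hN : ∀ v, ∃ w, v ∈ M.verts → ∃ e, M.Link e v w := by
    intro v
    by_cases hv : v ∈ M.verts
    · obtain ⟨e, w, h⟩ := hM.exists_link_of_mem hv
      exact ⟨w, fun _ ↦ ⟨e, h⟩⟩
    · exact ⟨v, fun h ↦ absurd h hv⟩
  choose N hN using hN
  -- A vertex of degree two copies a chosen neighbour, which has degree three. Thus at most one of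
  -- its two edges is cut.
  set g : α → Prop := fun v ↦ if (M.inc v).card = 3 then f v else f (N v) with hg
  have g3 : ∀ v, (M.inc v).card = 3 → (g v ↔ f v) := fun v hv ↦ by simp [hg, hv]
  have g2 : ∀ v, (M.inc v).card = 2 → (g v ↔ f (N v)) := fun v hv ↦ by simp [hg, hv]
  rw [← g3 x hx3, ← g3 y hy3]
  have cross : ∀ e ∈ M.edges, ¬ (g (M.src e) ↔ g (M.tgt e)) →
      ∃ w z b u, (M.inc w).card = 2 ∧ (M.inc z).card = 3 ∧ M.Link e z w ∧ M.inc w = {e, b} ∧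
        b ≠ e ∧ M.Link b w u ∧ (g w ↔ g u) := by
    intro e he hne
    obtain ⟨w, z, hl, hw, hwz⟩ : ∃ w z, M.Link e w z ∧ (M.inc w).card = 2 ∧ ¬ (g w ↔ g z) := by
      rcases hM.card_inc (M.src_mem e he) with h | h
      · exact ⟨_, _, link_src_tgt he, h, hne⟩
      rcases hM.card_inc (M.tgt_mem e he) with h' | h'
      · exact ⟨_, _, (link_src_tgt he).symm, h', fun h ↦ hne h.symm⟩
      · exact absurd ((g3 _ h).trans ((hf e he h h').trans (g3 _ h').symm)) hne
    have hz := hM.card_three_of_link hw hl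
    obtain ⟨b, hb⟩ := hN w hl.left_mem
    have hu := hM.card_three_of_link hw hb
    have hwu : g w ↔ g (N w) := (g2 w hw).trans (g3 _ hu).symm
    have hbe : b ≠ e := by
      rintro rfl
      rcases hb.ends hl with ⟨-, h⟩ | ⟨h, -⟩
      · exact hwz (h ▸ hwu)
      · exact hl.ne h
    obtain ⟨b', _, -, hinc, -⟩ := exists_inc_eq_pair hw hl.mem_inc_left
    have hbb : b = b' := by
      have := hinc ▸ hb.mem_inc_left
      simpa [hbe] using this
    exact ⟨w, z, b, N w, hw, hz, hl.symm, hbb ▸ hinc, hbe, hb, hwu⟩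
  by_contra hcon
  obtain ⟨e, he, hne⟩ : ∃ e ∈ M.edges, ¬ (g (M.src e) ↔ g (M.tgt e)) := by
    by_contra! h
    exact hcon (hM.conn.iff h hx hy)
  obtain ⟨w, z, b, u, hw, hz, hl, hinc, hbe, hb, hwu⟩ := cross e he hne
  obtain ⟨d, hd, hde, hsep⟩ := hM.exists_even_of_deg_two hl hinc hbe
  -- An even set meets the cut `g` in an even number of edges, and `e` is one of them.
  obtain ⟨e', he', hee, hde', hne'⟩ : ∃ e' ∈ M.edges, e' ≠ e ∧ d e' ≠ 0 ∧
      ¬ (g (M.src e') ↔ g (M.tgt e')) := by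
    by_contra! h
    have h0 := hd fun v ↦ if g v then 1 else 0
    rw [Finset.sum_eq_single e] at h0
    · rw [hde, one_mul] at h0
      by_cases i : g (M.src e) <;> by_cases j : g (M.tgt e) <;> simp [i, j] at h0 hne
    · intro e' he' hee
      by_cases hd0 : d e' = 0
      · rw [hd0, zero_mul]
      · rw [if_congr (h e' he' hee hd0) rfl rfl, CharTwo.add_self_eq_zero, mul_zero]
    · exact fun h ↦ absurd he h
  obtain ⟨w', z', b', u', hw', -, hl', hinc', hbe', -, -⟩ := cross e' he' hne'
  have hww : w' ≠ w := by
    rintro rfl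
    have := hinc ▸ hl'.mem_inc_right
    simp only [Finset.mem_insert, hee, Finset.mem_singleton, false_or] at this
    subst this
    exact hne' (hb.iff_of_src_tgt hwu)
  have hwz : w' ≠ z := by
    rintro rfl
    omega
  -- Both edges at `w'` lie in the even set, so deleting it isolates `w'`. This contradicts the
  -- choice of `d`, because both ends of `e` differ from `w'`.
  refine hww.symm (hsep (· = w') (fun a ha hda ↦ ?_) (iff_of_false hwz.symm hww.symm) w'
    hl'.right_mem w hl.right_mem rfl)
  have : a ∉ M.inc w' := by
    rw [hinc', Finset.mem_insert, Finset.mem_singleton]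
    rintro (rfl | rfl)
    · exact hde' hda
    · exact hde' ((hd.eq_of_inc_pair hinc' hbe'.symm).trans hda)
  exact iff_of_false (src_ne_of_notMem_inc ha this) (tgt_ne_of_notMem_inc ha this)

lemma Critical.exists_card_three (hM : M.Critical) : ∃ v ∈ M.verts, (M.inc v).card = 3 := by
  obtain ⟨v, hv⟩ := hM.conn.1
  rcases hM.card_inc hv with h | h
  · obtain ⟨e, w, hl⟩ := hM.exists_link_of_mem hv
    exact ⟨w, hl.right_mem, hM.card_three_of_link h hl⟩
  · exact ⟨v, hv, h⟩

lemma Critical.conn_side_three (hM : M.Critical) :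
    (M.side fun v ↦ (M.inc v).card = 3).Conn (M.side fun v ↦ (M.inc v).card = 3).edges := by
  obtain ⟨v, hv, hv3⟩ := hM.exists_card_three
  refine ⟨⟨v, mem_side_verts.2 ⟨hv, hv3⟩⟩, fun f hf x hx y hy ↦ ?_⟩
  rw [mem_side_verts] at hx hy
  exact (hM.iff_of_card_three (fun e he h1 h2 ↦
    hf e (Finset.mem_coe.2 (mem_side_edges.2 ⟨he, h1, h2⟩))) hx.1 hx.2 hy.1 hy.2).1

/-- In a critical graph, some nonempty closed set spans vertices of degree three only. -/
lemma Critical.exists_even_three (hM : M.Critical) :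
    ∃ d, M.IsEven d ∧ (∃ e ∈ M.edges, d e ≠ 0) ∧
      ∀ e ∈ M.edges, d e ≠ 0 → ∀ v, e ∈ M.inc v → (M.inc v).card = 3 := by
  by_contra! hcon
  obtain ⟨S, hS⟩ : ∃ S, S = M.side fun v ↦ (M.inc v).card = 3 := ⟨_, rfl⟩
  have hSv : ∀ v, v ∈ S.verts ↔ v ∈ M.verts ∧ (M.inc v).card = 3 := fun v ↦
    hS ▸ mem_side_verts
  have hSe : ∀ e, e ∈ S.edges ↔ e ∈ M.edges ∧ (M.inc (M.src e)).card = 3 ∧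
    (M.inc (M.tgt e)).card = 3 := fun e ↦ hS ▸ mem_side_edges
  have hSs : ∀ e, S.src e = M.src e ∧ S.tgt e = M.tgt e := by
    intro e; rw [hS]; exact ⟨rfl, rfl⟩
  have hSE : S.edges ⊆ M.edges := fun e he ↦ ((hSe e).1 he).1
  have hSc : S.Conn S.edges := hS ▸ hM.conn_side_three
  -- The connected part of degree three contains no nonempty even set, so it is a tree.
  have hScard : S.edges.card + 1 = S.verts.card := by
    rw [hSc.card_add_one_iff subset_rfl]
    intro d hd hd0 e he
    by_contra hde
    obtain ⟨e', he', hde', v, hv, hv3⟩ := hcon d (isEven_of_subset hSE hd0 fun g ↦ by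
      have := hd g
      simpa only [hSs] using this) ⟨e, hSE he, hde⟩
    have := (hSe e').1 (by_contra fun h ↦ hde' (hd0 e' h))
    rcases (mem_inc.1 hv).2 with rfl | rfl
    exacts [hv3 this.2.1, hv3 this.2.2]
  have hc : ∀ v, ∃ e, v ∈ M.verts → ∃ w, M.Link e v w := by
    intro v
    by_cases hv : v ∈ M.verts
    · obtain ⟨e, w, h⟩ := hM.exists_link_of_mem hv
      exact ⟨e, fun _ ↦ ⟨w, h⟩⟩
    · obtain ⟨u, hu⟩ := hM.conn.1
      obtain ⟨e, -⟩ := hM.exists_link_of_mem hu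
      exact ⟨e, fun h ↦ absurd h hv⟩
  choose c hc using hc
  -- The vertices of degree two; each is attached to the tree by the chosen edge `c v`.
  obtain ⟨T, hT⟩ : ∃ T : Finset α, T = (M.side fun v ↦ ¬ (M.inc v).card = 3).verts := ⟨_, rfl⟩
  have hT2 : ∀ v, v ∈ T ↔ v ∈ M.verts ∧ (M.inc v).card = 2 := by
    intro v
    rw [hT, mem_side_verts, and_congr_right_iff]
    intro hv
    have := hM.card_inc hv
    omega
  have hTc : S.verts.card + T.card = M.verts.card := by
    rw [hS, hT]
    exact card_side_verts_add
  have hinj : Set.InjOn c T := by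
    intro u hu v hv huv
    have hu := (hT2 u).1 hu
    have hv := (hT2 v).1 hv
    obtain ⟨a, ha⟩ := hc u hu.1
    obtain ⟨b, hb⟩ := hc v hv.1
    rw [huv] at ha
    rcases ha.ends hb with ⟨h, -⟩ | ⟨h, h'⟩
    · exact h
    · have := hM.card_three_of_link hv.2 hb
      rw [← h, hu.2] at this
      omega
  have hdisj : Disjoint S.edges (T.image c) := by
    rw [Finset.disjoint_left]
    intro e he he'
    obtain ⟨v, hv, rfl⟩ := Finset.mem_image.1 he'
    have hv := (hT2 v).1 hv
    obtain ⟨b, hb⟩ := hc v hv.1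
    have he := (hSe _).1 he
    rcases hb with ⟨-, ⟨h, -⟩ | ⟨-, h⟩⟩ <;> rw [h, hv.2] at he <;> omega
  refine hM.not_decomp ⟨S.edges ∪ T.image c, ?_, ⟨hM.conn.1, fun f hf ↦ ?_⟩, ?_, ?_⟩
  · refine Finset.union_subset hSE fun e he ↦ ?_
    obtain ⟨v, hv, rfl⟩ := Finset.mem_image.1 he
    obtain ⟨b, hb⟩ := hc v ((hT2 v).1 hv).1
    exact hb.mem
  · obtain ⟨s, hs⟩ := hSc.1
    have h3 : ∀ v ∈ M.verts, (M.inc v).card = 3 → (f v ↔ f s) := fun v hv hv3 ↦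
      hSc.iff (fun e he ↦ by
        rw [(hSs e).1, (hSs e).2]
        exact hf e (by simp [Finset.mem_coe.1 he])) ((hSv v).2 ⟨hv, hv3⟩) hs
    have h : ∀ v ∈ M.verts, (f v ↔ f s) := by
      intro v hv
      rcases hM.card_inc hv with h2 | h2
      · obtain ⟨b, hb⟩ := hc v hv
        have hvT : c v ∈ T.image c := Finset.mem_image_of_mem c ((hT2 v).2 ⟨hv, h2⟩)
        exact (hf.link (by simp only [Finset.coe_union]; exact Or.inr hvT) hb).trans
          (h3 b hb.right_mem (hM.card_three_of_link h2 hb))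
      · exact h3 v hv h2
    exact fun x hx y hy hxx ↦ (h y hy).2 ((h x hx).1 hxx)
  · rw [Finset.card_union_of_disjoint hdisj, Finset.card_image_of_injOn hinj]
    omega
  · intro x e he heF e' he' heF'
    obtain ⟨y, hl⟩ := exists_link he
    obtain ⟨y', hl'⟩ := exists_link he'
    rw [Finset.mem_union, not_or] at heF heF'
    rcases hM.card_inc hl.left_mem with hx | hx
    · obtain ⟨b, hb⟩ := hc x hl.left_mem
      obtain ⟨b', _, -, hinc, -⟩ := exists_inc_eq_pair hx hb.mem_inc_left
      have hxT : c x ∈ T.image c := Finset.mem_image_of_mem c ((hT2 x).2 ⟨hl.left_mem, hx⟩)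
      have key : ∀ e ∈ M.inc x, e ∉ T.image c → e = b' := by
        intro e he heT
        rw [hinc, Finset.mem_insert, Finset.mem_singleton] at he
        exact he.resolve_left fun h ↦ heT (h ▸ hxT)
      rw [key e he heF.2, key e' he' heF'.2]
    · have key : ∀ e y, M.Link e x y → e ∉ S.edges → (M.inc y).card = 2 := by
        intro e y hl he
        refine (hM.card_inc hl.right_mem).resolve_right fun h ↦ he ((hSe e).2 ⟨hl.mem, ?_⟩)
        rcases hl with ⟨-, ⟨h1, h2⟩ | ⟨h1, h2⟩⟩ <;> rw [h1, h2]
        exacts [⟨hx, h⟩, ⟨h, hx⟩]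
      -- An omitted edge at a vertex of degree three leads to a vertex of degree two, and two such
      -- vertices have no common neighbour.
      have hyy : y = y' := by
        by_contra hne
        exact hM.not_link_link_of_card_two (key e y hl heF.1) (key e' y' hl' heF'.1) hne hl.symm
          hl'.symm
      exact hM.eq_of_link hl (hyy ▸ hl')

end FinGraph

/-! ### Passage between multigraphs and oriented finite multigraphs -/

open Graph

variable {α β : Type*} {G H C : Graph α β} {M : FinGraph α β} {e : β} {x y : α}

namespace FinGraph

/-- The multigraph underlying an oriented finite multigraph. -/
def toGraph (M : FinGraph α β) : Graph α β where
  vertexSet := M.verts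
  IsLink := M.Link
  isLink_symm _ _ := ⟨fun _ _ ↦ Link.symm⟩
  eq_or_eq_of_isLink_of_isLink _ _ _ _ _ h h' :=
    (h.ends h').imp And.left And.left
  left_mem_of_isLink _ _ _ h := h.left_mem

/-- `M` is an orientation of the multigraph `G`. -/
structure Rep (M : FinGraph α β) (G : Graph α β) : Prop where
  mem_verts : ∀ x, x ∈ V(G) ↔ x ∈ M.verts
  isLink : ∀ e x y, G.IsLink e x y ↔ M.Link e x y

lemma rep_toGraph (M : FinGraph α β) : Rep M M.toGraph where
  mem_verts _ := Iff.rfl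
  isLink _ _ _ := Iff.rfl

lemma exists_rep (hl : G.Loopless) (hV : V(G).Finite) (hE : E(G).Finite)
    (hne : V(G).Nonempty) : ∃ M : FinGraph α β, Rep M G := by
  obtain ⟨v, -⟩ := hne
  have h : ∀ e, ∃ p : α × α, e ∈ E(G) → G.IsLink e p.1 p.2 := by
    intro e
    by_cases he : e ∈ E(G)
    · obtain ⟨x, y, h⟩ := exists_isLink_of_mem_edgeSet he
      exact ⟨(x, y), fun _ ↦ h⟩
    -- Arbitrary ends for elements of `β` that are not edges.
    · exact ⟨(v, v), fun h ↦ absurd h he⟩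
  choose p hp using h
  refine ⟨⟨hV.toFinset, hE.toFinset, fun e ↦ (p e).1, fun e ↦ (p e).2, ?_, ?_, ?_⟩, ?_, ?_⟩
  · intro e he
    rw [Set.Finite.mem_toFinset] at he ⊢
    exact (hp e he).left_mem
  · intro e he
    rw [Set.Finite.mem_toFinset] at he ⊢
    exact (hp e he).right_mem
  · intro e he
    rw [Set.Finite.mem_toFinset] at he
    exact (hp e he).ne
  · intro x
    rw [Set.Finite.mem_toFinset]
  · intro e x y
    unfold Link
    rw [Set.Finite.mem_toFinset]
    constructor
    · intro h
      refine ⟨h.edge_mem, ?_⟩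
      exact (hp e h.edge_mem).eq_and_eq_or_eq_and_eq h
    · rintro ⟨he, ⟨h1, h2⟩ | ⟨h1, h2⟩⟩
      · exact h1 ▸ h2 ▸ hp e he
      · exact h1 ▸ h2 ▸ (hp e he).symm

namespace Rep

lemma mem_edges (h : Rep M G) (e : β) : e ∈ E(G) ↔ e ∈ M.edges := by
  rw [edge_mem_iff_exists_isLink]
  constructor
  · rintro ⟨x, y, hl⟩
    exact ((h.isLink _ _ _).1 hl).mem
  · intro he
    exact ⟨_, _, (h.isLink _ _ _).2 (link_src_tgt he)⟩

lemma inc (h : Rep M G) : G.Inc e x ↔ e ∈ M.inc x := by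
  constructor
  · rintro ⟨y, hl⟩
    exact ((h.isLink _ _ _).1 hl).mem_inc_left
  · intro he
    obtain ⟨y, hl⟩ := exists_link he
    exact ⟨y, (h.isLink _ _ _).2 hl⟩

lemma degree (h : Rep M G) (x : α) : degree G x = (M.inc x).card := by
  rw [TwoDecomposition.degree, ← Set.ncard_coe_finset]
  congr 1
  ext e
  exact h.inc

lemma vertexSet (h : Rep M G) : V(G) = M.verts := Set.ext h.mem_verts

lemma edgeSet (h : Rep M G) : E(G) = M.edges := Set.ext h.mem_edges

lemma size (h : Rep M G) : size G = M.verts.card + M.edges.card := by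
  rw [TwoDecomposition.size, h.vertexSet, h.edgeSet, Set.ncard_coe_finset, Set.ncard_coe_finset]

lemma loopless (h : Rep M G) : G.Loopless :=
  ⟨fun e x hx ↦ ((h.isLink e x x).1 hx).ne rfl⟩

/-- A predicate uncut by `F` propagates along walks; conversely, the predicate "reachable from `x`"
is uncut by `F`. -/
lemma isConnected_iff (h : Rep M G) {F : Set β} (hV : V(H) = V(G))
    (hF : F ⊆ M.edges) (hl : ∀ e x y, H.IsLink e x y ↔ G.IsLink e x y ∧ e ∈ F) :
    IsConnected H ↔ M.Conn F := by
  unfold IsConnected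
  rw [hV, h.vertexSet]
  constructor
  · rintro ⟨hne, hc⟩
    refine ⟨hne, fun f hf x hx y hy ↦ ?_⟩
    have hxy := hc x hx y hy
    induction hxy with
    | refl => exact id
    | tail _ h' ih =>
      obtain ⟨e, he⟩ := h'
      rw [hl, h.isLink] at he
      exact fun hfx ↦ (hf.link he.2 he.1).1 (ih he.1.left_mem hfx)
  · rintro ⟨hne, hc⟩
    refine ⟨hne, fun x hx y hy ↦ hc (Relation.ReflTransGen H.Adj x) (fun e he ↦ ?_) x hx y hy .refl⟩
    have hlink : H.IsLink e (M.src e) (M.tgt e) :=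
      (hl _ _ _).2 ⟨(h.isLink _ _ _).2 (link_src_tgt (hF he)), he⟩
    exact ⟨fun h' ↦ h'.tail hlink.adj, fun h' ↦ h'.tail hlink.symm.adj⟩

lemma isConnected_self_iff (h : Rep M G) : IsConnected G ↔ M.Conn M.edges :=
  h.isConnected_iff rfl subset_rfl fun e _ _ ↦
    ⟨fun hl ↦ ⟨hl, (h.mem_edges e).1 hl.edge_mem⟩, And.left⟩

lemma isConnected_deleteEdges_iff (h : Rep M G) (F : Set β) :
    IsConnected (G.deleteEdges F) ↔ M.Conn (M.edges \ F) :=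
  h.isConnected_iff rfl Set.sdiff_subset fun e _ _ ↦ by
    rw [deleteEdges_isLink]
    exact and_congr_right fun hl ↦ ⟨fun he ↦ ⟨(h.mem_edges e).1 hl.edge_mem, he⟩, And.right⟩

end Rep

/-! ### Cycles and the cycle space -/

/-- Exchanging the sums over edges and vertices, each `g x` is counted once for every edge of `S` at
`x`, an even number of times. -/
lemma isEven_of_even_card {S : Finset β} (hS : S ⊆ M.edges)
    (hc : ∀ x, Even ({e ∈ S | e ∈ M.inc x}).card) :
    M.IsEven (fun e ↦ if e ∈ S then 1 else 0) := by
  refine isEven_indicator S hS fun g ↦ ?_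
  have h1 : ∀ e ∈ S, g (M.src e) + g (M.tgt e) =
      ∑ x ∈ M.verts, if e ∈ M.inc x then g x else 0 := by
    intro e he
    have heM := hS he
    rw [← Finset.sum_filter, ← Finset.sum_pair (M.src_ne_tgt e heM)]
    refine Finset.sum_congr ?_ fun _ _ ↦ rfl
    ext x
    rw [Finset.mem_insert, Finset.mem_singleton, Finset.mem_filter,
      (link_src_tgt heM).mem_inc_iff]
    constructor
    · intro h
      refine ⟨?_, h⟩
      rcases h with rfl | rfl
      exacts [M.src_mem e heM, M.tgt_mem e heM]
    · exact And.right
  rw [Finset.sum_congr rfl h1, Finset.sum_comm]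
  refine Finset.sum_eq_zero fun x _ ↦ ?_
  rw [← Finset.sum_filter, Finset.sum_const, nsmul_eq_mul]
  obtain ⟨k, hk⟩ := hc x
  rw [hk, Nat.cast_add, CharTwo.add_self_eq_zero, zero_mul]

lemma Rep.exists_even_of_isCycle (h : Rep M G) (hC : IsCycle C) (hle : C ≤ G) :
    ∃ d, M.IsEven d ∧ (∃ e ∈ M.edges, d e ≠ 0) ∧ ∀ e, d e ≠ 0 ↔ e ∈ E(C) := by
  have hE : ∀ e ∈ E(C), e ∈ M.edges := fun e he ↦ (h.mem_edges e).1 (hle.edgeSet_mono he)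
  have hinc : ∀ e x, e ∈ E(C) → (C.Inc e x ↔ e ∈ M.inc x) := fun e x he ↦
    (hle.inc_congr he).trans h.inc
  have hd : ∀ e, (if e ∈ hC.finite_edgeSet.toFinset then 1 else 0 : ZMod 2) ≠ 0 ↔ e ∈ E(C) := by
    intro e
    by_cases he : e ∈ E(C) <;> simp [he]
  refine ⟨_, isEven_of_even_card (S := hC.finite_edgeSet.toFinset)
    (fun e he ↦ hE e (by simpa using he)) fun x ↦ ?_, ?_, hd⟩
  · have h1 : ({e ∈ hC.finite_edgeSet.toFinset | e ∈ M.inc x}).card =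
        TwoDecomposition.degree C x := by
      rw [TwoDecomposition.degree, ← Set.ncard_coe_finset]
      congr 1
      ext e
      simp only [Finset.coe_filter, Set.Finite.mem_toFinset, Set.mem_ofPred_eq,
        Graph.mem_incidenceSet]
      exact ⟨fun he ↦ (hinc e x he.1).2 he.2, fun he ↦ ⟨he.edge_mem, (hinc e x he.edge_mem).1 he⟩⟩
    rw [h1]
    by_cases hx : x ∈ V(C)
    · rw [hC.degree_eq_two x hx]
      exact even_two
    · have : C.incidenceSet x = ∅ := Set.eq_empty_of_forall_notMem fun e he ↦ hx he.vertex_mem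
      rw [TwoDecomposition.degree, this, Set.ncard_empty]
      exact Even.zero
  · obtain ⟨v, hv⟩ := hC.connected.1
    obtain ⟨e, he⟩ := Set.nonempty_of_ncard_ne_zero (s := C.incidenceSet v)
      (by have := hC.degree_eq_two v hv; unfold TwoDecomposition.degree at this; omega)
    exact ⟨e, hE e he.edge_mem, (hd e).2 he.edge_mem⟩

/-- The cycle is the component, in the support of `d`, of an end of a support edge. Each of its
vertices has a positive, even number of support edges and at most three, hence exactly two. -/
lemma Rep.exists_isCycle (h : Rep M G) (hdeg : ∀ x ∈ M.verts, (M.inc x).card ≤ 3)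
    {d : β → ZMod 2} (hd : M.IsEven d) (hd0 : ∃ e ∈ M.edges, d e ≠ 0) :
    ∃ C ≤ G, IsCycle C ∧ ∀ e ∈ E(C), d e ≠ 0 := by
  obtain ⟨e₀, he₀, hde₀⟩ := hd0
  set A : α → α → Prop := fun u v ↦ ∃ e, M.Link e u v ∧ d e ≠ 0 with hA
  have hA0 : A (M.src e₀) (M.tgt e₀) := ⟨e₀, link_src_tgt he₀, hde₀⟩
  have hAs : ∀ u v, A u v → A v u := fun u v ⟨e, he, hde⟩ ↦ ⟨e, he.symm, hde⟩
  set S : α → Prop := Relation.ReflTransGen A (M.src e₀) with hS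
  have hSn : ∀ x, S x → ∃ y, A x y := by
    intro x hx
    rcases Relation.ReflTransGen.cases_tail hx with h | ⟨y, -, h⟩
    · exact ⟨_, h ▸ hA0⟩
    · exact ⟨y, hAs _ _ h⟩
  obtain ⟨C, hCv, hCl⟩ : ∃ C : Graph α β, V(C) = {x | S x} ∧
      ∀ e x y, C.IsLink e x y ↔ M.Link e x y ∧ d e ≠ 0 ∧ S x ∧ S y :=
    ⟨{ vertexSet := {x | S x}
       IsLink := fun e x y ↦ M.Link e x y ∧ d e ≠ 0 ∧ S x ∧ S y
       isLink_symm := fun _ _ ↦ ⟨fun _ _ h ↦ ⟨h.1.symm, h.2.1, h.2.2.2, h.2.2.1⟩⟩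
       eq_or_eq_of_isLink_of_isLink := fun _ _ _ _ _ h h' ↦
        (h.1.ends h'.1).imp And.left And.left
       left_mem_of_isLink := fun _ _ _ h ↦ h.2.2.1 }, rfl, fun _ _ _ ↦ Iff.rfl⟩
  have hCV : ∀ x, x ∈ V(C) ↔ S x := fun x ↦ by rw [hCv]; rfl
  have hSA : ∀ x y, S x → A x y → S y := fun x y hx hxy ↦ hx.tail hxy
  have hCE : ∀ e ∈ E(C), e ∈ M.edges ∧ d e ≠ 0 := by
    intro e he
    obtain ⟨x, y, hl⟩ := exists_isLink_of_mem_edgeSet he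
    rw [hCl] at hl
    exact ⟨hl.1.mem, hl.2.1⟩
  have hle : C ≤ G := by
    refine ⟨fun x hx ↦ ?_, fun e x y hl ↦ (h.isLink _ _ _).2 ((hCl e x y).1 hl).1⟩
    obtain ⟨y, e, he, -⟩ := hSn x ((hCV x).1 hx)
    exact (h.mem_verts x).2 he.left_mem
  refine ⟨C, hle, ⟨⟨fun e x hx ↦ ((hCl e x x).1 hx).1.ne rfl⟩, ?_, ?_, ⟨?_, ?_⟩, ?_⟩,
    fun e he ↦ (hCE e he).2⟩
  · exact M.verts.finite_toSet.subset fun x hx ↦ (h.mem_verts x).1 (hle.vertexSet_mono hx)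
  · exact M.edges.finite_toSet.subset fun e he ↦ (hCE e he).1
  · exact ⟨M.src e₀, (hCV _).2 .refl⟩
  · have key : ∀ x, S x → Relation.ReflTransGen C.Adj (M.src e₀) x ∧
        Relation.ReflTransGen C.Adj x (M.src e₀) := by
      intro x hx
      induction hx with
      | refl => exact ⟨.refl, .refl⟩
      | tail hb hbc ih =>
        have hc := hb.tail hbc
        obtain ⟨e, he, hde⟩ := hbc
        have hl := (hCl e _ _).2 ⟨he, hde, hb, hc⟩
        exact ⟨ih.1.tail hl.adj, ih.2.head hl.symm.adj⟩
    exact fun x hx y hy ↦ (key x ((hCV x).1 hx)).2.trans (key y ((hCV y).1 hy)).1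
  · intro x hx
    rw [hCV] at hx
    have h1 : TwoDecomposition.degree C x = ({e ∈ M.inc x | d e ≠ 0}).card := by
      rw [TwoDecomposition.degree, ← Set.ncard_coe_finset]
      congr 1
      ext e
      simp only [Finset.coe_filter, Set.mem_ofPred_eq, Graph.mem_incidenceSet]
      constructor
      · rintro ⟨y, hl⟩
        rw [hCl] at hl
        exact ⟨hl.1.mem_inc_left, hl.2.1⟩
      · rintro ⟨he, hde⟩
        obtain ⟨y, hl⟩ := exists_link he
        exact ⟨y, (hCl _ _ _).2 ⟨hl, hde, hx, hSA x y hx ⟨e, hl, hde⟩⟩⟩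
    obtain ⟨y, e, he, hde⟩ := hSn x hx
    have h2 : 0 < ({e ∈ M.inc x | d e ≠ 0}).card :=
      Finset.card_pos.2 ⟨e, Finset.mem_filter.2 ⟨he.mem_inc_left, hde⟩⟩
    have h3 : ({e ∈ M.inc x | d e ≠ 0}).card ≤ 3 :=
      (Finset.card_filter_le _ _).trans (hdeg x he.left_mem)
    have h4 : ((({e ∈ M.inc x | d e ≠ 0}).card : ℕ) : ZMod 2) = 0 := by
      refine Eq.trans ?_ (hd.sum_inc x)
      rw [← Finset.sum_filter_ne_zero, Finset.cast_card]
      refine Finset.sum_congr rfl fun e he ↦ ?_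
      exact (zmod_two_eq_one (Finset.mem_filter.1 he).2).symm
    rw [ZMod.natCast_eq_zero_iff_even] at h4
    obtain ⟨k, hk⟩ := h4
    omega

/-! ### Good graphs and decompositions -/

/-- An even set contains a cycle; if deleting the even set left a connected graph, so would deleting
only the cycle. -/
lemma Rep.good (h : Rep M G) (hG : MemS 1 3 G) : M.Good := by
  have hdeg : ∀ x ∈ M.verts, (M.inc x).card ≤ 3 := fun x hx ↦ by
    rw [← h.degree]
    exact hG.degree_le x ((h.mem_verts x).2 hx)
  refine ⟨h.isConnected_self_iff.1 hG.connected, fun d hd hd0 hc ↦ ?_, hdeg⟩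
  obtain ⟨C, hle, hC, hCd⟩ := h.exists_isCycle hdeg hd hd0
  refine hG.separating C hle hC ((h.isConnected_deleteEdges_iff _).2 (hc.mono ?_))
  exact fun e he ↦ ⟨he.1, fun heC ↦ hCd e heC he.2⟩

/-- The lower bound on degrees comes from connectivity together with the presence of a second
vertex. Cycles are separating because their edge sets are even. -/
lemma Rep.memS (h : Rep M G) (hM : M.Good) (hn : ∀ x, ∃ y ∈ M.verts, y ≠ x) : MemS 1 3 G where
  loopless := h.loopless
  finite_vertexSet := h.vertexSet ▸ M.verts.finite_toSet
  finite_edgeSet := h.edgeSet ▸ M.edges.finite_toSet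
  connected := h.isConnected_self_iff.2 hM.conn
  separating C hle hC hc := by
    obtain ⟨d, hd, hd0, hdC⟩ := h.exists_even_of_isCycle hC hle
    refine hM.sep d hd hd0 (((h.isConnected_deleteEdges_iff _).1 hc).mono ?_)
    exact fun e he ↦ ⟨he.1, by_contra fun h ↦ he.2 ((hdC e).1 h)⟩
  le_degree x hx := by
    rw [h.degree]
    obtain ⟨y, hy, hyx⟩ := hn x
    obtain ⟨e, -, he⟩ := hM.conn.exists_mem_inc subset_rfl ((h.mem_verts x).1 hx) hy hyx
    exact Finset.card_pos.2 ⟨e, he⟩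
  degree_le x hx := by
    rw [h.degree]
    exact hM.deg_le x ((h.mem_verts x).1 hx)

lemma Rep.hasTwoDecomposition (h : Rep M G) (hM : M.Decomp) : HasTwoDecomposition G := by
  obtain ⟨F, hF, hc, hn, hm⟩ := hM
  have hle : G.restrict F ≤ G := restrict_le
  refine ⟨G.restrict F, E(G) \ F, ⟨hle, rfl⟩, ⟨⟨?_⟩, ?_, ?_⟩, ⟨Set.sdiff_subset, ?_⟩, ?_, ?_⟩
  · exact fun e x hx ↦ h.loopless.not_isLoopAt e x (hx.mono hle)
  · refine (h.isConnected_iff (H := G.restrict F) rfl hF fun e x y ↦ ?_).2 hc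
    rw [restrict_isLink, and_comm]
  · intro C hC hcyc
    obtain ⟨d, hd, ⟨e, he, hde⟩, hdC⟩ := h.exists_even_of_isCycle hcyc (hC.trans hle)
    have hCF : ∀ e ∈ E(C), e ∈ F := fun e he ↦ (hC.edgeSet_mono he).2
    exact hde ((hc.card_add_one_iff hF).1 hn d hd
      (fun e he ↦ by_contra fun h ↦ he (hCF e ((hdC e).1 h))) e (hCF e ((hdC e).1 hde)))
  · intro e he f hf x hex hfx
    exact hm x e (h.inc.1 hex) he.2 f (h.inc.1 hfx) hf.2
  · exact Set.disjoint_left.2 fun e he he' ↦ he'.2 he.2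
  · ext e
    simp only [edgeSet_restrict, Set.mem_union, Set.mem_inter_iff, Set.mem_sdiff]
    tauto

/-- The edge count of the tree follows from acyclicity: a nonempty even set inside it would contain
a cycle, by the degree bound. -/
lemma Rep.decomp (h : Rep M G) (hdeg : ∀ x ∈ M.verts, (M.inc x).card ≤ 3)
    (hG : HasTwoDecomposition G) : M.Decomp := by
  obtain ⟨T, N, hT, htree, hN, hdisj, hun⟩ := hG
  obtain ⟨F, hFdef⟩ : ∃ F : Finset β, F = {e ∈ M.edges | e ∈ E(T)} := ⟨_, rfl⟩
  have hFT : ∀ e, e ∈ F ↔ e ∈ E(T) := by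
    intro e
    rw [hFdef, Finset.mem_filter, and_iff_right_iff_imp]
    exact fun he ↦ (h.mem_edges e).1 (hT.le.edgeSet_mono he)
  have hF : F ⊆ M.edges := hFdef ▸ Finset.filter_subset _ _
  have hTl : ∀ e x y, T.IsLink e x y ↔ G.IsLink e x y ∧ e ∈ (F : Set β) := by
    intro e x y
    rw [Finset.mem_coe, hFT]
    exact ⟨fun hl ↦ ⟨hl.mono hT.le, hl.edge_mem⟩, fun hl ↦ (hT.le.isLink_iff hl.2).2 hl.1⟩
  have hc : M.Conn F := (h.isConnected_iff hT.vertexSet_eq hF hTl).1 htree.connected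
  refine ⟨F, hF, hc, (hc.card_add_one_iff hF).2 fun d hd hd0 e he ↦ ?_, ?_⟩
  · by_contra hde
    obtain ⟨C, hle, hC, hCd⟩ := h.exists_isCycle hdeg hd ⟨e, hF he, hde⟩
    refine htree.acyclic C ⟨hT.vertexSet_eq ▸ hle.vertexSet_mono, fun e x y hl ↦ ?_⟩ hC
    exact (hTl e x y).2 ⟨hl.mono hle, by_contra fun h ↦ hCd e hl.edge_mem (hd0 e h)⟩
  · have hmem : ∀ e ∈ M.edges, e ∉ F → e ∈ N := by
      intro e he heF
      have : e ∈ E(T) ∪ N := hun ▸ (h.mem_edges e).2 he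
      exact this.resolve_left fun h ↦ heF ((hFT e).2 h)
    intro x e he heF e' he' heF'
    exact hN.2 e (hmem e (mem_inc.1 he).1 heF) e' (hmem e' (mem_inc.1 he').1 heF') x
      (h.inc.2 he) (h.inc.2 he')

end FinGraph

/-! ### From minimum counterexamples to critical graphs -/

open FinGraph

universe u v

lemma IsMinimumCounterexample.exists_critical {α : Type u} {β : Type v} {G : Graph α β}
    (hG : IsMinimumCounterexample G) : ∃ M : FinGraph α β, Rep M G ∧ M.Critical := by
  obtain ⟨⟨hS, hnd⟩, hmin⟩ := hG
  obtain ⟨M, hM⟩ := exists_rep hS.loopless hS.finite_vertexSet hS.finite_edgeSet hS.connected.1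
  refine ⟨M, hM, hM.good hS, fun h ↦ hnd (hM.hasTwoDecomposition h), fun H hH hlt ↦ ?_⟩
  by_contra hHd
  have hrep := rep_toGraph H
  -- A smaller good graph without a decomposition has at least two vertices, so it is a genuine
  -- counterexample with minimum degree at least one.
  have hn : ∀ x, ∃ y ∈ H.verts, y ≠ x := by
    by_contra! h
    obtain ⟨x, hx⟩ := h
    exact hHd (decomp_of_subsingleton hH.conn.1 hx)
  have := hmin α β H.toGraph ⟨hrep.memS hH hn, fun h ↦ hHd (hrep.decomp hH.deg_le h)⟩
  rw [hM.size, hrep.size] at this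
  omega

variable {N : FinGraph α β}

/-! ### The properties of critical graphs read in the multigraph -/

namespace FinGraph

/-- Following a 2-regular subgraph two steps in each direction from a vertex gives four distinct
edges, as there are no parallel edges and no triangles. If there is no fifth edge, the two walks
meet and close a quadrilateral. -/
lemma Critical.five_le_card (hM : M.Critical) (hl : ∀ e x y, N.Link e x y → M.Link e x y)
    (hdeg : ∀ x ∈ N.verts, (N.inc x).card = 2) (hne : N.verts.Nonempty) : 5 ≤ N.edges.card := by
  by_contra! hcard
  obtain ⟨x₀, hx₀⟩ := hne
  have hnext : ∀ e x y, N.Link e x y → ∃ e' z, e' ≠ e ∧ N.Link e' y z ∧ z ≠ x := by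
    intro e x y h
    obtain ⟨e', z, hne, -, h'⟩ := exists_inc_eq_pair (hdeg y h.right_mem) h.mem_inc_right
    refine ⟨e', z, hne, h', ?_⟩
    rintro rfl
    exact hne (hM.eq_of_link (hl _ _ _ h').symm (hl _ _ _ h))
  obtain ⟨e₁, he₁⟩ := Finset.card_pos.1 ((hdeg x₀ hx₀).symm ▸ two_pos)
  obtain ⟨x₁, h₁⟩ := exists_link he₁
  obtain ⟨e₂, x₂, h21, h₂, hx21⟩ := hnext _ _ _ h₁.symm
  obtain ⟨e₃, y₁, h31, h₃, hy10⟩ := hnext _ _ _ h₁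
  obtain ⟨e₄, y₂, h42, h₄, hy20⟩ := hnext _ _ _ h₂
  have hy12 : y₁ ≠ x₂ := by
    rintro rfl
    exact hM.no_triangle (hl _ _ _ h₁) (hl _ _ _ h₂) (hl _ _ _ h₃)
  have hy21 : y₂ ≠ x₁ := by
    rintro rfl
    exact hM.no_triangle (hl _ _ _ h₂) (hl _ _ _ h₁) (hl _ _ _ h₄)
  have h32 : e₃ ≠ e₂ := h₂.edge_ne_of_notMem h₃.mem_inc_left h₁.ne.symm hx21.symm
  have h34 : e₃ ≠ e₄ := h₄.edge_ne_of_notMem h₃.mem_inc_left hx21.symm hy21.symm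
  have h14 : e₁ ≠ e₄ := h₄.edge_ne_of_notMem h₁.mem_inc_left h₂.ne hy20.symm
  have hE : N.edges = {e₁, e₂, e₃, e₄} := by
    refine (Finset.eq_of_subset_of_card_le ?_ ?_).symm
    · simp [Finset.insert_subset_iff, h₁.mem, h₂.mem, h₃.mem, h₄.mem]
    · rw [Finset.card_insert_of_notMem (by simp [h21.symm, h31.symm, h14]),
        Finset.card_insert_of_notMem (by simp [h32.symm, h42.symm]), Finset.card_pair h34]
      omega
  -- The second edge at `y₁` can only be `e₄`, so `y₁ = y₂`.
  obtain ⟨e₅, z, h53, h₅, -⟩ := hnext _ _ _ h₃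
  have h51 : e₅ ≠ e₁ := h₁.edge_ne_of_notMem h₅.mem_inc_left hy10 h₃.ne.symm
  have h52 : e₅ ≠ e₂ := h₂.edge_ne_of_notMem h₅.mem_inc_left hy10 hy12
  have h54 : e₅ = e₄ := by simpa [hE, h51, h52, h53] using h₅.mem
  subst h54
  have hyy : y₁ = y₂ := (h₄.mem_inc_iff.1 h₅.mem_inc_left).resolve_left hy12
  subst hyy
  exact hM.no_square (hl _ _ _ h₁) (hl _ _ _ h₃) (hl _ _ _ h₄).symm (hl _ _ _ h₂) hy10.symm
    hx21.symm

lemma Rep.simple (h : Rep M G) (hM : M.Critical) : G.Simple :=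
  { h.loopless with
    eq_of_isLink := fun _ _ _ _ he he' ↦
      hM.eq_of_link ((h.isLink _ _ _).1 he) ((h.isLink _ _ _).1 he') }

lemma Rep.isEdgeConnected_two (h : Rep M G) (hM : M.Critical) : IsEdgeConnected 2 G := by
  constructor
  · obtain ⟨x, hx⟩ := hM.conn.1
    obtain ⟨y, hy, hyx⟩ := hM.nontrivial x
    exact ⟨x, (h.mem_verts x).2 hx, y, (h.mem_verts y).2 hy, hyx.symm⟩
  · intro F hF hcard
    rw [h.isConnected_deleteEdges_iff]
    have hle : F.encard ≤ 1 := Order.le_of_lt_add_one (by rwa [one_add_one_eq_two])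
    rcases Set.encard_le_one_iff_eq.1 hle with rfl | ⟨e, rfl⟩
    · simpa using hM.conn
    · simpa using hM.bridgeless ((h.mem_edges e).1 (hF rfl))

lemma Rep.five_le_girth (h : Rep M G) (hM : M.Critical) : 5 ≤ girth G := by
  refine le_iInf₂ fun C ⟨hle, hC⟩ ↦ ?_
  obtain ⟨N, hN⟩ := exists_rep hC.loopless hC.finite_vertexSet hC.finite_edgeSet hC.connected.1
  have := hM.five_le_card (N := N)
    (fun e x y hl ↦ (h.isLink _ _ _).1 (((hN.isLink _ _ _).2 hl).mono hle))
    (fun x hx ↦ by rw [← hN.degree]; exact hC.degree_eq_two x ((hN.mem_verts x).2 hx))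
    (by obtain ⟨v, hv⟩ := hC.connected.1; exact ⟨v, (hN.mem_verts v).1 hv⟩)
  rw [hN.edgeSet, Set.encard_coe_eq_coe_finsetCard]
  exact_mod_cast this

lemma Rep.mem_verticesOfDegree (h : Rep M G) {k : ℕ} :
    x ∈ verticesOfDegree G k ↔ x ∈ M.verts ∧ (M.inc x).card = k := by
  rw [verticesOfDegree, Set.mem_ofPred_eq, h.mem_verts, h.degree]

lemma Rep.three_le_dist (h : Rep M G) (hM : M.Critical) (x y : V(G))
    (hx : x.1 ∈ verticesOfDegree G 2) (hy : y.1 ∈ verticesOfDegree G 2) (hxy : x ≠ y) : 3 ≤ dist G x y := by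
  rw [h.mem_verticesOfDegree] at hx hy
  -- Distance above two means distinct, non-adjacent and without a common neighbour.
  have hlt : 2 < G.toSimpleGraph.edist x y := by
    rw [SimpleGraph.two_lt_edist_iff]
    refine ⟨hxy, ?_, Set.eq_empty_of_forall_notMem fun z hz ↦ ?_⟩
    · rintro ⟨-, e, he⟩
      exact hM.not_link_of_card_two hx.2 hy.2 ((h.isLink _ _ _).1 he)
    · obtain ⟨⟨-, e, he⟩, ⟨-, e', he'⟩⟩ := hz
      exact hM.not_link_link_of_card_two hx.2 hy.2 (Subtype.coe_ne_coe.2 hxy)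
        ((h.isLink _ _ _).1 he) ((h.isLink _ _ _).1 he')
  have := Order.add_one_le_of_lt hlt
  rwa [two_add_one_eq_three] at this

lemma Rep.isConnected_deleteVerts (h : Rep M G) (hM : M.Critical) :
    IsConnected (G.deleteVerts (verticesOfDegree G 2)) := by
  have hV : ∀ x, x ∈ V(G.deleteVerts (verticesOfDegree G 2)) ↔
      x ∈ M.verts ∧ (M.inc x).card = 3 := by
    intro x
    rw [vertexSet_deleteVerts, Set.mem_sdiff, h.mem_verts, h.mem_verticesOfDegree]
    constructor
    · rintro ⟨hx, hx'⟩
      exact ⟨hx, (hM.card_inc hx).resolve_left fun h ↦ hx' ⟨hx, h⟩⟩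
    · rintro ⟨hx, hx'⟩
      exact ⟨hx, fun h ↦ by omega⟩
  constructor
  · obtain ⟨v, hv⟩ := hM.exists_card_three
    exact ⟨v, (hV v).2 hv⟩
  · intro x hx y hy
    rw [hV] at hx hy
    refine (hM.iff_of_card_three
      (f := Relation.ReflTransGen (G.deleteVerts (verticesOfDegree G 2)).Adj x)
      (fun e he h1 h2 ↦ ?_) hx.1 hx.2 hy.1 hy.2).1 .refl
    have hl : (G.deleteVerts (verticesOfDegree G 2)).IsLink e (M.src e) (M.tgt e) := by
      rw [deleteVerts_isLink, h.isLink, h.mem_verticesOfDegree, h.mem_verticesOfDegree]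
      exact ⟨link_src_tgt he, fun h ↦ by omega, fun h ↦ by omega⟩
    exact ⟨fun h' ↦ h'.tail hl.adj, fun h' ↦ h'.tail hl.symm.adj⟩

lemma Rep.exists_isCycle_verticesOfDegree_three (h : Rep M G) (hM : M.Critical) :
    ∃ C ≤ G, IsCycle C ∧ V(C) ⊆ verticesOfDegree G 3 := by
  obtain ⟨d, hd, hd0, hd3⟩ := hM.exists_even_three
  obtain ⟨C, hle, hC, hCd⟩ := h.exists_isCycle hM.deg_le hd hd0
  refine ⟨C, hle, hC, fun x hx ↦ ?_⟩
  obtain ⟨e, he⟩ := Set.nonempty_of_ncard_ne_zero (s := C.incidenceSet x)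
    (by have := hC.degree_eq_two x hx; unfold TwoDecomposition.degree at this; omega)
  rw [h.mem_verticesOfDegree]
  have hinc := h.inc.1 (Graph.Inc.mono hle he)
  exact ⟨(h.mem_verts x).1 (hle.vertexSet_mono hx),
    hd3 e (mem_inc.1 hinc).1 (hCd e he.edge_mem) x hinc⟩

end FinGraph

end TwoDecomposition

theorem theorem3p3 {α : Type*} {β : Type*} (G : Graph α β)
    (hG : TwoDecomposition.IsMinimumCounterexample G) :
    (G.Simple ∧ TwoDecomposition.IsEdgeConnected 2 G) ∧
    5 ≤ TwoDecomposition.girth G ∧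
    (∀ x y : Graph.vertexSet G, x.1 ∈ TwoDecomposition.verticesOfDegree G 2 →
      y.1 ∈ TwoDecomposition.verticesOfDegree G 2 → x ≠ y → 3 ≤ TwoDecomposition.dist G x y) ∧
    TwoDecomposition.IsConnected (G.deleteVerts (TwoDecomposition.verticesOfDegree G 2)) ∧
    (∃ C : Graph α β, C ≤ G ∧ TwoDecomposition.IsCycle C ∧
      Graph.vertexSet C ⊆ TwoDecomposition.verticesOfDegree G 3) := by
  obtain ⟨M, h, hM⟩ := hG.exists_critical
  exact ⟨⟨h.simple hM, h.isEdgeConnected_two hM⟩, h.five_le_girth hM, h.three_le_dist hM,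
    h.isConnected_deleteVerts hM, h.exists_isCycle_verticesOfDegree_three hM⟩
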